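/- **Conventions.** Manifolds and tensors are smooth; manifolds are Hausdorff and second countable. A *statistical manifold* $(M,g_M,D)$ *of constant curvature* $c\in\mathbb R$ is a manifold $M$ with a Riemannian metric $g_M$ and a torsion-free affine connection $D$ such that $Dg_M$ is totally symmetric and the curvature tensor of $D$ satisfies $\Theta_D(X,Y)Z=c\,(g_M(Y,Z)X-g_M(X,Z)Y)$. An *automorphism* of it is a diffeomorphism preserving $g_M$ and $D$. A *locally conformally Hessian (l.c.H.) manifold* $(C,\nabla,g,\theta)$ is a manifold $C$ with a flat torsion-free connection $\nabla$, a Riemannian metric $g$ and a closed $1$-form $\theta$ (the *Lee form*) such that $\nabla g-\theta\otimes g$ is totally symmetric; $\xi=\theta^\sharp$ is its *Lee field*. A vector field is *affine* if its local flows preserve $\nabla$. The l.c.H. manifold is *radiant* if $\xi$ is Killing and $\nabla\xi=\mu\,\mathrm{Id}$ for some constant $\mu\in\mathbb R$. For connected $C$, its *l.c.H. rank* is the rank of the abelian group $\operatorname{Im}\chi\subset\mathbb R^{>0}$, where $\chi:\pi_1(C,x_0)\to\mathbb R^{>0}$, $\chi(\gamma)=e^{-\int_\gamma\theta}$. **Theorem.**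 Let $(M,g_M,D)$ be a connected statistical manifold of constant curvature $c\in\mathbb R$, let $\varphi$ be an automorphism of it, and let $q>0$, $q\neq 1$. Put $\varphi_q(m,s)=(\varphi(m),qs)$ on $M\times\mathbb R^{>0}$, where $s$ is the coordinate of $\mathbb R^{>0}$, and let $C=(M\times\mathbb R^{>0})/\varphi_q$ be the quotient by the group generated by $\varphi_q$. Then $C$ is a (Hausdorff, second countable) manifold, the projection $M\times\mathbb R^{>0}\to C$ being a local diffeomorphism, and: 1. For every $\lambda\in\mathbb R$ with $\lambda(2-\lambda)=c$ (such $\lambda$ exists if and only if $c\le 1$) there is a connection $\nabla$ on $C$ such that $(C,\nabla,g,\theta)$ is an l.c.H. manifold, where $g$, $\theta$ are induced by the $\varphi_q$-invariant tensors $g_M+\frac{ds^2}{s^2}$ and $-\frac{2\,ds}{s}$. Its Lee field is the field $\xi$ induced by $-2s\partial_s$; it is affine and Killing and satisfies $\nabla\xi=-2\lambda\,\mathrm{Id}$. In particular this structure is radiant, and its l.c.H. rank is $1$. 2. For every $c$, also if $c>1$, $C$ admits a radiant l.c.H. structure of l.c.H. rank $1$. If $c\ne0$, it can be chosen so that the constant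 $\mu$ with $\nabla\xi=\mu\,\mathrm{Id}$ is different from $0$ and, at every point, from $-g(\xi,\xi)$. -/

import Mathlib

open Bundle Set
open scoped Manifold ContDiff

noncomputable section

namespace LCHGeometry

section General

variable {E : Type*} [NormedAddCommGroup E] [NormedSpace ℝ E]
  {H : Type*} [TopologicalSpace H] {I : ModelWithCorners ℝ E H}
  {M : Type*} [TopologicalSpace M] [ChartedSpace H M]

/-! ### Vector fields, metrics, one-forms and affine connections -/

/-- A vector field `X` on `M` is smooth. -/
def SmoothVF [IsManifold I ∞ M] (X : Π x : M, TangentSpace I x) : Prop :=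
  ContMDiff I I.tangent ∞ (fun x ↦ (⟨x, X x⟩ : TangentBundle I M))

variable (I M) in
/-- Smooth Riemannian metrics on `M`. -/
abbrev RiemMetric [IsManifold I ∞ M] :=
  Bundle.ContMDiffRiemannianMetric I ∞ E (fun x : M ↦ TangentSpace I x)

variable (I M) in
/-- Affine connections (Koszul connections on the tangent bundle).
Caution: `∇ Y x (X x)` is what is written `(∇_X Y)(x)` on paper. -/
abbrev Connection [IsManifold I ∞ M] :=
  CovariantDerivative I E (fun x : M ↦ TangentSpace I x)

/-- A `1`-form `θ` is smooth. -/
def SmoothForm [IsManifold I ∞ M] (θ : Π x : M, TangentSpace I x →L[ℝ] ℝ) : Prop :=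
  ContMDiff I (I.prod 𝓘(ℝ, E →L[ℝ] ℝ)) ∞
    (fun x ↦ TotalSpace.mk' (E →L[ℝ] ℝ) (E := fun x : M ↦ TangentSpace I x →L[ℝ] ℝ) x (θ x))

/-- `dθ = 0`, where `dθ(X, Y) = X(θ(Y)) - Y(θ(X)) - θ([X, Y])`. -/
def ClosedForm [IsManifold I ∞ M] (θ : Π x : M, TangentSpace I x →L[ℝ] ℝ) : Prop :=
  ∀ X Y : Π x : M, TangentSpace I x, SmoothVF X → SmoothVF Y → ∀ x : M,
    mvfderiv I (fun y ↦ θ y (Y y)) x (X x) - mvfderiv I (fun y ↦ θ y (X y)) x (Y x)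
      - θ x (VectorField.mlieBracket I X Y x) = 0

/-- The connection is smooth: it maps smooth sections to smooth sections. -/
def SmoothConnection [IsManifold I ∞ M] (D : Connection I M) : Prop :=
  CovariantDerivative.ContMDiffCovariantDerivative D ∞

/-- The connection has vanishing torsion tensor. -/
def TorsionFree [FiniteDimensional ℝ E] [IsManifold I ∞ M] (D : Connection I M) : Prop :=
  haveI : CompleteSpace E := FiniteDimensional.complete ℝ E
  haveI : IsManifold I 2 M := IsManifold.of_le (n := ∞) (by norm_cast)
  ∀ x : M, CovariantDerivative.torsion D x = 0

/-- The curvature `Θ_D(X, Y) Z = D_X D_Y Z - D_Y D_X Z - D_{[X, Y]} Z` at the point `x`. -/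
def curvature [IsManifold I ∞ M] (D : Connection I M) (X Y Z : Π x : M, TangentSpace I x)
    (x : M) : TangentSpace I x :=
  D (fun y ↦ D Z y (Y y)) x (X x) - D (fun y ↦ D Z y (X y)) x (Y x)
    - D Z x (VectorField.mlieBracket I X Y x)

/-- `(D g)(X, Y, Z) = (D_X g)(Y, Z) = X(g(Y, Z)) - g(D_X Y, Z) - g(Y, D_X Z)` at the point `x`. -/
def nablaMetric [IsManifold I ∞ M] (D : Connection I M) (g : RiemMetric I M)
    (X Y Z : Π x : M, TangentSpace I x) (x : M) : ℝ :=
  mvfderiv I (fun y ↦ g.inner y (Y y) (Z y)) x (X x)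
    - g.inner x (D Y x (X x)) (Z x) - g.inner x (Y x) (D Z x (X x))

/-- A covariant `3`-tensor, given by its values on vector fields, is totally symmetric
(the two transpositions generate the symmetric group on three letters). -/
def TotallySymmetric [IsManifold I ∞ M]
    (T : (X Y Z : Π x : M, TangentSpace I x) → M → ℝ) : Prop :=
  ∀ X Y Z : Π x : M, TangentSpace I x, SmoothVF X → SmoothVF Y → SmoothVF Z → ∀ x : M,
    T X Y Z x = T Y X Z x ∧ T X Y Z x = T X Z Y x

/-! ### Statistical manifolds -/

/-- `(M, D, g)` is a statistical manifold: `D` is a torsion-free connection and `D g` is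
totally symmetric. -/
structure IsStatistical [FiniteDimensional ℝ E] [IsManifold I ∞ M]
    (D : Connection I M) (g : RiemMetric I M) : Prop where
  smooth : SmoothConnection D
  torsionFree : TorsionFree D
  symmetric : TotallySymmetric (nablaMetric D g)

/-- `Θ_D(X, Y) Z = c (g(Y, Z) X - g(X, Z) Y)`. -/
def HasConstantCurvature [IsManifold I ∞ M] (D : Connection I M) (g : RiemMetric I M)
    (c : ℝ) : Prop :=
  ∀ X Y Z : Π x : M, TangentSpace I x, SmoothVF X → SmoothVF Y → SmoothVF Z → ∀ x : M,
    curvature D X Y Z x = c • (g.inner x (Y x) (Z x) • X x - g.inner x (X x) (Z x) • Y x)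

/-- The map `ψ`, considered on the open set `U`, preserves the connection `D`:
`ψ_*(D_X Y) = D_{ψ_* X} ψ_* Y`, expressed through `ψ`-related pairs of vector fields. -/
def PreservesConnection [IsManifold I ∞ M] (D : Connection I M) (U : Set M) (ψ : M → M) : Prop :=
  ∀ X Y X' Y' : Π x : M, TangentSpace I x,
    SmoothVF X → SmoothVF Y → SmoothVF X' → SmoothVF Y' →
    (∀ x ∈ U, mfderiv I I ψ x (X x) = X' (ψ x)) →
    (∀ x ∈ U, mfderiv I I ψ x (Y x) = Y' (ψ x)) →
    ∀ x ∈ U, mfderiv I I ψ x (D Y x (X x)) = D Y' (ψ x) (X' (ψ x))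

/-- The map `ψ` pulls the metric `g` back to itself. -/
def PreservesMetric [IsManifold I ∞ M] (g : RiemMetric I M) (ψ : M → M) : Prop :=
  ∀ (x : M) (v w : TangentSpace I x),
    g.inner (ψ x) (mfderiv I I ψ x v) (mfderiv I I ψ x w) = g.inner x v w

/-- Automorphisms of a statistical manifold: diffeomorphisms preserving the metric and the
connection. -/
structure IsStatisticalAut [IsManifold I ∞ M] (D : Connection I M) (g : RiemMetric I M)
    (φ : Diffeomorph I I M M ∞) : Prop where
  metric : PreservesMetric g φ
  connection : PreservesConnection D univ φ

/-! ### Locally conformally Hessian manifolds -/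

/-- `(M, ∇)` is a flat affine manifold: `∇` is a flat torsion-free connection. -/
structure IsFlatAffine [FiniteDimensional ℝ E] [IsManifold I ∞ M]
    (D : Connection I M) : Prop where
  smooth : SmoothConnection D
  torsionFree : TorsionFree D
  flat : ∀ X Y Z : Π x : M, TangentSpace I x, SmoothVF X → SmoothVF Y → SmoothVF Z → ∀ x : M,
    curvature D X Y Z x = 0

/-- `(M, ∇, g, θ)` is a locally conformally Hessian manifold with Lee form `θ`: `∇` is a flat
affine structure, `θ` is a closed `1`-form and `∇ g - θ ⊗ g` is totally symmetric. -/
structure IsLCH [FiniteDimensional ℝ E] [IsManifold I ∞ M] (D : Connection I M)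
    (g : RiemMetric I M) (θ : Π x : M, TangentSpace I x →L[ℝ] ℝ) : Prop where
  flatAffine : IsFlatAffine D
  smoothForm : SmoothForm θ
  closed : ClosedForm θ
  symmetric : TotallySymmetric
    (fun X Y Z x ↦ nablaMetric D g X Y Z x - θ x (X x) * g.inner x (Y x) (Z x))

/-- `ξ` is the Lee field `θ^♯`, the vector field dual to `θ` with respect to `g`. -/
def IsLeeField [IsManifold I ∞ M] (g : RiemMetric I M) (θ : Π x : M, TangentSpace I x →L[ℝ] ℝ)
    (ξ : Π x : M, TangentSpace I x) : Prop :=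
  ∀ (x : M) (v : TangentSpace I x), g.inner x (ξ x) v = θ x v

/-- `ξ` is a Killing field: it is smooth and `L_ξ g = 0`, where
`(L_ξ g)(Y, Z) = ξ(g(Y, Z)) - g([ξ, Y], Z) - g(Y, [ξ, Z])`. -/
def IsKilling [IsManifold I ∞ M] (g : RiemMetric I M) (ξ : Π x : M, TangentSpace I x) : Prop :=
  SmoothVF ξ ∧
  ∀ Y Z : Π x : M, TangentSpace I x, SmoothVF Y → SmoothVF Z → ∀ x : M,
    mvfderiv I (fun y ↦ g.inner y (Y y) (Z y)) x (ξ x)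
      - g.inner x (VectorField.mlieBracket I ξ Y x) (Z x)
      - g.inner x (Y x) (VectorField.mlieBracket I ξ Z x) = 0

/-- `ξ` is an affine field: it is smooth and its (local) flows preserve `∇`. -/
def IsAffineField [IsManifold I ∞ M] (D : Connection I M)
    (ξ : Π x : M, TangentSpace I x) : Prop :=
  SmoothVF ξ ∧
  ∀ (U : Set M) (ε : ℝ) (ψ : ℝ → M → M), IsOpen U → 0 < ε →
    ContMDiffOn (𝓘(ℝ, ℝ).prod I) I ∞ (fun p : ℝ × M ↦ ψ p.1 p.2) (Ioo (-ε) ε ×ˢ U) →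
    (∀ x ∈ U, ψ 0 x = x ∧ IsMIntegralCurveOn (fun t ↦ ψ t x) ξ (Ioo (-ε) ε)) →
    ∀ t ∈ Ioo (-ε) ε, PreservesConnection D U (ψ t)

/-- `∇ ξ = μ Id`. -/
def NablaEqSmulId [IsManifold I ∞ M] (D : Connection I M) (ξ : Π x : M, TangentSpace I x)
    (μ : ℝ) : Prop :=
  ∀ (x : M) (v : TangentSpace I x), D ξ x v = μ • v

/-- A radiant l.c.H. manifold: the Lee field `ξ` is Killing and `∇ ξ = μ Id` for a constant
`μ`. -/
structure IsRadiantLCH [FiniteDimensional ℝ E] [IsManifold I ∞ M] (D : Connection I M)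
    (g : RiemMetric I M) (θ : Π x : M, TangentSpace I x →L[ℝ] ℝ)
    (ξ : Π x : M, TangentSpace I x) : Prop where
  lch : IsLCH D g θ
  lee : IsLeeField g θ ξ
  killing : IsKilling g ξ
  radiant : ∃ μ : ℝ, NablaEqSmulId D ξ μ

/-! ### The l.c.H. rank -/

/-- The integral of the `1`-form `θ` along the path `γ`, restricted to `[0, 1]`. -/
def pathIntegral (θ : Π x : M, TangentSpace I x →L[ℝ] ℝ) (γ : ℝ → M) : ℝ :=
  ∫ t in (0 : ℝ)..1, θ (γ t) (mfderiv 𝓘(ℝ, ℝ) I γ t (1 : ℝ))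

/-- The image `Im χ` of the character `χ : π₁(M, x₀) → ℝ^{>0}`, `χ(γ) = exp(-∫_γ θ)`. If `df` is
the pullback of `θ` to a covering, a deck transformation corresponding to `γ` multiplies the
Hessian metric `e^{-f} g` of the covering by `χ(γ)`. -/
def homothetyGroup (θ : Π x : M, TangentSpace I x →L[ℝ] ℝ) (x₀ : M) : Subgroup ℝˣ :=
  Subgroup.closure {u : ℝˣ | ∃ γ : ℝ → M, ContMDiff 𝓘(ℝ, ℝ) I 1 γ ∧ γ 0 = x₀ ∧ γ 1 = x₀ ∧
    (u : ℝ) = Real.exp (-pathIntegral θ γ)}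

/-- The l.c.H. rank: the rank of the abelian group `Im χ`. -/
def lchRank (θ : Π x : M, TangentSpace I x →L[ℝ] ℝ) (x₀ : M) : Cardinal :=
  Module.rank ℤ (Additive (homothetyGroup θ x₀))

end General

/-! ### The cone `M × ℝ^{>0}` and its quotient by `φ_q` -/

/-- `ℝ^{>0}`, as an open submanifold of `ℝ`. -/
def PosReal : TopologicalSpace.Opens ℝ := ⟨Ioi 0, isOpen_Ioi⟩

/-- Multiplication by `q > 0` on `ℝ^{>0}`. -/
def PosReal.scale (q : ℝ) (hq : 0 < q) : Equiv.Perm PosReal where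
  toFun s := ⟨q * s.1, mul_pos hq s.2⟩
  invFun s := ⟨q⁻¹ * s.1, mul_pos (inv_pos.2 hq) s.2⟩
  left_inv _ := Subtype.ext (inv_mul_cancel_left₀ hq.ne' _)
  right_inv _ := Subtype.ext (mul_inv_cancel_left₀ hq.ne' _)

/-- `φ_q(m, s) = (φ(m), q s)`. -/
def coneMap {M : Type*} (φ : Equiv.Perm M) (q : ℝ) (hq : 0 < q) : Equiv.Perm (M × PosReal) :=
  Equiv.prodCongr φ (PosReal.scale q hq)

/-- The quotient of `M × ℝ^{>0}` by the group generated by `φ_q`, with the quotient topology. -/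
abbrev ConeQuotient {M : Type*} (φ : Equiv.Perm M) (q : ℝ) (hq : 0 < q) : Type _ :=
  Quotient (Equiv.Perm.SameCycle.setoid (coneMap φ q hq))

/-- The projection `M × ℝ^{>0} → (M × ℝ^{>0}) / φ_q`. -/
def coneProj {M : Type*} (φ : Equiv.Perm M) (q : ℝ) (hq : 0 < q) (p : M × PosReal) :
    ConeQuotient φ q hq :=
  Quotient.mk _ p

section Cone

variable {E : Type*} [NormedAddCommGroup E] [NormedSpace ℝ E]
  {M : Type*} [TopologicalSpace M] [ChartedSpace E M]

variable (E) in
/-- The model with corners of `M × ℝ^{>0}` and of its quotient. -/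
abbrev coneModel : ModelWithCorners ℝ (E × ℝ) (ModelProd E ℝ) := 𝓘(ℝ, E).prod 𝓘(ℝ, ℝ)

/-- The `1`-form `ds` on `M × ℝ^{>0}`, `s` being the coordinate of `ℝ^{>0}`. -/
def ds (p : M × PosReal) : TangentSpace (coneModel E) p →L[ℝ] ℝ :=
  mvfderiv (coneModel E) (fun p : M × PosReal ↦ (p.2 : ℝ)) p

/-- The differential of the projection `M × ℝ^{>0} → M`. -/
def dfst (p : M × PosReal) : TangentSpace (coneModel E) p →L[ℝ] TangentSpace 𝓘(ℝ, E) p.1 :=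
  mfderiv (coneModel E) 𝓘(ℝ, E) (Prod.fst : M × PosReal → M) p

/-- The vector field `s ∂_s` on `M × ℝ^{>0}`. -/
def sds (p : M × PosReal) : TangentSpace (coneModel E) p := ((0 : E), (p.2 : ℝ))

/-- `s ∂_s` is tangent to the second factor. -/
lemma dfst_sds [IsManifold 𝓘(ℝ, E) ∞ M] (p : M × PosReal) :
    dfst (E := E) p (sds p) = 0 := by
  unfold dfst sds
  rw [mfderiv_fst]
  rfl

/-- `ds(s ∂_s) = s`. -/
lemma ds_sds [IsManifold 𝓘(ℝ, E) ∞ M] (p : M × PosReal) :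
    ds (E := E) p (sds p) = p.2 := by
  have h : HasMFDerivAt 𝓘(ℝ, ℝ) 𝓘(ℝ, ℝ) (Subtype.val : PosReal → ℝ) p.2
      (ContinuousLinearMap.id ℝ ℝ) := by
    have key : HasFDerivAt (fun x : ℝ ↦ ((chartAt ℝ p.2).symm x : ℝ))
        (ContinuousLinearMap.id ℝ ℝ) (chartAt ℝ p.2 p.2) := by
      refine HasFDerivAt.congr_of_eventuallyEq (hasFDerivAt_id (𝕜 := ℝ) (chartAt ℝ p.2 p.2)) ?_
      filter_upwards [(chartAt ℝ p.2).open_target.mem_nhds (mem_chart_target ℝ p.2)] with x hx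
      exact (chartAt ℝ p.2).right_inv hx
    exact ⟨continuous_subtype_val.continuousAt, key.hasFDerivWithinAt⟩
  have hc : HasMFDerivAt (coneModel E) 𝓘(ℝ, ℝ) (fun p : M × PosReal ↦ (p.2 : ℝ)) p
      ((ContinuousLinearMap.id ℝ ℝ).comp (ContinuousLinearMap.snd ℝ E ℝ)) :=
    HasMFDerivAt.comp p h (hasMFDerivAt_snd p)
  unfold ds sds mvfderiv
  rw [hc.mfderiv]
  rfl

end Cone

end LCHGeometry

end

open Bundle Set
open scoped Manifold ContDiff
open scoped Topology

noncomputable section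

namespace LCHGeometry

/-! Put `t = log s`. On `M × ℝ` the structure is given by the cylinder metric `g_M + dt²`, the form
`θ = -2 dt`, the field `ξ = -2 ∂_t`, and the connection `∇_X Y = D_X Y + (λ - 2) g_M(X, Y) ∂_t`,
`∇_X ∂_t = ∇_{∂_t} X = λ X`, `∇_{∂_t} ∂_t = λ ∂_t`, for fields `X`, `Y` lifted from `M`
(`coneChristoffel`).

The component of its curvature along `M` is `Θ_D(X, Y) Z + λ(λ - 2)(g_M(Y, Z) X - g_M(X, Z) Y)`,
which vanishes because `λ(2 - λ) = c`. The component along `∂_t` is `λ - 2` times the Codazzi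
equation for `(D, g_M)` (`christoffelCurvature_cone`). The two coefficients `λ` and `λ - 2` differ
by exactly the `2` in `θ = -2 dt`, and this makes `∇g - θ ⊗ g` totally symmetric (`cone_codazzi`).
Since `ξ` has constant coefficients, `∇ξ = -2λ Id` can be read off from the Christoffel symbols.

No coefficient depends on `t`. Hence everything is invariant under `φ_q`, which is `φ` times the
translation by `log q`, and descends to `C` (`compatible_quotParam`, `exists_isCone`). For the same
reason the flow of `ξ`, a translation in `t`, preserves the metric and the connection
(`IsCone.isKilling`, `IsCone.isAffineField`).

For the rank, `exp(2πi log s / log q)` is a well-defined function on `C`. Comparing it with `∫ θ`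
along a loop shows that the integral is an integer multiple of `-2 log q`. A path in `M` from `m` to
`φ(m)` gives a loop attaining `-2 log q`. So `Im χ` is the infinite cyclic group generated by `q²`
(`IsConeLeeForm.lchRank_eq_one`).

If `c ≤ 1`, a root `λ` exists. As `g(ξ, ξ) = 4`, the value `μ = -2λ` is `0` or `-g(ξ, ξ)` only for
`λ = 0` or `λ = 2`, that is, only for `c = 0`. If `c > 1`, replacing `g_M` by `c g_M` does not
change `D` and makes the curvature constant equal to `1`, so `λ = 1` applies.

All local computations take place in parametrizations, local diffeomorphisms from the model vector
space. There a connection becomes its Christoffel symbols (`Represents`), and objects on `C` are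
glued from families obeying the transformation laws (`exists_connection`, `exists_metric`,
`exists_form`, `exists_vectorField`). -/

/-! ### Vector fields in a parametrization -/

section Pull

variable {F : Type*} [NormedAddCommGroup F] [NormedSpace ℝ F]
  {H : Type*} [TopologicalSpace H] {I : ModelWithCorners ℝ F H}
  {M : Type*} [TopologicalSpace M] [ChartedSpace H M]

/-- `f` is a smooth local diffeomorphism from the model vector space at `u`. -/
abbrev IsParamAt (I : ModelWithCorners ℝ F H) (f : F → M) (u : F) : Prop :=
  IsLocalDiffeomorphAt 𝓘(ℝ, F) I ∞ f u

/-- The expression of the vector field `Z` in the parametrization `f`. -/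
def pull (f : F → M) (Z : Π x : M, TangentSpace I x) (u : F) : F :=
  VectorField.mpullback 𝓘(ℝ, F) I f Z u

/-- The differential of `f` at `u` as a map on the model vector space. -/
def dpar (I : ModelWithCorners ℝ F H) (f : F → M) (u : F) : F →L[ℝ] TangentSpace I (f u) :=
  mfderiv 𝓘(ℝ, F) I f u

/-- The inverse of the differential of `f` at `u`. -/
def dparInv (I : ModelWithCorners ℝ F H) (f : F → M) (u : F) : TangentSpace I (f u) →L[ℝ] F :=
  (dpar I f u).inverse

variable {f : F → M} {u : F}

lemma IsParamAt.isInvertible (hf : IsParamAt I f u) : (dpar I f u).IsInvertible :=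
  ⟨hf.mfderivToContinuousLinearEquiv (by simp), rfl⟩

lemma IsParamAt.dparInv_dpar (hf : IsParamAt I f u) (w : F) :
    dparInv I f u (dpar I f u w) = w := by
  obtain ⟨e, he⟩ := hf.isInvertible
  simp [dparInv, ← he]

lemma IsParamAt.dpar_dparInv (hf : IsParamAt I f u) (v : TangentSpace I (f u)) :
    dpar I f u (dparInv I f u v) = v := by
  obtain ⟨e, he⟩ := hf.isInvertible
  simp [dparInv, ← he]

lemma IsParamAt.dpar_injective (hf : IsParamAt I f u) : Function.Injective (dpar I f u) :=
  Function.LeftInverse.injective hf.dparInv_dpar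

lemma pull_eq_dparInv (Z : Π x : M, TangentSpace I x) :
    pull f Z u = dparInv I f u (Z (f u)) := rfl

lemma IsParamAt.dpar_pull (hf : IsParamAt I f u) (Z : Π x : M, TangentSpace I x) :
    dpar I f u (pull f Z u) = Z (f u) :=
  hf.dpar_dparInv _

lemma IsParamAt.pull_eq (hf : IsParamAt I f u) {Z : Π x : M, TangentSpace I x} {w : F}
    (h : dpar I f u w = Z (f u)) : pull f Z u = w := by
  rw [pull_eq_dparInv, ← h, hf.dparInv_dpar]

lemma IsParamAt.eventually (hf : IsParamAt I f u) : ∀ᶠ v in 𝓝 u, IsParamAt I f v := by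
  obtain ⟨Φ, hu, h⟩ := hf
  filter_upwards [Φ.open_source.mem_nhds hu] with v hv
  exact ⟨Φ, hv, h⟩

lemma IsParamAt.continuousAt (hf : IsParamAt I f u) : ContinuousAt f u :=
  hf.contMDiffAt.continuousAt

lemma IsParamAt.map_nhds (hf : IsParamAt I f u) : Filter.map f (𝓝 u) = 𝓝 (f u) := by
  obtain ⟨Φ, hu, h⟩ := hf
  have h1 := Φ.toOpenPartialHomeomorph.map_nhds_eq (x := u) hu
  have h2 : f =ᶠ[𝓝 u] Φ.toOpenPartialHomeomorph :=
    Filter.eventuallyEq_of_mem (Φ.open_source.mem_nhds hu) h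
  rw [Filter.map_congr h2, h1, h2.self_of_nhds]

/-- A local diffeomorphism maps neighbourhoods onto neighbourhoods, so germs on the manifold may be
tested on parameters. -/
lemma IsParamAt.eventually_iff (hf : IsParamAt I f u) {P : M → Prop} :
    (∀ᶠ y in 𝓝 (f u), P y) ↔ ∀ᶠ v in 𝓝 u, P (f v) := by
  rw [← hf.map_nhds, Filter.eventually_map]

/-- A vector field on `M` extending `z` through the local inverse of `f`. -/
def push (hf : IsParamAt I f u) (z : F → F) : Π x : M, TangentSpace I x :=
  VectorField.mpullback I 𝓘(ℝ, F) hf.localInverse z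

/-- Chain rule for the identity `localInverse ∘ f = id`. It is needed at all parameters `v` near
`u`, since fields are going to be differentiated. -/
lemma IsParamAt.mfderiv_localInverse (hf : IsParamAt I f u) {v : F}
    (hv : v ∈ hf.localInverse.target) :
    mfderiv I 𝓘(ℝ, F) hf.localInverse (f v) = dparInv I f v := by
  have hfv : IsParamAt I f v := by
    obtain ⟨h1, h2⟩ := hf.choose_spec
    exact ⟨hf.choose, hv, h2⟩
  have hsrc : f v ∈ hf.localInverse.source := by
    rw [hf.choose_spec.2 hv]; exact hf.choose.map_source hv
  have hd : MDifferentiableAt I 𝓘(ℝ, F) hf.localInverse (f v) :=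
    (hf.localInverse_contMDiffOn.contMDiffAt
      (hf.localInverse_open_source.mem_nhds hsrc)).mdifferentiableAt (by simp)
  have h1 : mfderiv 𝓘(ℝ, F) 𝓘(ℝ, F) (hf.localInverse ∘ f) v =
      ContinuousLinearMap.id ℝ F := by
    have : hf.localInverse ∘ f =ᶠ[𝓝 v] id :=
      Filter.eventuallyEq_of_mem (hf.localInverse.open_target.mem_nhds hv)
        hf.localInverse_eqOn_left
    rw [this.mfderiv_eq]; exact mfderiv_id
  rw [mfderiv_comp v hd (hfv.mdifferentiableAt (by simp))] at h1
  ext w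
  have h2 := congrArg (fun L : F →L[ℝ] F ↦ L (dparInv I f v w)) h1
  have h3 := hfv.dpar_dparInv w
  change mfderiv I 𝓘(ℝ, F) hf.localInverse (f v) (dpar I f v (dparInv I f v w)) =
    dparInv I f v w at h2
  rwa [h3] at h2

lemma IsParamAt.pull_push (hf : IsParamAt I f u) (z : F → F) :
    ∀ᶠ v in 𝓝 u, pull f (push hf z) v = z v := by
  filter_upwards [hf.localInverse.open_target.mem_nhds hf.localInverse_mem_target, hf.eventually]
    with v hv hfv
  refine hfv.pull_eq ?_
  have h1 : push hf z (f v) = (dparInv I f v).inverse (z (hf.localInverse (f v))) :=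
    congrArg (fun L : TangentSpace I (f v) →L[ℝ] F ↦ L.inverse (z (hf.localInverse (f v))))
      (hf.mfderiv_localInverse hv)
  rw [h1, hf.localInverse_left_inv hv]
  obtain ⟨e, he⟩ := hfv.isInvertible
  simp only [dparInv, ← he]
  simp

lemma IsParamAt.push_pull (hf : IsParamAt I f u) (Z : Π x : M, TangentSpace I x) :
    ∀ᶠ y in 𝓝 (f u), push hf (pull f Z) y = Z y := by
  rw [hf.eventually_iff]
  filter_upwards [hf.pull_push (pull f Z), hf.eventually] with v h hfv
  rw [← hfv.dpar_pull (push hf (pull f Z)), h, hfv.dpar_pull]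

lemma mdifferentiableAt_vectorSpace_iff {z : Π x : F, TangentSpace 𝓘(ℝ, F) x} :
    MDifferentiableAt 𝓘(ℝ, F) 𝓘(ℝ, F).tangent
      (fun x ↦ (⟨x, z x⟩ : TangentBundle 𝓘(ℝ, F) F)) u ↔
      DifferentiableAt ℝ (fun x ↦ (z x : F)) u := by
  rw [mdifferentiableAt_section]
  simp only [trivializationAt_model_space_apply]
  exact mdifferentiableAt_iff_differentiableAt

lemma IsParamAt.localInverse_isInvertible (hf : IsParamAt I f u) :
    (mfderiv I 𝓘(ℝ, F) hf.localInverse (f u)).IsInvertible :=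
  ⟨hf.localInverse_isLocalDiffeomorphAt.mfderivToContinuousLinearEquiv (by simp), rfl⟩

/-- For the converse, precompose `s ∘ f` with the local inverse of `f`. -/
lemma IsParamAt.contMDiffAt_comp_iff (hf : IsParamAt I f u) {G : Type*} [NormedAddCommGroup G]
    [NormedSpace ℝ G] {s : M → G} :
    ContMDiffAt I 𝓘(ℝ, G) ∞ s (f u) ↔ ContDiffAt ℝ ∞ (s ∘ f) u := by
  rw [← contMDiffAt_iff_contDiffAt]
  refine ⟨fun h ↦ h.comp u hf.contMDiffAt, fun h ↦ ?_⟩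
  have h2 : ContMDiffAt I 𝓘(ℝ, G) ∞ ((s ∘ f) ∘ hf.localInverse) (f u) := by
    refine ContMDiffAt.comp (f u) ?_ hf.localInverse_contMDiffAt
    rwa [hf.localInverse_left_inv hf.localInverse_mem_target]
  refine h2.congr_of_eventuallyEq ?_
  filter_upwards [hf.localInverse_eventuallyEq_right] with y hy
  exact congrArg s hy.symm

lemma IsParamAt.mvfderiv_dpar (hf : IsParamAt I f u) {G : Type*} [NormedAddCommGroup G]
    [NormedSpace ℝ G] {s : M → G} (hs : MDifferentiableAt I 𝓘(ℝ, G) s (f u)) (w : F) :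
    mvfderiv I s (f u) (dpar I f u w) = fderiv ℝ (s ∘ f) u w := by
  have := mfderiv_comp u hs (hf.mdifferentiableAt (by simp))
  rw [mfderiv_eq_fderiv] at this
  rw [this]
  rfl

variable [IsManifold I ∞ M]

lemma isManifold_of_top (I : ModelWithCorners ℝ F H) (M : Type*) [TopologicalSpace M]
    [ChartedSpace H M] [IsManifold I ∞ M] : IsManifold I 2 M :=
  IsManifold.of_le (n := ∞) (by norm_cast)

variable [FiniteDimensional ℝ F]

lemma IsParamAt.contDiffAt_pull (hf : IsParamAt I f u) {Z : Π x : M, TangentSpace I x}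
    (hZ : ContMDiffAt I I.tangent ∞ (fun x ↦ (⟨x, Z x⟩ : TangentBundle I M)) (f u)) :
    ContDiffAt ℝ ∞ (pull f Z) u := by
  have : CompleteSpace F := FiniteDimensional.complete ℝ F
  have h := ContMDiffAt.mpullback_vectorField_preimage (I := 𝓘(ℝ, F)) hZ hf.contMDiffAt
    hf.isInvertible (by simp)
  exact contMDiffAt_vectorSpace_iff_contDiffAt.1 h

lemma IsParamAt.differentiableAt_pull (hf : IsParamAt I f u) {Z : Π x : M, TangentSpace I x}
    (hZ : MDifferentiableAt I I.tangent (fun x ↦ (⟨x, Z x⟩ : TangentBundle I M)) (f u)) :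
    DifferentiableAt ℝ (pull f Z) u := by
  have : CompleteSpace F := FiniteDimensional.complete ℝ F
  have := isManifold_of_top I M
  have h := MDifferentiableAt.mpullback_vectorField (I := 𝓘(ℝ, F)) hZ hf.contMDiffAt
    hf.isInvertible (by norm_cast)
  exact mdifferentiableAt_vectorSpace_iff.1 h

lemma IsParamAt.contMDiffAt_push (hf : IsParamAt I f u) {z : F → F} (hz : ContDiffAt ℝ ∞ z u) :
    ContMDiffAt I I.tangent ∞ (fun x ↦ (⟨x, push hf z x⟩ : TangentBundle I M)) (f u) := by
  have : CompleteSpace F := FiniteDimensional.complete ℝ F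
  refine ContMDiffAt.mpullback_vectorField_preimage (n := ∞) ?_ hf.localInverse_contMDiffAt
    hf.localInverse_isInvertible (by simp)
  rw [hf.localInverse_left_inv hf.localInverse_mem_target]
  exact contMDiffAt_vectorSpace_iff_contDiffAt.2 hz

lemma IsParamAt.mdifferentiableAt_push (hf : IsParamAt I f u) {z : F → F}
    (hz : DifferentiableAt ℝ z u) :
    MDifferentiableAt I I.tangent (fun x ↦ (⟨x, push hf z x⟩ : TangentBundle I M)) (f u) := by
  have : CompleteSpace F := FiniteDimensional.complete ℝ F
  have := isManifold_of_top I M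
  refine MDifferentiableAt.mpullback_vectorField (n := ∞) ?_ hf.localInverse_contMDiffAt
    hf.localInverse_isInvertible (by norm_cast)
  rw [hf.localInverse_left_inv hf.localInverse_mem_target]
  exact mdifferentiableAt_vectorSpace_iff.2 hz

/-- Near `f u` the field `Z` is the push of its own pull, and pushing preserves smoothness. -/
lemma IsParamAt.contMDiffAt_of_pull (hf : IsParamAt I f u) {Z : Π x : M, TangentSpace I x}
    (hz : ContDiffAt ℝ ∞ (pull f Z) u) :
    ContMDiffAt I I.tangent ∞ (fun x ↦ (⟨x, Z x⟩ : TangentBundle I M)) (f u) := by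
  refine (hf.contMDiffAt_push hz).congr_of_eventuallyEq ?_
  filter_upwards [hf.push_pull Z] with y hy
  rw [hy]

lemma IsParamAt.mdifferentiableAt_of_pull (hf : IsParamAt I f u)
    {Z : Π x : M, TangentSpace I x} (hz : DifferentiableAt ℝ (pull f Z) u) :
    MDifferentiableAt I I.tangent (fun x ↦ (⟨x, Z x⟩ : TangentBundle I M)) (f u) := by
  refine (hf.mdifferentiableAt_push hz).congr_of_eventuallyEq ?_
  filter_upwards [hf.push_pull Z] with y hy
  rw [hy]

/-- Lie brackets are natural under pullback, and in a vector space the bracket is the difference of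
directional derivatives. -/
lemma IsParamAt.pull_mlieBracket (hf : IsParamAt I f u) {X Y : Π x : M, TangentSpace I x}
    (hX : MDifferentiableAt I I.tangent (fun x ↦ (⟨x, X x⟩ : TangentBundle I M)) (f u))
    (hY : MDifferentiableAt I I.tangent (fun x ↦ (⟨x, Y x⟩ : TangentBundle I M)) (f u)) :
    pull f (VectorField.mlieBracket I X Y) u =
      fderiv ℝ (pull f Y) u (pull f X u) - fderiv ℝ (pull f X) u (pull f Y u) := by
  have : CompleteSpace F := FiniteDimensional.complete ℝ F
  have : IsManifold I (minSmoothness ℝ 2) M := by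
    rw [minSmoothness_of_isRCLikeNormedField]; exact isManifold_of_top I M
  have h := VectorField.mpullback_mlieBracket (I := 𝓘(ℝ, F)) hX hY hf.contMDiffAt
    (by rw [minSmoothness_of_isRCLikeNormedField]; norm_cast)
  refine h.trans ?_
  rw [← VectorField.mlieBracketWithin_univ, VectorField.mlieBracketWithin_eq_lieBracketWithin]
  exact congrFun (VectorField.lieBracketWithin_univ (V := pull f X) (W := pull f Y)) u

end Pull

/-! ### Smoothness criteria and extension of vector fields -/

section SmoothVF

variable {F : Type*} [NormedAddCommGroup F] [NormedSpace ℝ F]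
  {H : Type*} [TopologicalSpace H] {I : ModelWithCorners ℝ F H}
  {M : Type*} [TopologicalSpace M] [ChartedSpace H M] [IsManifold I ∞ M]

lemma SmoothVF.mdifferentiableAt {Z : Π x : M, TangentSpace I x} (hZ : SmoothVF Z) (x : M) :
    MDiffAt (T% Z) x :=
  ContMDiffAt.mdifferentiableAt (hZ x) (by simp)

end SmoothVF

section Smoothness

variable {F : Type*} [NormedAddCommGroup F] [NormedSpace ℝ F] [FiniteDimensional ℝ F]
  {H : Type*} [TopologicalSpace H] {I : ModelWithCorners ℝ F H}
  {M : Type*} [TopologicalSpace M] [ChartedSpace H M]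

/-- In finite dimension `φ = ∑ i, bᵢ* ⊗ φ(bᵢ)`, a finite sum depending smoothly on the values on the
basis. -/
lemma contMDiffAt_clm_of_apply {G ι : Type*} [NormedAddCommGroup G] [NormedSpace ℝ G] [Fintype ι]
    (b : Module.Basis ι ℝ F) {φ : M → F →L[ℝ] G} {x : M}
    (h : ∀ i, ContMDiffAt I 𝓘(ℝ, G) ∞ (fun y ↦ φ y (b i)) x) :
    ContMDiffAt I 𝓘(ℝ, F →L[ℝ] G) ∞ φ x := by
  have key : φ = fun y ↦ ∑ i, ContinuousLinearMap.smulRightL ℝ F G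
      (LinearMap.toContinuousLinearMap (b.coord i)) (φ y (b i)) := by
    funext y
    ext w
    conv_lhs => rw [← b.sum_repr w, map_sum]
    simp
  rw [key]
  refine ContMDiffAt.sum fun i _ ↦ ?_
  exact (ContinuousLinearMap.contMDiff _).contMDiffAt.comp x (h i)

/-- It suffices to test on a local frame of the tangent bundle: in trivializations its members are
the constant basis vectors. -/
lemma contMDiffAt_hom_of_apply [IsManifold I ∞ M] {G : Type*} [NormedAddCommGroup G]
    [NormedSpace ℝ G]
    {V : M → Type*} [TopologicalSpace (TotalSpace G V)] [∀ x, AddCommGroup (V x)]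
    [∀ x, Module ℝ (V x)] [∀ x, TopologicalSpace (V x)] [∀ x, IsTopologicalAddGroup (V x)]
    [∀ x, ContinuousSMul ℝ (V x)] [FiberBundle G V] [VectorBundle ℝ G V]
    (φ : Π x : M, TangentSpace I x →L[ℝ] V x) (x : M)
    (h : ∀ X : Π x : M, TangentSpace I x, CMDiffAt ∞ (T% X) x →
      ContMDiffAt I (I.prod 𝓘(ℝ, G)) ∞ (fun y ↦ TotalSpace.mk' G y (φ y (X y))) x) :
    ContMDiffAt I (I.prod 𝓘(ℝ, F →L[ℝ] G)) ∞
      (fun y ↦ TotalSpace.mk' (F →L[ℝ] G) (E := fun x : M ↦ TangentSpace I x →L[ℝ] V x) y (φ y))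
      x := by
  rw [contMDiffAt_hom_bundle]
  refine ⟨contMDiffAt_id, contMDiffAt_clm_of_apply (Module.finBasis ℝ F) fun i ↦ ?_⟩
  set b := Module.finBasis ℝ F
  set e := trivializationAt F (TangentSpace I : M → Type _) x
  have hx : x ∈ e.baseSet := FiberBundle.mem_baseSet_trivializationAt F _ x
  have hX := contMDiffAt_localFrame_of_mem (I := I) ∞ e b i hx
  have h2 := (contMDiffAt_section (F := G) (E := V) x).1 (h _ hX)
  refine h2.congr_of_eventuallyEq ?_
  filter_upwards [e.open_baseSet.mem_nhds hx,
    (trivializationAt G V x).open_baseSet.mem_nhds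
      (FiberBundle.mem_baseSet_trivializationAt G V x)] with y hy hy'
  rw [ContinuousLinearMap.inCoordinates_eq hy hy']
  simp only [ContinuousLinearMap.comp_apply, ContinuousLinearEquiv.coe_coe]
  rw [e.localFrame_apply_of_mem_baseSet b hy]
  simp only [Trivialization.basisAt, Module.Basis.map_apply]
  rfl

variable [IsManifold I ∞ M] [T2Space M]

/-- Multiply by a bump function supported where `Z` is smooth. The tensor conditions quantify over
global smooth fields, so local fields have to be extended. -/
lemma exists_smoothVF_eventuallyEq {x : M} (Z : Π x : M, TangentSpace I x)
    (hZ : ∀ᶠ y in 𝓝 x, CMDiffAt ∞ (T% Z) y) :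
    ∃ Z' : Π x : M, TangentSpace I x, SmoothVF Z' ∧ ∀ᶠ y in 𝓝 x, Z' y = Z y := by
  obtain ⟨s, hs, hso, hxs⟩ := mem_nhds_iff.1 hZ
  obtain ⟨ρ, -, hρ⟩ := (SmoothBumpFunction.nhds_basis_tsupport (I := I) x).mem_iff.1
    (hso.mem_nhds hxs)
  refine ⟨(ρ : M → ℝ) • Z, ?_, ?_⟩
  · exact ContMDiffOn.smul_section_of_tsupport ρ.contMDiff.contMDiffOn hso hρ
      fun y hy ↦ (hs hy).contMDiffWithinAt
  · filter_upwards [ρ.eventuallyEq_one] with y hy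
    simp [hy]

lemma IsParamAt.exists_smoothVF {f : F → M} {u : F} (hf : IsParamAt I f u) {z : F → F}
    (hz : ∀ᶠ v in 𝓝 u, ContDiffAt ℝ ∞ z v) :
    ∃ Z : Π x : M, TangentSpace I x, SmoothVF Z ∧ ∀ᶠ v in 𝓝 u, pull f Z v = z v := by
  obtain ⟨Z, hZ, hZe⟩ := exists_smoothVF_eventuallyEq (x := f u) (push hf z) (by
    rw [hf.eventually_iff]
    filter_upwards [(hf.pull_push z).eventually_nhds, hz, hf.eventually] with v h1 h2 h3
    exact h3.contMDiffAt_of_pull (h2.congr_of_eventuallyEq h1))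
  refine ⟨Z, hZ, ?_⟩
  filter_upwards [hf.eventually_iff.1 hZe, hf.pull_push z] with v h1 h2
  rw [← h2, pull_eq_dparInv, pull_eq_dparInv, h1]

/-- These are the test fields: their derivatives vanish in the parametrization, so identities
between covariant derivatives become identities between Christoffel symbols. -/
lemma IsParamAt.exists_smoothVF_const {f : F → M} {u : F} (hf : IsParamAt I f u) (z : F) :
    ∃ Z : Π x : M, TangentSpace I x, SmoothVF Z ∧ ∀ᶠ v in 𝓝 u, pull f Z v = z :=
  hf.exists_smoothVF (.of_forall fun _ ↦ contDiffAt_const)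

end Smoothness

/-! ### Christoffel symbols -/

section Christoffel

variable {F : Type*} [NormedAddCommGroup F] [NormedSpace ℝ F] [FiniteDimensional ℝ F]
  {H : Type*} [TopologicalSpace H] {I : ModelWithCorners ℝ F H}
  {M : Type*} [TopologicalSpace M] [ChartedSpace H M]

/-- The covariant derivative with Christoffel symbols `Γ` in the parametrization `f`, as an
endomorphism of the model vector space. -/
def covPull (f : F → M) (u : F) (Γ : F →L[ℝ] F →L[ℝ] F) (Z : Π x : M, TangentSpace I x) :
    F →L[ℝ] F :=
  fderiv ℝ (pull f Z) u + Γ.flip (pull f Z u)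

/-- `Γ` are the Christoffel symbols of `N` in the parametrization `f` at `u`. -/
def Represents [IsManifold I ∞ M] (N : Connection I M) (f : F → M) (u : F)
    (Γ : F →L[ℝ] F →L[ℝ] F) : Prop :=
  ∀ Z : Π x : M, TangentSpace I x, MDiffAt (T% Z) (f u) → ∀ w : F,
    N Z (f u) (dpar I f u w) = dpar I f u (covPull f u Γ Z w)

variable {f : F → M} {u : F}

lemma covPull_apply (Γ : F →L[ℝ] F →L[ℝ] F) (Z : Π x : M, TangentSpace I x) (w : F) :
    covPull f u Γ Z w = fderiv ℝ (pull f Z) u w + Γ w (pull f Z u) := rfl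

lemma covPull_of_const (Γ : F →L[ℝ] F →L[ℝ] F) {Z : Π x : M, TangentSpace I x} {z : F}
    (hZ : ∀ᶠ v in 𝓝 u, pull f Z v = z) (w : F) : covPull f u Γ Z w = Γ w z := by
  have : pull f Z =ᶠ[𝓝 u] fun _ ↦ z := hZ
  rw [covPull_apply, this.fderiv_eq, hZ.self_of_nhds]
  simp

variable [IsManifold I ∞ M]

lemma covPull_add (hf : IsParamAt I f u) (Γ : F →L[ℝ] F →L[ℝ] F)
    {Z Z' : Π x : M, TangentSpace I x} (hZ : MDiffAt (T% Z) (f u))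
    (hZ' : MDiffAt (T% Z') (f u)) :
    covPull f u Γ (Z + Z') = covPull f u Γ Z + covPull f u Γ Z' := by
  have h : pull f (Z + Z') = pull f Z + pull f Z' := by
    funext v; simp [pull_eq_dparInv]
  ext w
  simp only [covPull_apply, h, add_apply]
  rw [fderiv_add (hf.differentiableAt_pull hZ) (hf.differentiableAt_pull hZ')]
  simp only [add_apply, Pi.add_apply, map_add]
  abel

lemma covPull_smul (hf : IsParamAt I f u) (Γ : F →L[ℝ] F →L[ℝ] F)
    {g : M → ℝ} {Z : Π x : M, TangentSpace I x} (hg : MDiffAt g (f u))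
    (hZ : MDiffAt (T% Z) (f u)) (w : F) :
    covPull f u Γ (g • Z) w =
      g (f u) • covPull f u Γ Z w + (mvfderiv I g (f u) (dpar I f u w)) • pull f Z u := by
  have h : pull f (g • Z) = fun v ↦ (g ∘ f) v • pull f Z v := by
    funext v; simp [pull_eq_dparInv]
  have hgf : DifferentiableAt ℝ (g ∘ f) u :=
    (MDifferentiableAt.comp u hg (hf.mdifferentiableAt (by simp))).differentiableAt
  simp only [covPull_apply, h]
  rw [fderiv_fun_smul hgf (hf.differentiableAt_pull hZ), hf.mvfderiv_dpar hg]
  simp only [add_apply, smul_apply, map_smul,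
    ContinuousLinearMap.smulRight_apply, Function.comp_apply]
  module

/-- Every connection has Christoffel symbols. -/
lemma exists_represents (hf : IsParamAt I f u) (N : Connection I M) :
    ∃ Γ : F →L[ℝ] F →L[ℝ] F, Represents N f u Γ := by
  have := isManifold_of_top I M
  have : IsManifold I 1 M := IsManifold.of_le (n := 2) (by norm_cast)
  -- The difference of the connection and the flat derivative of the parametrization. The Leibniz
  -- terms cancel, so it is tensorial and depends only on the value of `Z` at the point.
  let Φ : (Π x : M, TangentSpace I x) → F →L[ℝ] F := fun Z ↦
    (dparInv I f u).comp ((N Z (f u)).comp (dpar I f u)) - covPull f u 0 Z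
  have hΦ : TensorialAt I F Φ (f u) := by
    constructor
    · intro g Z hg hZ
      ext w
      simp only [Φ, sub_apply, ContinuousLinearMap.comp_apply,
        smul_apply, N.isCovariantDerivativeOnUniv.leibniz hZ hg,
        covPull_smul hf 0 hg hZ]
      simp only [add_apply, smul_apply, map_add, map_smul,
        ContinuousLinearMap.smulRight_apply, pull_eq_dparInv]
      module
    · intro Z Z' hZ hZ'
      ext w
      simp only [Φ, sub_apply, ContinuousLinearMap.comp_apply,
        N.isCovariantDerivativeOnUniv.add hZ hZ', covPull_add hf 0 hZ hZ',
        add_apply, map_add]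
      abel
  let L := TensorialAt.mkHom Φ (f u) hΦ
  -- `L` takes the differentiated field first, whereas Christoffel symbols take the direction first.
  refine ⟨(L.comp (dpar I f u)).flip, fun Z hZ w ↦ ?_⟩
  have h := TensorialAt.mkHom_apply hΦ hZ
  have h2 : L (dpar I f u (pull f Z u)) = Φ Z := by rw [hf.dpar_pull]; exact h
  have h3 : covPull f u (L.comp (dpar I f u)).flip Z w =
      dparInv I f u (N Z (f u) (dpar I f u w)) := by
    rw [covPull_apply, ContinuousLinearMap.flip_apply, ContinuousLinearMap.comp_apply, h2]
    simp [Φ, covPull_apply]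
  rw [h3, hf.dpar_dparInv]

/-- The Christoffel symbols of the connection `N` in the parametrization `f`. -/
def christoffel (N : Connection I M) (f : F → M) (u : F) : F →L[ℝ] F →L[ℝ] F :=
  open Classical in
  if hf : IsParamAt I f u then (exists_represents hf N).choose else 0

lemma represents_christoffel (hf : IsParamAt I f u) (N : Connection I M) :
    Represents N f u (christoffel N f u) := by
  rw [christoffel, dif_pos hf]
  exact (exists_represents hf N).choose_spec

lemma Represents.pull_apply {N : Connection I M} {Γ : F →L[ℝ] F →L[ℝ] F}
    (h : Represents N f u Γ) (hf : IsParamAt I f u) {Z X : Π x : M, TangentSpace I x}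
    (hZ : MDiffAt (T% Z) (f u)) :
    pull f (fun y ↦ N Z y (X y)) u = fderiv ℝ (pull f Z) u (pull f X u) +
      Γ (pull f X u) (pull f Z u) := by
  refine hf.pull_eq ?_
  rw [← covPull_apply, ← h Z hZ, hf.dpar_pull]

variable [T2Space M]

lemma Represents.unique {N : Connection I M} {Γ Γ' : F →L[ℝ] F →L[ℝ] F}
    (h : Represents N f u Γ) (h' : Represents N f u Γ') (hf : IsParamAt I f u) : Γ = Γ' := by
  ext w z
  obtain ⟨Z, hZ, hz⟩ := hf.exists_smoothVF_const z
  have h1 := h Z (hZ.mdifferentiableAt _) w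
  rw [h' Z (hZ.mdifferentiableAt _) w] at h1
  have h2 := hf.dpar_injective h1
  rw [covPull_of_const _ hz, covPull_of_const _ hz] at h2
  exact h2.symm

/-- On basis vectors the Christoffel symbols are the pull of `N` applied to test fields with
constant expressions, and this is smooth because `N` preserves smoothness. -/
lemma contDiffAt_christoffel (hf : IsParamAt I f u) {N : Connection I M}
    (hN : SmoothConnection N) : ContDiffAt ℝ ∞ (christoffel N f) u := by
  let b := Module.finBasis ℝ F
  rw [← contMDiffAt_iff_contDiffAt]
  refine contMDiffAt_clm_of_apply b fun i ↦ contMDiffAt_clm_of_apply b fun j ↦ ?_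
  rw [contMDiffAt_iff_contDiffAt]
  obtain ⟨Z, hZ, hz⟩ := hf.exists_smoothVF_const (b j)
  obtain ⟨X, hX, hx⟩ := hf.exists_smoothVF_const (b i)
  have h1 : ContMDiff I (I.prod 𝓘(ℝ, F →L[ℝ] F)) ∞ (fun x ↦ TotalSpace.mk' (F →L[ℝ] F)
      (E := fun x : M ↦ TangentSpace I x →L[ℝ] TangentSpace I x) x (N Z x)) := by
    rw [← contMDiffOn_univ]
    exact hN.contMDiff.contMDiff (hZ.contMDiffOn)
  have h2 : ContMDiffAt I I.tangent ∞
      (fun y ↦ (⟨y, N Z y (X y)⟩ : TangentBundle I M)) (f u) :=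
    ContMDiffAt.clm_bundle_apply (h1 (f u)) (hX (f u))
  refine (hf.contDiffAt_pull h2).congr_of_eventuallyEq ?_
  filter_upwards [hf.eventually, hz.eventually_nhds, hx] with v hv hzv hxv
  rw [(represents_christoffel hv N).pull_apply hv (hZ.mdifferentiableAt _), hxv,
    ← covPull_apply, covPull_of_const _ hzv]

end Christoffel

section Tensors

variable {F : Type*} [NormedAddCommGroup F] [NormedSpace ℝ F] [FiniteDimensional ℝ F]
  {H : Type*} [TopologicalSpace H] {I : ModelWithCorners ℝ F H}
  {M : Type*} [TopologicalSpace M] [ChartedSpace H M] [IsManifold I ∞ M]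
  {f : F → M} {u : F}

/-! ### Tensors in a parametrization -/

/-- The curvature tensor of the connection with Christoffel symbols `Γ`. -/
def christoffelCurvature (Γ : F → F →L[ℝ] F →L[ℝ] F) (u x y z : F) : F :=
  fderiv ℝ Γ u x y z - fderiv ℝ Γ u y x z + Γ u x (Γ u y z) - Γ u y (Γ u x z)

/-- The expression of the metric `g` in the parametrization `f`. -/
def metricPull (g : RiemMetric I M) (f : F → M) (u : F) : F →L[ℝ] F →L[ℝ] ℝ :=
  (ContinuousLinearMap.precomp ℝ (dpar I f u)).comp ((g.inner (f u)).comp (dpar I f u))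

lemma metricPull_apply (g : RiemMetric I M) (f : F → M) (u w z : F) :
    metricPull g f u w z = g.inner (f u) (dpar I f u w) (dpar I f u z) := rfl

lemma IsParamAt.metricPull_pull (hf : IsParamAt I f u) (g : RiemMetric I M)
    (Y Z : Π x : M, TangentSpace I x) :
    metricPull g f u (pull f Y u) (pull f Z u) = g.inner (f u) (Y (f u)) (Z (f u)) := by
  rw [metricPull_apply, hf.dpar_pull, hf.dpar_pull]

lemma contMDiffAt_inner (g : RiemMetric I M) {Y Z : Π x : M, TangentSpace I x} {x : M}
    (hY : CMDiffAt ∞ (T% Y) x) (hZ : CMDiffAt ∞ (T% Z) x) :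
    ContMDiffAt I 𝓘(ℝ, ℝ) ∞ (fun y ↦ g.inner y (Y y) (Z y)) x := by
  have : ContMDiffAt I (I.prod 𝓘(ℝ)) ∞
      (fun m ↦ TotalSpace.mk' ℝ (E := Bundle.Trivial M ℝ) m (g.inner m (Y m) (Z m))) x :=
    ContMDiffAt.clm_bundle_apply₂ (F₁ := F) (F₂ := F) (g.contMDiff x) hY hZ
  simp only [contMDiffAt_totalSpace] at this
  exact this.2

lemma contDiffAt_metricPull [T2Space M] (hf : IsParamAt I f u) (g : RiemMetric I M) :
    ContDiffAt ℝ ∞ (metricPull g f) u := by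
  let b := Module.finBasis ℝ F
  rw [← contMDiffAt_iff_contDiffAt]
  refine contMDiffAt_clm_of_apply b fun i ↦ contMDiffAt_clm_of_apply b fun j ↦ ?_
  rw [contMDiffAt_iff_contDiffAt]
  obtain ⟨Z, hZ, hz⟩ := hf.exists_smoothVF_const (b j)
  obtain ⟨X, hX, hx⟩ := hf.exists_smoothVF_const (b i)
  refine (hf.contMDiffAt_comp_iff.1 (contMDiffAt_inner g (hX _) (hZ _))).congr_of_eventuallyEq ?_
  filter_upwards [hf.eventually, hz, hx] with v hv hzv hxv
  rw [← hzv, ← hxv, hv.metricPull_pull]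
  rfl

/-- Expand both iterated derivatives. The second derivatives of `Z` cancel by symmetry, the terms
with derivatives of `X` and `Y` cancel against the bracket term, and the mixed terms in `Γ` and
first derivatives of `Z` cancel in pairs. -/
lemma pull_curvature (hf : IsParamAt I f u) {N : Connection I M} {Γ : F → F →L[ℝ] F →L[ℝ] F}
    (hN : ∀ᶠ v in 𝓝 u, Represents N f v (Γ v)) (hΓ : DifferentiableAt ℝ Γ u)
    {X Y Z : Π x : M, TangentSpace I x} (hX : SmoothVF X) (hY : SmoothVF Y) (hZ : SmoothVF Z) :
    pull f (curvature N X Y Z) u =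
      christoffelCurvature Γ u (pull f X u) (pull f Y u) (pull f Z u) := by
  have hx := hf.contDiffAt_pull (hX (f u))
  have hy := hf.contDiffAt_pull (hY (f u))
  have hz := hf.contDiffAt_pull (hZ (f u))
  have hdz : DifferentiableAt ℝ (pull f Z) u := hz.differentiableAt (by simp)
  have hddz : DifferentiableAt ℝ (fderiv ℝ (pull f Z)) u :=
    (hz.fderiv_right (m := ∞) (by simp)).differentiableAt (by simp)
  have key : ∀ X Y : Π x : M, TangentSpace I x, SmoothVF X → SmoothVF Y →
      pull f (fun x ↦ N (fun y ↦ N Z y (Y y)) x (X x)) u =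
        fderiv ℝ (fderiv ℝ (pull f Z)) u (pull f X u) (pull f Y u) +
        fderiv ℝ (pull f Z) u (fderiv ℝ (pull f Y) u (pull f X u)) +
        (fderiv ℝ Γ u (pull f X u) (pull f Y u) (pull f Z u) +
          Γ u (fderiv ℝ (pull f Y) u (pull f X u)) (pull f Z u) +
          Γ u (pull f Y u) (fderiv ℝ (pull f Z) u (pull f X u))) +
        Γ u (pull f X u) (fderiv ℝ (pull f Z) u (pull f Y u) +
          Γ u (pull f Y u) (pull f Z u)) := by
    intro X Y hX hY
    have hdy : DifferentiableAt ℝ (pull f Y) u :=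
      (hf.contDiffAt_pull (hY (f u))).differentiableAt (by simp)
    have h1 : pull f (fun y ↦ N Z y (Y y)) =ᶠ[𝓝 u] fun v ↦
        fderiv ℝ (pull f Z) v (pull f Y v) + Γ v (pull f Y v) (pull f Z v) := by
      filter_upwards [hN, hf.eventually] with v hv hfv
      exact hv.pull_apply hfv (hZ.mdifferentiableAt _)
    have hA := hddz.hasFDerivAt.clm_apply hdy.hasFDerivAt
    have hB := (hΓ.hasFDerivAt.clm_apply hdy.hasFDerivAt).clm_apply hdz.hasFDerivAt
    -- `N` itself is not assumed smooth. The field `N_Y Z` is differentiable because its local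
    -- expression is.
    have hW : MDiffAt (T% (fun y ↦ N Z y (Y y))) (f u) :=
      hf.mdifferentiableAt_of_pull
        ((hA.fun_add hB).differentiableAt.congr_of_eventuallyEq h1)
    rw [hN.self_of_nhds.pull_apply hf hW, h1.fderiv_eq, h1.self_of_nhds, (hA.fun_add hB).fderiv]
    simp only [add_apply, ContinuousLinearMap.comp_apply, ContinuousLinearMap.flip_apply]
    abel
  have hsymm : fderiv ℝ (fderiv ℝ (pull f Z)) u (pull f X u) (pull f Y u) =
      fderiv ℝ (fderiv ℝ (pull f Z)) u (pull f Y u) (pull f X u) :=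
    (hz.isSymmSndFDerivAt (by rw [minSmoothness_of_isRCLikeNormedField]; norm_cast)).eq _ _
  have h3 : pull f (fun x ↦ N Z x (VectorField.mlieBracket I X Y x)) u =
      fderiv ℝ (pull f Z) u (pull f (VectorField.mlieBracket I X Y) u) +
        Γ u (pull f (VectorField.mlieBracket I X Y) u) (pull f Z u) :=
    hN.self_of_nhds.pull_apply hf (hZ.mdifferentiableAt _)
  rw [hf.pull_mlieBracket (hX.mdifferentiableAt _) (hY.mdifferentiableAt _)] at h3
  have h4 : pull f (curvature N X Y Z) u =
      pull f (fun x ↦ N (fun y ↦ N Z y (Y y)) x (X x)) u -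
      pull f (fun x ↦ N (fun y ↦ N Z y (X y)) x (Y x)) u -
      pull f (fun x ↦ N Z x (VectorField.mlieBracket I X Y x)) u := by
    simp only [pull_eq_dparInv, curvature, map_sub]
  rw [h4, key X Y hX hY, key Y X hY hX, h3, hsymm, christoffelCurvature]
  simp only [map_sub, map_add, sub_apply]
  abel

/-- The product rule for `g(Y, Z)` produces exactly the derivatives of `Y` and `Z` contained in the
covariant derivatives, so only tensorial terms remain. -/
lemma nablaMetric_param (hf : IsParamAt I f u) {N : Connection I M} (g : RiemMetric I M)
    {Γ : F →L[ℝ] F →L[ℝ] F} (hN : Represents N f u Γ)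
    (hg : DifferentiableAt ℝ (metricPull g f) u)
    {X Y Z : Π x : M, TangentSpace I x} (hY : SmoothVF Y) (hZ : SmoothVF Z) :
    nablaMetric N g X Y Z (f u) =
      fderiv ℝ (metricPull g f) u (pull f X u) (pull f Y u) (pull f Z u) -
      metricPull g f u (Γ (pull f X u) (pull f Y u)) (pull f Z u) -
      metricPull g f u (pull f Y u) (Γ (pull f X u) (pull f Z u)) := by
  have hdy := hf.differentiableAt_pull (hY.mdifferentiableAt _)
  have hdz := hf.differentiableAt_pull (hZ.mdifferentiableAt _)
  have hs : MDifferentiableAt I 𝓘(ℝ, ℝ) (fun y ↦ g.inner y (Y y) (Z y)) (f u) :=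
    (contMDiffAt_inner g (hY _) (hZ _)).mdifferentiableAt (by simp)
  have h1 : (fun y ↦ g.inner y (Y y) (Z y)) ∘ f =ᶠ[𝓝 u]
      fun v ↦ metricPull g f v (pull f Y v) (pull f Z v) := by
    filter_upwards [hf.eventually] with v hv
    exact (hv.metricPull_pull g Y Z).symm
  have hB := (hg.hasFDerivAt.clm_apply hdy.hasFDerivAt).clm_apply hdz.hasFDerivAt
  rw [nablaMetric, ← hf.dpar_pull X, hf.mvfderiv_dpar hs, h1.fderiv_eq, hB.fderiv,
    hN Y (hY.mdifferentiableAt _), hN Z (hZ.mdifferentiableAt _)]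
  rw [← hf.dpar_pull Y, ← hf.dpar_pull Z, ← metricPull_apply, ← metricPull_apply,
    covPull_apply, covPull_apply]
  simp only [add_apply, ContinuousLinearMap.comp_apply, ContinuousLinearMap.flip_apply, map_add]
  ring

lemma torsion_param (hf : IsParamAt I f u) {N : Connection I M}
    {Γ : F →L[ℝ] F →L[ℝ] F} (hN : Represents N f u Γ)
    {X Y : Π x : M, TangentSpace I x} (hX : SmoothVF X) (hY : SmoothVF Y) :
    N Y (f u) (X (f u)) - N X (f u) (Y (f u)) - VectorField.mlieBracket I X Y (f u) =
      dpar I f u (Γ (pull f X u) (pull f Y u) - Γ (pull f Y u) (pull f X u)) := by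
  have h := hf.pull_mlieBracket (hX.mdifferentiableAt _) (hY.mdifferentiableAt _)
  have h1 := hN Y (hY.mdifferentiableAt _) (pull f X u)
  have h2 := hN X (hX.mdifferentiableAt _) (pull f Y u)
  rw [hf.dpar_pull] at h1 h2
  rw [h1, h2, ← hf.dpar_pull (VectorField.mlieBracket I X Y), h, ← map_sub, ← map_sub,
    covPull_apply, covPull_apply]
  congr 1
  abel

variable [T2Space M]

lemma torsionFree_iff_christoffel (hf : IsParamAt I f u) {N : Connection I M}
    {Γ : F →L[ℝ] F →L[ℝ] F} (hN : Represents N f u Γ) :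
    (haveI : CompleteSpace F := FiniteDimensional.complete ℝ F
     haveI := isManifold_of_top I M
     N.torsion (f u) = 0) ↔ ∀ x y, Γ x y = Γ y x := by
  have : CompleteSpace F := FiniteDimensional.complete ℝ F
  have := isManifold_of_top I M
  have key : ∀ x y : F, N.torsion (f u) (dpar I f u x) (dpar I f u y) =
      dpar I f u (Γ x y - Γ y x) := by
    intro x y
    obtain ⟨X, hX, hx⟩ := hf.exists_smoothVF_const x
    obtain ⟨Y, hY, hy⟩ := hf.exists_smoothVF_const y
    have h := torsion_param hf hN hX hY
    rw [← N.torsion_apply (hX.mdifferentiableAt _) (hY.mdifferentiableAt _), ← hf.dpar_pull X,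
      ← hf.dpar_pull Y, hx.self_of_nhds, hy.self_of_nhds] at h
    exact h
  constructor
  · intro h x y
    have h1 := key x y
    rw [h] at h1
    have h2 : dpar I f u (Γ x y - Γ y x) = dpar I f u 0 := by
      rw [← h1, map_zero]; rfl
    exact sub_eq_zero.1 (hf.dpar_injective h2)
  · intro h
    ext v w
    rw [← hf.dpar_dparInv v, ← hf.dpar_dparInv w, key, h, sub_self, map_zero]
    rfl

end Tensors

/-- The unit ball of a positive definite form on a finite-dimensional space is bounded. -/
lemma isVonNBounded_of_posDef {F : Type*} [NormedAddCommGroup F] [NormedSpace ℝ F]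
    [FiniteDimensional ℝ F] (b : F →L[ℝ] F →L[ℝ] ℝ) (hb : ∀ v, v ≠ 0 → 0 < b v v) :
    Bornology.IsVonNBounded ℝ {v : F | b v v < 1} := by
  rw [NormedSpace.isVonNBounded_iff]
  have : ProperSpace F := FiniteDimensional.proper ℝ F
  -- The unit sphere is empty when `F` is the zero space.
  rcases (Metric.sphere (0 : F) 1).eq_empty_or_nonempty with he | hne
  · have h0 : ∀ v : F, v = 0 := by
      intro v
      by_contra hv
      have : (‖v‖⁻¹ • v) ∈ Metric.sphere (0 : F) 1 := by
        simp [norm_smul, inv_mul_cancel₀ (norm_ne_zero_iff.2 hv)]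
      rw [he] at this
      exact this
    exact (Bornology.isBounded_singleton (x := (0 : F))).subset fun v _ ↦ h0 v
  · have hcont : Continuous fun v : F ↦ b v v := b.continuous.clm_apply continuous_id
    obtain ⟨v₀, hv₀, hmin⟩ := (isCompact_sphere (0 : F) 1).exists_isMinOn hne hcont.continuousOn
    have hv₀' : v₀ ≠ 0 := by
      rintro rfl
      simp at hv₀
    have hm := hb v₀ hv₀'
    -- The minimum `m = b v₀ v₀` on the sphere gives `m ‖v‖² ≤ b v v < 1`. The radius `1 + m⁻¹`
    -- avoids a square root, since `‖v‖ ≤ 1 + ‖v‖²`.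
    refine (Metric.isBounded_closedBall (x := (0 : F)) (r := 1 + (b v₀ v₀)⁻¹)).subset fun v hv ↦ ?_
    rw [mem_closedBall_zero_iff]
    rcases eq_or_ne v 0 with rfl | hv0
    · simp only [norm_zero]; positivity
    have hn : 0 < ‖v‖ := norm_pos_iff.2 hv0
    have h1 : (‖v‖⁻¹ • v) ∈ Metric.sphere (0 : F) 1 := by
      simp [norm_smul, inv_mul_cancel₀ hn.ne']
    have h2 : b v₀ v₀ ≤ ‖v‖⁻¹ * (‖v‖⁻¹ * b v v) := by simpa using hmin h1
    have h3 : b v₀ v₀ * ‖v‖ ^ 2 ≤ b v v := by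
      calc b v₀ v₀ * ‖v‖ ^ 2 ≤ ‖v‖⁻¹ * (‖v‖⁻¹ * b v v) * ‖v‖ ^ 2 := by gcongr
        _ = b v v := by field_simp
    have h4 : b v v < 1 := hv
    have h5 : ‖v‖ ^ 2 ≤ (b v₀ v₀)⁻¹ := by
      rw [← one_div, le_div_iff₀ hm]; linarith
    nlinarith [sq_nonneg (‖v‖ - 1)]

/-! ### Change of parametrization -/

section Transition

variable {F : Type*} [NormedAddCommGroup F] [NormedSpace ℝ F]
  {H : Type*} [TopologicalSpace H] {I : ModelWithCorners ℝ F H}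
  {M : Type*} [TopologicalSpace M] [ChartedSpace H M]

/-- `τ` is a smooth change of parametrizations from `f` near `u` to `f'` near `u'`. -/
structure IsTransition (f f' : F → M) (u u' : F) (τ : F → F) : Prop where
  contDiffAt : ContDiffAt ℝ ∞ τ u
  map : τ u = u'
  comp : ∀ᶠ v in 𝓝 u, f' (τ v) = f v

/-- The transformation law of Christoffel symbols under the change of parametrizations `τ`. -/
def ChristoffelLaw (τ : F → F) (u : F) (Γ Γ' : F →L[ℝ] F →L[ℝ] F) : Prop :=
  ∀ w z : F, fderiv ℝ τ u (Γ w z) =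
    fderiv ℝ (fderiv ℝ τ) u w z + Γ' (fderiv ℝ τ u w) (fderiv ℝ τ u z)

/-- All tangent spaces are definitionally the model space, so vectors at equal base points can be
compared in `F` without transport. -/
lemma tangent_congr {A : Sort*} (θ : Π x : M, TangentSpace I x → A) {x y : M} (h : x = y)
    {v : TangentSpace I x} {w : TangentSpace I y} (hvw : (v : F) = w) : θ x v = θ y w := by
  subst h
  exact congrArg _ hvw

variable {f f' : F → M} {u u' : F} {τ : F → F}

lemma dpar_of_comp {v : F} (hf' : IsParamAt I f' (τ v)) (hτ : DifferentiableAt ℝ τ v)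
    (h : ∀ᶠ v' in 𝓝 v, f' (τ v') = f v') (w : F) :
    (dpar I f v w : F) = dpar I f' (τ v) (fderiv ℝ τ v w) := by
  have h4 := mfderiv_comp v (hf'.mdifferentiableAt (by simp)) hτ.mdifferentiableAt
  have h5 : f =ᶠ[𝓝 v] f' ∘ τ := by filter_upwards [h] with v hv using hv.symm
  have h6 := h5.mfderiv_eq (I := 𝓘(ℝ, F)) (I' := I)
  rw [mfderiv_eq_fderiv] at h4
  have h7 := congrArg (fun L : F →L[ℝ] F ↦ L w) h6
  have h8 := congrArg (fun L : F →L[ℝ] F ↦ L w) h4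
  exact h7.trans h8

lemma IsTransition.eq (h : IsTransition f f' u u' τ) : f u = f' u' := by
  rw [← h.map, h.comp.self_of_nhds]

lemma IsTransition.dpar_eq (h : IsTransition f f' u u' τ) (hf' : IsParamAt I f' u') (w : F) :
    (dpar I f u w : F) = dpar I f' u' (fderiv ℝ τ u w) := by
  obtain ⟨h1, rfl, h3⟩ := h
  exact dpar_of_comp hf' (h1.differentiableAt (by simp)) h3 w

lemma IsTransition.pull_eq (h : IsTransition f f' u u' τ) (hf : IsParamAt I f u)
    (hf' : IsParamAt I f' u') (Z : Π x : M, TangentSpace I x) :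
    ∀ᶠ v in 𝓝 u, pull f' Z (τ v) = fderiv ℝ τ v (pull f Z v) := by
  have h1 : ∀ᶠ v in 𝓝 u, IsParamAt I f' (τ v) := by
    have := hf'.eventually
    rw [← h.map] at this
    exact h.contDiffAt.continuousAt.eventually this
  have h2 : ∀ᶠ v in 𝓝 u, ContDiffAt ℝ 1 τ v :=
    (h.contDiffAt.of_le (by norm_cast)).eventually (by simp)
  filter_upwards [h1, h2, hf.eventually, h.comp.eventually_nhds] with v hv1 hv2 hv3 hv4
  have h9 := dpar_of_comp (I := I) hv1 (hv2.differentiableAt (by simp)) hv4 (pull f Z v)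
  exact hv1.pull_eq (h9.symm.trans ((hv3.dpar_pull Z).trans
    (congrArg (fun y ↦ (Z y : F)) hv4.self_of_nhds.symm)))

/-- Differentiate the identity `z'(τ v) = dτ_v (z v)` between the two expressions of `Z`. What
remains is the defect in the transformation law of Christoffel symbols, depending on `Z` only
through its value at the point. -/
lemma IsTransition.covPull_sub [FiniteDimensional ℝ F] [IsManifold I ∞ M]
    (h : IsTransition f f' u u' τ) (hf : IsParamAt I f u)
    (hf' : IsParamAt I f' u') {Z : Π x : M, TangentSpace I x} (hZ : MDiffAt (T% Z) (f u))
    (Γ Γ' : F →L[ℝ] F →L[ℝ] F) (w : F) :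
    covPull f' u' Γ' Z (fderiv ℝ τ u w) - fderiv ℝ τ u (covPull f u Γ Z w) =
      fderiv ℝ (fderiv ℝ τ) u w (pull f Z u) +
        Γ' (fderiv ℝ τ u w) (fderiv ℝ τ u (pull f Z u)) - fderiv ℝ τ u (Γ w (pull f Z u)) := by
  have h1 := h.pull_eq hf hf' Z
  have hZ' : MDiffAt (T% Z) (f' u') := by rw [← h.eq]; exact hZ
  have hd' := hf'.differentiableAt_pull hZ'
  have hd := hf.differentiableAt_pull hZ
  have hdd : DifferentiableAt ℝ (fderiv ℝ τ) u :=
    (h.contDiffAt.fderiv_right (m := ∞) (by simp)).differentiableAt (by simp)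
  obtain ⟨h2, rfl, h3⟩ := h
  have hτ : DifferentiableAt ℝ τ u := h2.differentiableAt (by simp)
  have e1 : HasFDerivAt (fun v ↦ pull f' Z (τ v)) _ u := hd'.hasFDerivAt.comp u hτ.hasFDerivAt
  have e2 := hdd.hasFDerivAt.clm_apply hd.hasFDerivAt
  have e3 := congrArg (fun L : F →L[ℝ] F ↦ L w)
    (e1.unique (e2.congr_of_eventuallyEq h1))
  simp only [ContinuousLinearMap.comp_apply, add_apply, ContinuousLinearMap.flip_apply] at e3
  rw [covPull_apply, covPull_apply, e3, h1.self_of_nhds, map_add]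
  abel

variable [FiniteDimensional ℝ F] [IsManifold I ∞ M]

lemma ChristoffelLaw.covPull_eq {Γ Γ' : F →L[ℝ] F →L[ℝ] F} (hl : ChristoffelLaw τ u Γ Γ')
    (h : IsTransition f f' u u' τ) (hf : IsParamAt I f u)
    (hf' : IsParamAt I f' u') {Z : Π x : M, TangentSpace I x} (hZ : MDiffAt (T% Z) (f u)) (w : F) :
    covPull f' u' Γ' Z (fderiv ℝ τ u w) = fderiv ℝ τ u (covPull f u Γ Z w) := by
  rw [← sub_eq_zero, h.covPull_sub hf hf' hZ, hl, sub_self]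

/-- Both expressions compute the same covariant derivative, so the defect in `covPull_sub` vanishes.
A test field with prescribed value `z` isolates each coefficient. -/
lemma Represents.christoffelLaw [T2Space M] {N : Connection I M} {Γ Γ' : F →L[ℝ] F →L[ℝ] F}
    (hN : Represents N f u Γ) (hN' : Represents N f' u' Γ') (h : IsTransition f f' u u' τ)
    (hf : IsParamAt I f u) (hf' : IsParamAt I f' u') : ChristoffelLaw τ u Γ Γ' := by
  intro w z
  obtain ⟨Z, hZ, hz⟩ := hf.exists_smoothVF_const z
  have h1 := h.covPull_sub hf hf' (hZ.mdifferentiableAt _) Γ Γ' w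
  have h2 : covPull f' u' Γ' Z (fderiv ℝ τ u w) = fderiv ℝ τ u (covPull f u Γ Z w) := by
    apply hf'.dpar_injective
    rw [← hN' Z (hZ.mdifferentiableAt _)]
    have h3 : (N Z (f u) (dpar I f u w) : F) = N Z (f' u') (dpar I f' u' (fderiv ℝ τ u w)) :=
      tangent_congr (fun x (v : TangentSpace I x) ↦ (N Z x v : F)) h.eq (h.dpar_eq hf' w)
    exact (h3.symm.trans (hN Z (hZ.mdifferentiableAt _) w)).trans (h.dpar_eq hf' _)
  rw [h2, sub_self, hz.self_of_nhds] at h1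
  exact (sub_eq_zero.1 h1.symm).symm

lemma IsTransition.metricPull_eq (h : IsTransition f f' u u' τ) (hf' : IsParamAt I f' u')
    (g : RiemMetric I M) (w z : F) :
    metricPull g f u w z = metricPull g f' u' (fderiv ℝ τ u w) (fderiv ℝ τ u z) := by
  have h1 := h.dpar_eq hf' w
  have h2 := h.dpar_eq hf' z
  rw [metricPull_apply, metricPull_apply]
  revert h1 h2
  -- The vectors are made free variables so that the base point can be rewritten along `f u = f'
  -- u'`.
  generalize dpar I f u w = a, dpar I f u z = b, dpar I f' u' (fderiv ℝ τ u w) = a',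
    dpar I f' u' (fderiv ℝ τ u z) = b'
  revert a b a' b'
  rw [h.eq]
  rintro a b a' b' rfl rfl
  rfl

end Transition

/-! ### Gluing tensors and connections -/

section Gluing

variable {F : Type*} [NormedAddCommGroup F] [NormedSpace ℝ F]
  {H : Type*} [TopologicalSpace H] {I : ModelWithCorners ℝ F H}
  {M : Type*} [TopologicalSpace M] [ChartedSpace H M] {ι : Type*}

/-- A cover of `M` by parametrizations. -/
structure IsParamCover (I : ModelWithCorners ℝ F H) (f : ι → F → M) (U : ι → Set F) : Prop where
  isOpen : ∀ i, IsOpen (U i)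
  param : ∀ i, ∀ u ∈ U i, IsParamAt I (f i) u
  cover : ∀ x, ∃ i, ∃ u ∈ U i, f i u = x

/-- All changes of parametrizations in the family `f` satisfy `P`. -/
def Compatible (f : ι → F → M) (U : ι → Set F) (P : ι → ι → F → F → (F → F) → Prop) : Prop :=
  ∀ i j, ∀ u ∈ U i, ∀ u' ∈ U j, f i u = f j u' →
    ∃ τ, IsTransition (f i) (f j) u u' τ ∧ P i j u u' τ

variable {f : ι → F → M} {U : ι → Set F}

/-- At each point transport the local expression from one parametrization; compatibility makes the
result independent of the choice. The other gluing lemmas follow the same pattern. -/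
lemma exists_form (hU : IsParamCover I f U) (θ : ι → F → F →L[ℝ] ℝ)
    (hc : Compatible f U fun i j u u' τ ↦ ∀ w, θ i u w = θ j u' (fderiv ℝ τ u w)) :
    ∃ Θ : Π x : M, TangentSpace I x →L[ℝ] ℝ, ∀ i, ∀ u ∈ U i, ∀ w,
      Θ (f i u) (dpar I (f i) u w) = θ i u w := by
  have key : ∀ x : M, ∃ t : TangentSpace I x →L[ℝ] ℝ, ∀ i, ∀ u ∈ U i, f i u = x → ∀ w,
      t (dpar I (f i) u w) = θ i u w := by
    intro x
    obtain ⟨j, u', hu', rfl⟩ := hU.cover x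
    refine ⟨(θ j u').comp (dparInv I (f j) u'), fun i u hu h w ↦ ?_⟩
    obtain ⟨τ, hτ, hl⟩ := hc i j u hu u' hu' h
    have hp := hU.param j u' hu'
    have h1 := hτ.dpar_eq hp w
    rw [hl w, ← hp.dparInv_dpar (fderiv ℝ τ u w)]
    exact congrArg (fun v : F ↦ θ j u' (dparInv I (f j) u' v)) h1
  choose Θ hΘ using key
  exact ⟨Θ, fun i u hu w ↦ hΘ _ i u hu rfl w⟩

lemma exists_vectorField (hU : IsParamCover I f U) (ξ : ι → F → F)
    (hc : Compatible f U fun i j u u' τ ↦ fderiv ℝ τ u (ξ i u) = ξ j u') :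
    ∃ Ξ : Π x : M, TangentSpace I x, ∀ i, ∀ u ∈ U i, dpar I (f i) u (ξ i u) = Ξ (f i u) := by
  have key : ∀ x : M, ∃ t : TangentSpace I x, ∀ i, ∀ u ∈ U i, f i u = x →
      (dpar I (f i) u (ξ i u) : F) = t := by
    intro x
    obtain ⟨j, u', hu', rfl⟩ := hU.cover x
    refine ⟨dpar I (f j) u' (ξ j u'), fun i u hu h ↦ ?_⟩
    obtain ⟨τ, hτ, hl⟩ := hc i j u hu u' hu' h
    have h1 := hτ.dpar_eq (hU.param j u' hu') (ξ i u)
    rw [hl] at h1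
    exact h1
  choose Ξ hΞ using key
  exact ⟨Ξ, fun i u hu ↦ hΞ _ i u hu rfl⟩

lemma exists_bilin (hU : IsParamCover I f U) (B : ι → F → F →L[ℝ] F →L[ℝ] ℝ)
    (hc : Compatible f U fun i j u u' τ ↦
      ∀ w z, B i u w z = B j u' (fderiv ℝ τ u w) (fderiv ℝ τ u z)) :
    ∃ b : Π x : M, TangentSpace I x →L[ℝ] TangentSpace I x →L[ℝ] ℝ, ∀ i, ∀ u ∈ U i, ∀ w z,
      b (f i u) (dpar I (f i) u w) (dpar I (f i) u z) = B i u w z := by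
  have key : ∀ x : M, ∃ t : TangentSpace I x →L[ℝ] TangentSpace I x →L[ℝ] ℝ,
      ∀ i, ∀ u ∈ U i, f i u = x → ∀ w z,
      t (dpar I (f i) u w) (dpar I (f i) u z) = B i u w z := by
    intro x
    obtain ⟨j, u', hu', rfl⟩ := hU.cover x
    refine ⟨(ContinuousLinearMap.precomp ℝ (dparInv I (f j) u')).comp
      ((B j u').comp (dparInv I (f j) u')), fun i u hu h w z ↦ ?_⟩
    obtain ⟨τ, hτ, hl⟩ := hc i j u hu u' hu' h
    have hp := hU.param j u' hu'
    have h1 := hτ.dpar_eq hp w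
    have h2 := hτ.dpar_eq hp z
    rw [hl w z, ← hp.dparInv_dpar (fderiv ℝ τ u w), ← hp.dparInv_dpar (fderiv ℝ τ u z)]
    exact congrArg₂ (fun v v' : F ↦ B j u' (dparInv I (f j) u' v) (dparInv I (f j) u' v')) h1 h2
  choose b hb using key
  exact ⟨b, fun i u hu w ↦ hb _ i u hu rfl w⟩

variable [FiniteDimensional ℝ F] [IsManifold I ∞ M]

lemma smoothForm_of_params (hU : IsParamCover I f U) {θ : ι → F → F →L[ℝ] ℝ}
    {Θ : Π x : M, TangentSpace I x →L[ℝ] ℝ}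
    (hΘ : ∀ i, ∀ u ∈ U i, ∀ w, Θ (f i u) (dpar I (f i) u w) = θ i u w)
    (hθ : ∀ i, ∀ u ∈ U i, ContDiffAt ℝ ∞ (θ i) u) : SmoothForm Θ := by
  intro x
  obtain ⟨i, u, hu, rfl⟩ := hU.cover x
  have hp := hU.param i u hu
  refine contMDiffAt_hom_of_apply (V := Bundle.Trivial M ℝ) Θ (f i u) fun X hX ↦ ?_
  rw [contMDiffAt_section]
  refine hp.contMDiffAt_comp_iff.2 ?_
  refine ((hθ i u hu).clm_apply (hp.contDiffAt_pull hX)).congr_of_eventuallyEq ?_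
  filter_upwards [(hU.isOpen i).mem_nhds hu] with v hv
  change Θ (f i v) (X (f i v)) = _
  rw [← hΘ i v hv, (hU.param i v hv).dpar_pull]

lemma smoothVF_of_params (hU : IsParamCover I f U) {ξ : ι → F → F}
    {Ξ : Π x : M, TangentSpace I x}
    (hΞ : ∀ i, ∀ u ∈ U i, dpar I (f i) u (ξ i u) = Ξ (f i u))
    (hξ : ∀ i, ∀ u ∈ U i, ContDiffAt ℝ ∞ (ξ i) u) : SmoothVF Ξ := by
  intro x
  obtain ⟨i, u, hu, rfl⟩ := hU.cover x
  refine (hU.param i u hu).contMDiffAt_of_pull ((hξ i u hu).congr_of_eventuallyEq ?_)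
  filter_upwards [(hU.isOpen i).mem_nhds hu] with v hv
  exact (hU.param i v hv).pull_eq (hΞ i v hv)

lemma exists_metric (hU : IsParamCover I f U) (B : ι → F → F →L[ℝ] F →L[ℝ] ℝ)
    (hB : ∀ i, ∀ u ∈ U i, ContDiffAt ℝ ∞ (B i) u)
    (hsymm : ∀ i, ∀ u ∈ U i, ∀ w z, B i u w z = B i u z w)
    (hpos : ∀ i, ∀ u ∈ U i, ∀ w, w ≠ 0 → 0 < B i u w w)
    (hc : Compatible f U fun i j u u' τ ↦
      ∀ w z, B i u w z = B j u' (fderiv ℝ τ u w) (fderiv ℝ τ u z)) :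
    ∃ g : RiemMetric I M, ∀ i, ∀ u ∈ U i, metricPull g (f i) u = B i u := by
  obtain ⟨b, hb⟩ := exists_bilin hU B hc
  have hb' : ∀ i, ∀ u ∈ U i, ∀ v w : TangentSpace I (f i u), b (f i u) v w =
      B i u (dparInv I (f i) u v) (dparInv I (f i) u w) := by
    intro i u hu v w
    have hp := hU.param i u hu
    rw [← hb i u hu, hp.dpar_dparInv, hp.dpar_dparInv]
  have hbpos : ∀ (x : M) (v : TangentSpace I x), v ≠ 0 → 0 < b x v v := by
    intro x v hv
    obtain ⟨i, u, hu, rfl⟩ := hU.cover x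
    rw [hb' i u hu]
    refine hpos i u hu _ fun h ↦ hv ?_
    rw [← (hU.param i u hu).dpar_dparInv v, h, map_zero]
  refine ⟨⟨b, ?_, hbpos, ?_, ?_⟩, fun i u hu ↦ ?_⟩
  · intro x v w
    obtain ⟨i, u, hu, rfl⟩ := hU.cover x
    rw [hb' i u hu, hb' i u hu, hsymm i u hu]
  · intro x
    exact isVonNBounded_of_posDef (F := F) (b x) (hbpos x)
  · intro x
    obtain ⟨i, u, hu, rfl⟩ := hU.cover x
    have hp := hU.param i u hu
    refine contMDiffAt_hom_of_apply (V := fun x : M ↦ TangentSpace I x →L[ℝ] ℝ)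
      b (f i u) fun X hX ↦ ?_
    refine contMDiffAt_hom_of_apply (V := Bundle.Trivial M ℝ) (fun y ↦ b y (X y))
      (f i u) fun Y hY ↦ ?_
    rw [contMDiffAt_section]
    refine hp.contMDiffAt_comp_iff.2 ?_
    refine (((hB i u hu).clm_apply (hp.contDiffAt_pull hX)).clm_apply
      (hp.contDiffAt_pull hY)).congr_of_eventuallyEq ?_
    filter_upwards [(hU.isOpen i).mem_nhds hu] with v hv
    change b (f i v) (X (f i v)) (Y (f i v)) = _
    rw [← hb i v hv, (hU.param i v hv).dpar_pull, (hU.param i v hv).dpar_pull]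
  · ext w z
    rw [metricPull_apply]
    exact hb i u hu w z

/-- The transformation law says precisely that `covPull` conjugated by the differential does not
depend on the parametrization. Additivity and the Leibniz rule are inherited from `covPull`. -/
lemma exists_connection (hU : IsParamCover I f U) (Γ : ι → F → F →L[ℝ] F →L[ℝ] F)
    (hΓ : ∀ i, ∀ u ∈ U i, ContDiffAt ℝ ∞ (Γ i) u)
    (hc : Compatible f U fun i j u u' τ ↦ ChristoffelLaw τ u (Γ i u) (Γ j u')) :
    ∃ N : Connection I M, SmoothConnection N ∧ ∀ i, ∀ u ∈ U i, Represents N (f i) u (Γ i u) := by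
  have key : ∀ x : M, ∃ A : (Π x : M, TangentSpace I x) → TangentSpace I x →L[ℝ] TangentSpace I x,
      (∀ Z Z', MDiffAt (T% Z) x → MDiffAt (T% Z') x → A (Z + Z') = A Z + A Z') ∧
      (∀ Z (g : M → ℝ), MDiffAt (T% Z) x → MDiffAt g x →
        A (g • Z) = g x • A Z + (mvfderiv I g x).smulRight (Z x)) ∧
      ∀ i, ∀ u ∈ U i, f i u = x → ∀ Z, MDiffAt (T% Z) x → ∀ w,
      (A Z (dpar I (f i) u w) : F) = dpar I (f i) u (covPull (f i) u (Γ i u) Z w) := by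
    intro x
    obtain ⟨j, u', hu', rfl⟩ := hU.cover x
    have hp := hU.param j u' hu'
    refine ⟨fun Z ↦ (dpar I (f j) u').comp
      ((covPull (f j) u' (Γ j u') Z).comp (dparInv I (f j) u')), ?_, ?_, ?_⟩
    · intro Z Z' hZ hZ'
      ext v
      simp only [ContinuousLinearMap.comp_apply, covPull_add hp _ hZ hZ', add_apply, map_add]
    · intro Z g hZ hg
      ext v
      simp only [ContinuousLinearMap.comp_apply, covPull_smul hp _ hg hZ, add_apply, map_add,
        smul_apply, map_smul, ContinuousLinearMap.smulRight_apply, hp.dpar_dparInv, hp.dpar_pull]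
    · intro i u hu h Z hZ w
      obtain ⟨τ, hτ, hl⟩ := hc i j u hu u' hu' h
      have hpi := hU.param i u hu
      have h1 := hl.covPull_eq hτ hpi hp (by rw [h]; exact hZ) w
      have h2 := hτ.dpar_eq hp w
      have h3 := hτ.dpar_eq hp (covPull (f i) u (Γ i u) Z w)
      rw [← h1, ← hp.dparInv_dpar (fderiv ℝ τ u w)] at h3
      refine Eq.trans ?_ h3.symm
      exact congrArg (fun v : F ↦ (dpar I (f j) u'
        (covPull (f j) u' (Γ j u') Z (dparInv I (f j) u' v)) : F)) h2
  choose A hadd hsmul hrep using key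
  let N : Connection I M :=
    { toFun := fun Z x ↦ A x Z
      isCovariantDerivativeOnUniv :=
        { add := fun hZ hZ' _ ↦ hadd _ _ _ hZ hZ'
          leibniz := fun hZ hg _ ↦ hsmul _ _ _ hZ hg } }
  have hN : ∀ i, ∀ u ∈ U i, Represents N (f i) u (Γ i u) :=
    fun i u hu Z hZ w ↦ hrep _ i u hu rfl Z hZ w
  refine ⟨N, ⟨⟨fun {Z} hZ x _ ↦ ?_⟩⟩, hN⟩
  obtain ⟨i, u, hu, rfl⟩ := hU.cover x
  have hp := hU.param i u hu
  refine ContMDiffAt.contMDiffWithinAt ?_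
  refine contMDiffAt_hom_of_apply (V := fun x : M ↦ TangentSpace I x) (N Z) (f i u) fun X hX ↦ ?_
  have hZ' : SmoothVF Z := by
    rw [contMDiffOn_univ] at hZ
    exact hZ
  have hz := hp.contDiffAt_pull (hZ' (f i u))
  have hx := hp.contDiffAt_pull hX
  refine hp.contMDiffAt_of_pull ?_
  refine (((hz.fderiv_right (m := ∞) (by simp)).clm_apply hx).add
    (((hΓ i u hu).clm_apply hx).clm_apply hz)).congr_of_eventuallyEq ?_
  filter_upwards [(hU.isOpen i).mem_nhds hu] with v hv
  exact (hN i v hv).pull_apply (hU.param i v hv) (hZ'.mdifferentiableAt _)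

end Gluing

/-! ### Statistical manifolds in a parametrization -/

section Statistical

variable {F : Type*} [NormedAddCommGroup F] [NormedSpace ℝ F] [FiniteDimensional ℝ F]
  {H : Type*} [TopologicalSpace H] {I : ModelWithCorners ℝ F H}
  {M : Type*} [TopologicalSpace M] [ChartedSpace H M] [IsManifold I ∞ M] [T2Space M]
  {f : F → M} {u : F} {D : Connection I M} {g : RiemMetric I M}

lemma IsStatistical.christoffel_comm (h : IsStatistical D g) (hf : IsParamAt I f u) (x y : F) :
    christoffel D f u x y = christoffel D f u y x :=
  (torsionFree_iff_christoffel hf (represents_christoffel hf D)).1 (h.torsionFree (f u)) x y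

lemma eventually_represents_christoffel (hf : IsParamAt I f u) (D : Connection I M) :
    ∀ᶠ v in 𝓝 u, Represents D f v (christoffel D f v) := by
  filter_upwards [hf.eventually] with v hv using represents_christoffel hv D

/-- The curvature identity evaluated on test fields taking the values `x`, `y`, `z` at the point;
the Codazzi equation below is obtained in the same way. -/
lemma HasConstantCurvature.christoffelCurvature_eq {c : ℝ} (h : HasConstantCurvature D g c)
    (hD : SmoothConnection D) (hf : IsParamAt I f u) (x y z : F) :
    christoffelCurvature (christoffel D f) u x y z =
      c • (metricPull g f u y z • x - metricPull g f u x z • y) := by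
  obtain ⟨X, hX, hx⟩ := hf.exists_smoothVF_const x
  obtain ⟨Y, hY, hy⟩ := hf.exists_smoothVF_const y
  obtain ⟨Z, hZ, hz⟩ := hf.exists_smoothVF_const z
  have h1 := pull_curvature hf (eventually_represents_christoffel hf D)
    ((contDiffAt_christoffel hf hD).differentiableAt (by simp)) hX hY hZ
  rw [hx.self_of_nhds, hy.self_of_nhds, hz.self_of_nhds] at h1
  rw [← h1]
  refine hf.pull_eq ?_
  rw [h X Y Z hX hY hZ, ← hf.metricPull_pull, ← hf.metricPull_pull, hx.self_of_nhds,
    hy.self_of_nhds, hz.self_of_nhds, map_smul, map_sub, map_smul, map_smul,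
    ← hf.dpar_pull X, ← hf.dpar_pull Y, hx.self_of_nhds, hy.self_of_nhds]

lemma IsStatistical.codazzi (h : IsStatistical D g) (hf : IsParamAt I f u) (x y z : F) :
    fderiv ℝ (metricPull g f) u x y z
      - metricPull g f u (christoffel D f u x y) z - metricPull g f u y (christoffel D f u x z) =
    fderiv ℝ (metricPull g f) u y x z
      - metricPull g f u (christoffel D f u y x) z
      - metricPull g f u x (christoffel D f u y z) := by
  obtain ⟨X, hX, hx⟩ := hf.exists_smoothVF_const x
  obtain ⟨Y, hY, hy⟩ := hf.exists_smoothVF_const y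
  obtain ⟨Z, hZ, hz⟩ := hf.exists_smoothVF_const z
  have hg := (contDiffAt_metricPull hf g).differentiableAt (by simp)
  have h1 := (h.symmetric X Y Z hX hY hZ (f u)).1
  have hr := represents_christoffel hf D
  rw [nablaMetric_param hf g hr hg hY hZ, nablaMetric_param hf g hr hg hX hZ,
    hx.self_of_nhds, hy.self_of_nhds, hz.self_of_nhds] at h1
  exact h1

end Statistical

/-! ### Automorphisms in a parametrization -/

section Automorphism

variable {F : Type*} [NormedAddCommGroup F] [NormedSpace ℝ F] [FiniteDimensional ℝ F]
  {H : Type*} [TopologicalSpace H] {I : ModelWithCorners ℝ F H}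
  {M : Type*} [TopologicalSpace M] [ChartedSpace H M] [IsManifold I ∞ M]

/-- A smooth permutation with smooth inverse, as a diffeomorphism. -/
def permDiffeomorph (ψ : Equiv.Perm M) (h : ContMDiff I I ∞ ψ) (h' : ContMDiff I I ∞ ψ.symm) :
    Diffeomorph I I M M ∞ := ⟨ψ, h, h'⟩

lemma IsParamAt.comp_diffeomorph {f : F → M} {u : F} (hf : IsParamAt I f u)
    (φ : Diffeomorph I I M M ∞) : IsParamAt I (φ ∘ f) u :=
  IsLocalDiffeomorphAt.comp _ _ hf (φ.isLocalDiffeomorph (f u))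

lemma IsParamAt.dpar_comp {f : F → M} {u : F} (hf : IsParamAt I f u)
    (φ : Diffeomorph I I M M ∞) (w : F) :
    dpar I (φ ∘ f) u w = mfderiv I I φ (f u) (dpar I f u w) := by
  have := mfderiv_comp u ((φ.contMDiff (f u)).mdifferentiableAt (by simp))
    (hf.mdifferentiableAt (by simp))
  exact congrArg (fun L : F →L[ℝ] F ↦ L w) this

lemma PreservesMetric.metricPull_comp {g : RiemMetric I M} {φ : Diffeomorph I I M M ∞}
    (h : PreservesMetric g φ) {f : F → M} {u : F} (hf : IsParamAt I f u) :
    metricPull g (φ ∘ f) u = metricPull g f u := by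
  ext w z
  rw [metricPull_apply, metricPull_apply, hf.dpar_comp, hf.dpar_comp]
  exact h _ _ _

variable [T2Space M]

/-- The push-forward by `φ` of a field with constant expression in `f` has the same constant
expression in `φ ∘ f`. Preservation of `D` then equates the Christoffel symbols on all pairs of
vectors. -/
lemma PreservesConnection.represents_comp {D : Connection I M} {φ : Diffeomorph I I M M ∞}
    (h : PreservesConnection D univ φ) {f : F → M} {u : F} (hf : IsParamAt I f u)
    {Γ : F →L[ℝ] F →L[ℝ] F} (hΓ : Represents D f u Γ) : Represents D (φ ∘ f) u Γ := by
  have hfφ := hf.comp_diffeomorph φ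
  obtain ⟨Γ', hΓ'⟩ := exists_represents hfφ D
  suffices Γ = Γ' by rw [this]; exact hΓ'
  ext w z
  have : CompleteSpace F := FiniteDimensional.complete ℝ F
  -- The push-forward by `φ` is realized as the pullback by `φ.symm`, which gives a global smooth
  -- `φ`-related field.
  have hφ : ∀ X : Π x : M, TangentSpace I x, SmoothVF X →
      ∃ X' : Π x : M, TangentSpace I x, SmoothVF X' ∧
        (∀ x, mfderiv I I φ x (X x) = X' (φ x)) := by
    intro X hX
    have hinv : ∀ x, (mfderiv I I φ.symm x).IsInvertible := fun x ↦
      ⟨φ.symm.mfderivToContinuousLinearEquiv (by simp) x, rfl⟩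
    refine ⟨VectorField.mpullback I I φ.symm X, ContMDiff.mpullback_vectorField hX
      φ.symm.contMDiff hinv (by simp), fun x ↦ ?_⟩
    rw [VectorField.mpullback_apply]
    obtain ⟨e, he⟩ := hinv (φ x)
    have h0 : φ.symm ∘ φ =ᶠ[𝓝 x] id := .of_forall φ.symm_apply_apply
    have h1 := mfderiv_comp x ((φ.symm.contMDiff (φ x)).mdifferentiableAt (by simp))
      ((φ.contMDiff _).mdifferentiableAt (by simp))
    have h2 : mfderiv I I φ.symm (φ x) (mfderiv I I φ x (X x)) = (X x : F) :=
      congrArg (fun L : F →L[ℝ] F ↦ L (X x)) (h1.symm.trans ((h0.mfderiv_eq (I := I)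
        (I' := I)).trans mfderiv_id))
    have h3 : (X x : F) = X (φ.symm (φ x)) := by rw [φ.symm_apply_apply]
    have h4 : mfderiv I I φ.symm (φ x) (mfderiv I I φ x (X x)) = X (φ.symm (φ x)) := h2.trans h3
    rw [← h4, ← he]
    simp
  obtain ⟨X, hX, hx⟩ := hf.exists_smoothVF_const w
  obtain ⟨Z, hZ, hz⟩ := hf.exists_smoothVF_const z
  obtain ⟨X', hX', hXX'⟩ := hφ X hX
  obtain ⟨Z', hZ', hZZ'⟩ := hφ Z hZ
  have key : ∀ (Y Y' : Π x : M, TangentSpace I x) (y : F),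
      (∀ x, mfderiv I I φ x (Y x) = Y' (φ x)) → (∀ᶠ v in 𝓝 u, pull f Y v = y) →
      ∀ᶠ v in 𝓝 u, pull (φ ∘ f) Y' v = y := by
    intro Y Y' y hYY' hy
    filter_upwards [hf.eventually, hy] with v hv hyv
    refine (hv.comp_diffeomorph φ).pull_eq ?_
    rw [hv.dpar_comp, ← hyv, hv.dpar_pull]
    exact hYY' _
  have hx' := key X X' w hXX' hx
  have hz' := key Z Z' z hZZ' hz
  have h1 := h X Z X' Z' hX hZ hX' hZ' (fun x _ ↦ hXX' x) (fun x _ ↦ hZZ' x) (f u) trivial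
  rw [← hf.dpar_pull X, hx.self_of_nhds, hΓ Z (hZ.mdifferentiableAt _), covPull_of_const _ hz,
    ← hf.dpar_comp] at h1
  have h2 := hΓ' Z' (hZ'.mdifferentiableAt _) w
  have h3 := hfφ.dpar_pull X'
  rw [hx'.self_of_nhds] at h3
  rw [h3, covPull_of_const _ hz'] at h2
  exact hfφ.dpar_injective (h1.trans h2)

/-- The group of diffeomorphisms that leave the expressions of `D` and `g` in parametrizations
unchanged. -/
def paramInvariants (D : Connection I M) (g : RiemMetric I M) : Subgroup (Equiv.Perm M) where
  carrier := {ψ | ContMDiff I I ∞ ψ ∧ ContMDiff I I ∞ ψ.symm ∧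
    ∀ (f : F → M) (u : F), IsParamAt I f u →
      (∀ Γ, Represents D (ψ ∘ f) u Γ ↔ Represents D f u Γ) ∧
      metricPull g (ψ ∘ f) u = metricPull g f u}
  one_mem' := ⟨contMDiff_id, contMDiff_id, fun _ _ _ ↦ ⟨fun _ ↦ Iff.rfl, rfl⟩⟩
  mul_mem' := by
    rintro a b ⟨ha, ha', hA⟩ ⟨hb, hb', hB⟩
    refine ⟨ha.comp hb, hb'.comp ha', fun f u hf ↦ ?_⟩
    have h1 := hA (b ∘ f) u (hf.comp_diffeomorph (permDiffeomorph b hb hb'))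
    have h2 := hB f u hf
    exact ⟨fun Γ ↦ (h1.1 Γ).trans (h2.1 Γ), h1.2.trans h2.2⟩
  inv_mem' := by
    rintro a ⟨ha, ha', hA⟩
    refine ⟨ha', ha, fun f u hf ↦ ?_⟩
    have h1 := hA (a.symm ∘ f) u (hf.comp_diffeomorph (permDiffeomorph a ha ha').symm)
    have h2 : a ∘ (a.symm ∘ f) = f := by
      funext v; simp
    rw [h2] at h1
    exact ⟨fun Γ ↦ (h1.1 Γ).symm, h1.2.symm⟩

/-- Membership in a subgroup extends the invariance to all powers of `φ`, hence to all deck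
transformations. The converse implication for Christoffel symbols rests on their uniqueness. -/
lemma IsStatisticalAut.mem_paramInvariants {D : Connection I M} {g : RiemMetric I M}
    {φ : Diffeomorph I I M M ∞} (h : IsStatisticalAut D g φ) :
    φ.toEquiv ∈ paramInvariants D g := by
  refine ⟨φ.contMDiff, φ.symm.contMDiff, fun f u hf ↦ ⟨fun Γ ↦ ⟨fun hΓ ↦ ?_, fun hΓ ↦
    h.connection.represents_comp hf hΓ⟩, h.metric.metricPull_comp hf⟩⟩
  obtain ⟨Γ', hΓ'⟩ := exists_represents hf D
  rw [hΓ.unique (h.connection.represents_comp hf hΓ') (hf.comp_diffeomorph φ)]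
  exact hΓ'

end Automorphism

/-! ### Charts as parametrizations -/

section Charts

variable {E : Type*} [NormedAddCommGroup E] [NormedSpace ℝ E]
  {M : Type*} [TopologicalSpace M] [ChartedSpace E M] [IsManifold 𝓘(ℝ, E) ∞ M]

lemma isParamAt_chartAt_symm (m : M) {u : E} (hu : u ∈ (chartAt E m).target) :
    IsParamAt 𝓘(ℝ, E) (chartAt E m).symm u := by
  refine ⟨⟨(chartAt E m).symm.toPartialEquiv, (chartAt E m).open_target,
    (chartAt E m).open_source, contMDiffOn_chart_symm, contMDiffOn_chart⟩, hu, fun _ _ ↦ rfl⟩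

/-- The expression of `ψ` in charts. -/
def chartExpr (ψ : M → M) (m m' : M) (u : E) : E := chartAt E m' (ψ ((chartAt E m).symm u))

lemma isTransition_chartExpr {ψ : M → M} (hψ : ContMDiff 𝓘(ℝ, E) 𝓘(ℝ, E) ∞ ψ) {m m' : M}
    {u u' : E} (hu : u ∈ (chartAt E m).target) (hu' : u' ∈ (chartAt E m').target)
    (h : ψ ((chartAt E m).symm u) = (chartAt E m').symm u') :
    IsTransition (ψ ∘ (chartAt E m).symm) (chartAt E m').symm u u' (chartExpr ψ m m') := by
  have hsrc : ψ ((chartAt E m).symm u) ∈ (chartAt E m').source := by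
    rw [h]; exact (chartAt E m').map_target hu'
  have h1 := (isParamAt_chartAt_symm m hu).contMDiffAt
  refine ⟨?_, ?_, ?_⟩
  · rw [← contMDiffAt_iff_contDiffAt]
    have h2 : ContMDiffAt 𝓘(ℝ, E) 𝓘(ℝ, E) ∞ (chartAt E m') (ψ ((chartAt E m).symm u)) :=
      contMDiffOn_chart.contMDiffAt ((chartAt E m').open_source.mem_nhds hsrc)
    exact h2.comp u ((hψ _).comp u h1)
  · rw [chartExpr, h, (chartAt E m').right_inv hu']
  · have h3 : ContinuousAt (ψ ∘ (chartAt E m).symm) u :=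
      (hψ.continuous.continuousAt).comp h1.continuousAt
    filter_upwards [h3.eventually ((chartAt E m').open_source.mem_nhds hsrc)] with v hv
    exact (chartAt E m').left_inv hv

end Charts

/-! ### The smooth structure on the base of a local homeomorphism with smooth deck maps -/

section QuotientManifold

variable {F : Type*} [NormedAddCommGroup F] [NormedSpace ℝ F]
  {H : Type*} [TopologicalSpace H] {I : ModelWithCorners ℝ F H}
  {P : Type*} [TopologicalSpace P] [ChartedSpace H P]
  {C : Type*} [TopologicalSpace C]

/-- Any two points in a fibre of `pr` are related by a smooth map that commutes with `pr`. -/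
def HasSmoothDecks (I : ModelWithCorners ℝ F H) (pr : P → C) : Prop :=
  ∀ p p', pr p = pr p' → ∃ δ : P → P, ContMDiff I I ∞ δ ∧ δ p = p' ∧ pr ∘ δ = pr

/-- Near `y` both maps take values in the target of the local inverse, where `pr` is injective, and
both are lifts of `pr`. -/
lemma localInverseAt_comp_eventuallyEq {pr : P → C} (hp : IsLocalHomeomorph pr) (p y : P)
    (hy : pr y ∈ (hp.localInverseAt p).source) {δ : P → P} (hδ : ContinuousAt δ y)
    (h : δ y = hp.localInverseAt p (pr y)) (hc : pr ∘ δ = pr) :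
    (fun z ↦ hp.localInverseAt p (pr z)) =ᶠ[𝓝 y] δ := by
  have h1 : δ y ∈ (hp.localInverseAt p).target := by
    rw [h]; exact (hp.localInverseAt p).map_source hy
  filter_upwards [hδ ((hp.localInverseAt p).open_target.mem_nhds h1),
    hp.continuous.continuousAt ((hp.localInverseAt p).open_source.mem_nhds hy)] with z hz hz'
  refine hp.injOn_localInverseAt_target ((hp.localInverseAt p).map_source hz') hz ?_
  rw [hp.apply_localInverseAt_of_mem hz']
  exact (congrFun hc z).symm

lemma HasSmoothDecks.contMDiffAt_localInverseAt_comp {pr : P → C} (hd : HasSmoothDecks I pr)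
    (hp : IsLocalHomeomorph pr) (p y : P) (hy : pr y ∈ (hp.localInverseAt p).source) :
    ContMDiffAt I I ∞ (fun z ↦ hp.localInverseAt p (pr z)) y := by
  obtain ⟨δ, hδ, h, hc⟩ := hd y (hp.localInverseAt p (pr y))
    (hp.apply_localInverseAt_of_mem hy).symm
  exact (hδ y).congr_of_eventuallyEq
    (localInverseAt_comp_eventuallyEq hp p y hy hδ.continuous.continuousAt h hc)

/-- A coordinate change of `C` is a chart expression of `z ↦ localInverseAt p' (pr z)`, which
locally is a smooth deck map. -/
theorem HasSmoothDecks.isManifold [IsManifold I ∞ P] {pr : P → C} (hd : HasSmoothDecks I pr)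
    (hp : IsLocalHomeomorph pr) (hs : Function.Surjective pr) :
    @IsManifold ℝ _ F _ _ H _ I ∞ C _ (hp.chartedSpace hs) := by
  let _ : ChartedSpace H C := hp.chartedSpace hs
  apply isManifold_of_contDiffOn
  rintro _ _ ⟨q, rfl⟩ ⟨q', rfl⟩
  set p := hs.hasRightInverse.choose q
  set p' := hs.hasRightInverse.choose q'
  intro x hx
  obtain ⟨hx, x, rfl⟩ := hx
  simp only [mem_preimage, I.left_inv, OpenPartialHomeomorph.trans_source,
    OpenPartialHomeomorph.symm_source, OpenPartialHomeomorph.trans_target, mem_inter_iff,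
    OpenPartialHomeomorph.coe_trans_symm, Function.comp_apply, hp.localInverseAt_symm] at hx
  obtain ⟨⟨hx1, hx2⟩, hx3, hx4⟩ := hx
  have hsm := hd.contMDiffAt_localInverseAt_comp hp p' _ hx3
  rw [contMDiffAt_iff_of_mem_source (x := p) (y := p') ((chartAt H p).map_target hx1) hx4] at hsm
  have e : extChartAt I p ((chartAt H p).symm x) = I x := by
    simp [(chartAt H p).right_inv hx1]
  rw [e] at hsm
  refine (hsm.2.congr (fun z hz ↦ ?_) ?_).mono inter_subset_right <;>
  simp [hp.localInverseAt_symm]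

/-- In the charts of `C`, which are local inverses followed by charts of `P`, both `pr` and its
local inverses read as `z ↦ localInverseAt p (pr z)`, already known to be smooth. -/
theorem HasSmoothDecks.isLocalDiffeomorph [IsManifold I ∞ P] {pr : P → C}
    (hd : HasSmoothDecks I pr) (hp : IsLocalHomeomorph pr) (hs : Function.Surjective pr) :
    letI : ChartedSpace H C := hp.chartedSpace hs
    IsLocalDiffeomorph I I ∞ pr := by
  let _ : ChartedSpace H C := hp.chartedSpace hs
  have hr : ∀ z, pr (hs.hasRightInverse.choose z) = z := hs.hasRightInverse.choose_spec
  have hsrc : ∀ z, z ∈ (hp.localInverseAt (hs.hasRightInverse.choose z)).source := fun z ↦ by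
    have := hp.apply_self_mem_localInverseAt_source (x := hs.hasRightInverse.choose z)
    rwa [hr] at this
  have hps : ContMDiff I I ∞ pr := by
    intro y
    rw [contMDiffAt_iff_target]
    refine ⟨hp.continuous.continuousAt, ?_⟩
    have h1 := hd.contMDiffAt_localInverseAt_comp hp (hs.hasRightInverse.choose (pr y)) y (hsrc _)
    have h2 : hp.localInverseAt (hs.hasRightInverse.choose (pr y)) (pr y)
        = hs.hasRightInverse.choose (pr y) := by
      have := hp.localInverseAt_apply_self (x := hs.hasRightInverse.choose (pr y))
      rwa [hr] at this
    have h3 : ContMDiffAt I 𝓘(ℝ, F) ∞ (extChartAt I (hs.hasRightInverse.choose (pr y)))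
        (hp.localInverseAt (hs.hasRightInverse.choose (pr y)) (pr y)) := by
      rw [h2]; exact contMDiffAt_extChartAt
    exact ContMDiffAt.comp (g := extChartAt I (hs.hasRightInverse.choose (pr y)))
      (f := fun z ↦ hp.localInverseAt (hs.hasRightInverse.choose (pr y)) (pr z)) y h3 h1
  intro p
  have hL : ContMDiffOn I I ∞ (hp.localInverseAt p) (hp.localInverseAt p).source := by
    intro z hz
    apply ContMDiffAt.contMDiffWithinAt
    rw [← contMDiffWithinAt_univ, contMDiffWithinAt_iff_source]
    set y := hs.hasRightInverse.choose z with hy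
    have h1 := hd.contMDiffAt_localInverseAt_comp hp p y (by rw [hr]; exact hz)
    rw [← contMDiffWithinAt_univ, contMDiffWithinAt_iff_source] at h1
    have h2 : hp.localInverseAt y z = y := by
      have := hp.localInverseAt_apply_self (x := y)
      rwa [hr] at this
    -- The chart of `C` at `z` is the chart of `P` at the chosen preimage `y` after the local
    -- inverse, so smoothness at `z` is tested in the coordinates of `y`.
    have e : extChartAt I z z = extChartAt I y y := by
      change I (chartAt H y (hp.localInverseAt y z)) = _
      rw [h2]; rfl
    have e' : ∀ w, (extChartAt I z).symm w = pr ((extChartAt I y).symm w) := by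
      intro w
      change (hp.localInverseAt y).symm _ = _
      rw [hp.localInverseAt_symm]; rfl
    rw [e]
    refine (h1.congr (fun w _ ↦ ?_) ?_).mono ?_
    · exact congrArg (hp.localInverseAt p) (e' w)
    · exact congrArg (hp.localInverseAt p) (e' _)
    · simp
  refine ⟨⟨(hp.localInverseAt p).symm.toPartialEquiv, ?_, ?_, ?_, ?_⟩, ?_, ?_⟩
  · exact (hp.localInverseAt p).open_target
  · exact (hp.localInverseAt p).open_source
  · exact hps.contMDiffOn.congr fun x _ ↦ by simp [hp.localInverseAt_symm]
  · exact hL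
  · exact hp.self_mem_localInverseAt_target
  · intro x _
    change pr x = (hp.localInverseAt p).symm x
    rw [hp.localInverseAt_symm]

end QuotientManifold

/-! ### Topology of the cone quotient -/

section ConeTopology

variable {M : Type*} {φ : Equiv.Perm M} {q : ℝ} {hq : 0 < q}

lemma coneMap_apply (p : M × PosReal) :
    coneMap φ q hq p = (φ p.1, ⟨q * p.2, mul_pos hq p.2.2⟩) := rfl

lemma coneMap_symm_apply (p : M × PosReal) :
    (coneMap φ q hq)⁻¹ p = (φ⁻¹ p.1, ⟨q⁻¹ * p.2, mul_pos (inv_pos.2 hq) p.2.2⟩) := rfl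

lemma coneMap_zpow_apply (k : ℤ) (p : M × PosReal) :
    (coneMap φ q hq ^ k) p = ((φ ^ k) p.1, ⟨q ^ k * p.2, mul_pos (zpow_pos hq k) p.2.2⟩) := by
  induction k with
  | zero => simp
  | succ n ih =>
    rw [add_comm, zpow_add, zpow_one, Equiv.Perm.mul_apply, ih, coneMap_apply]
    refine Prod.ext ?_ (Subtype.ext ?_)
    · simp only
      rw [zpow_add, zpow_one]; rfl
    · simp only
      rw [zpow_add₀ hq.ne', zpow_one, mul_assoc]
  | pred n ih =>
    rw [sub_eq_neg_add, zpow_add, zpow_neg_one, Equiv.Perm.mul_apply, ih, coneMap_symm_apply]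
    refine Prod.ext ?_ (Subtype.ext ?_)
    · simp only
      rw [zpow_add, zpow_neg_one]; rfl
    · simp only
      rw [zpow_add₀ hq.ne', zpow_neg_one, mul_assoc]

lemma coneProj_eq_iff {p p' : M × PosReal} :
    coneProj φ q hq p = coneProj φ q hq p' ↔ ∃ k : ℤ, (coneMap φ q hq ^ k) p = p' := by
  unfold coneProj
  rw [Quotient.eq]
  rfl

lemma coneProj_zpow (k : ℤ) (p : M × PosReal) :
    coneProj φ q hq ((coneMap φ q hq ^ k) p) = coneProj φ q hq p :=
  (coneProj_eq_iff.2 ⟨k, rfl⟩).symm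

lemma coneProj_surjective : Function.Surjective (coneProj φ q hq) := Quotient.mk_surjective

lemma log_coneMap_zpow (k : ℤ) (p : M × PosReal) :
    Real.log ((coneMap φ q hq ^ k) p).2 = k * Real.log q + Real.log p.2 := by
  rw [coneMap_zpow_apply]
  have : (0 : ℝ) < p.2 := p.2.2
  simp only
  rw [Real.log_mul (zpow_pos hq k).ne' this.ne', Real.log_zpow]

variable [TopologicalSpace M]

lemma continuous_log_posReal : Continuous (fun p : M × PosReal ↦ Real.log p.2) := by
  refine Continuous.log (continuous_subtype_val.comp continuous_snd) fun p ↦ ?_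
  exact (show (0 : ℝ) < p.2 from p.2.2).ne'

lemma continuous_coneMap_zpow (hφ : ∀ k : ℤ, Continuous (φ ^ k : Equiv.Perm M)) (k : ℤ) :
    Continuous (coneMap φ q hq ^ k : Equiv.Perm (M × PosReal)) := by
  have : ⇑(coneMap φ q hq ^ k : Equiv.Perm (M × PosReal)) = fun p ↦
      ((φ ^ k) p.1, ⟨q ^ k * p.2, mul_pos (zpow_pos hq k) p.2.2⟩) :=
    funext fun p ↦ coneMap_zpow_apply k p
  rw [this]
  refine ((hφ k).comp continuous_fst).prodMk (Continuous.subtype_mk ?_ _)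
  exact continuous_const.mul (continuous_subtype_val.comp continuous_snd)

lemma continuous_coneProj : Continuous (coneProj φ q hq) := continuous_quotient_mk'

/-- The saturation of an open set is the union of its preimages under the powers of `φ_q`. -/
lemma isOpenMap_coneProj (hφ : ∀ k : ℤ, Continuous (φ ^ k : Equiv.Perm M)) :
    IsOpenMap (coneProj φ q hq) := by
  intro U hU
  have hqm : Topology.IsQuotientMap (coneProj φ q hq) := isQuotientMap_quot_mk
  refine hqm.isOpen_preimage.1 ?_
  have : coneProj φ q hq ⁻¹' (coneProj φ q hq '' U)
      = ⋃ k : ℤ, (coneMap φ q hq ^ k : Equiv.Perm (M × PosReal)) ⁻¹' U := by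
    ext p
    simp only [mem_preimage, mem_image, mem_iUnion]
    constructor
    · rintro ⟨p', hp', h⟩
      obtain ⟨k, hk⟩ := coneProj_eq_iff.1 h.symm
      exact ⟨k, hk ▸ hp'⟩
    · rintro ⟨k, hk⟩
      exact ⟨_, hk, coneProj_zpow k p⟩
  rw [this]
  exact isOpen_iUnion fun k ↦ hU.preimage (continuous_coneMap_zpow hφ k)

lemma isOpenQuotientMap_coneProj (hφ : ∀ k : ℤ, Continuous (φ ^ k : Equiv.Perm M)) :
    IsOpenQuotientMap (coneProj φ q hq) :=
  ⟨coneProj_surjective, continuous_coneProj, isOpenMap_coneProj hφ⟩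

lemma secondCountableTopology_coneQuotient [SecondCountableTopology M]
    (hφ : ∀ k : ℤ, Continuous (φ ^ k : Equiv.Perm M)) :
    SecondCountableTopology (ConeQuotient φ q hq) :=
  have : SecondCountableTopology PosReal := TopologicalSpace.Subtype.secondCountableTopology _
  TopologicalSpace.Quotient.secondCountableTopology (isOpenMap_coneProj hφ)

/-- Points in a slab of logarithmic width `|log q|` are inequivalent. -/
lemma injOn_coneProj (hq1 : q ≠ 1) (a : ℝ) :
    InjOn (coneProj φ q hq)
      {p : M × PosReal | |Real.log p.2 - a| < |Real.log q| / 2} := by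
  intro p hp p' hp' h
  obtain ⟨k, rfl⟩ := coneProj_eq_iff.1 h
  simp only [mem_ofPred_eq] at hp hp'
  rw [log_coneMap_zpow] at hp'
  have h0 : 0 < |Real.log q| := abs_pos.2 (Real.log_ne_zero_of_pos_of_ne_one hq hq1)
  -- `φ_q^k` shifts `log s` by `k log q`, which is less than the width of the slab only for `k = 0`.
  have h1 : |(k : ℝ)| * |Real.log q| < 1 * |Real.log q| := by
    rw [← abs_mul]
    calc |k * Real.log q| = |(k * Real.log q + Real.log p.2 - a) - (Real.log p.2 - a)| := by
          congr 1; ring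
      _ ≤ _ := abs_sub _ _
      _ < _ := by linarith
  have h2 := lt_of_mul_lt_mul_right h1 h0.le
  have h3 : |k| < 1 := by exact_mod_cast h2
  rw [Int.abs_lt_one_iff.1 h3]
  rfl

lemma isLocalHomeomorph_coneProj (hq1 : q ≠ 1)
    (hφ : ∀ k : ℤ, Continuous (φ ^ k : Equiv.Perm M)) :
    IsLocalHomeomorph (coneProj φ q hq) := by
  rw [isLocalHomeomorph_iff_isOpenEmbedding_restrict]
  intro p
  set U := {p' : M × PosReal | |Real.log p'.2 - Real.log p.2| < |Real.log q| / 2}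
  have hU : IsOpen U :=
    isOpen_lt (continuous_log_posReal.sub continuous_const).abs continuous_const
  have h0 : 0 < |Real.log q| := abs_pos.2 (Real.log_ne_zero_of_pos_of_ne_one hq hq1)
  refine ⟨U, hU.mem_nhds (by simpa [U] using h0), ?_⟩
  exact .of_continuous_injective_isOpenMap (continuous_coneProj.comp continuous_subtype_val)
    (injOn_iff_injective.1 (injOn_coneProj hq1 _))
    ((isOpenMap_coneProj hφ).comp hU.isOpenMap_subtype_val)

/-- An open quotient is Hausdorff iff the equivalence relation is closed. Here it is the union of
the closed graphs of the powers of `φ_q`, and this family is locally finite. -/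
lemma t2Space_coneQuotient [T2Space M] (hq1 : q ≠ 1)
    (hφ : ∀ k : ℤ, Continuous (φ ^ k : Equiv.Perm M)) : T2Space (ConeQuotient φ q hq) := by
  rw [t2Space_iff_of_isOpenQuotientMap (isOpenQuotientMap_coneProj hφ)]
  have hl : Real.log q ≠ 0 := Real.log_ne_zero_of_pos_of_ne_one hq hq1
  have : {r : (M × PosReal) × (M × PosReal) | coneProj φ q hq r.1 = coneProj φ q hq r.2}
      = ⋃ k : ℤ, {r | (coneMap φ q hq ^ k) r.1 = r.2} := by
    ext r
    simp [coneProj_eq_iff]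
  rw [this]
  refine LocallyFinite.isClosed_iUnion ?_ fun k ↦
    isClosed_eq ((continuous_coneMap_zpow hφ k).comp continuous_fst) continuous_snd
  intro r
  -- This continuous function is equal to `k` on the graph of `φ_q^k`, so the preimage of a bounded
  -- interval meets only finitely many graphs.
  set h : (M × PosReal) × (M × PosReal) → ℝ :=
    fun r ↦ (Real.log r.2.2 - Real.log r.1.2) / Real.log q with hh
  have hc : Continuous h := ((continuous_log_posReal.comp continuous_snd).sub
    (continuous_log_posReal.comp continuous_fst)).div_const _
  refine ⟨h ⁻¹' Metric.ball (h r) 1, hc.continuousAt (Metric.ball_mem_nhds _ one_pos), ?_⟩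
  refine (finite_Icc ⌊h r - 1⌋ ⌈h r + 1⌉).subset ?_
  rintro k ⟨r', hr', hb⟩
  have : h r' = k := by
    simp only [hh]
    rw [← show _ = r'.2 from hr', log_coneMap_zpow]
    field_simp
    ring
  rw [mem_preimage, this, Metric.mem_ball, Real.dist_eq, abs_lt] at hb
  constructor
  · exact_mod_cast (Int.floor_le _).trans (by linarith : h r - 1 ≤ k)
  · exact_mod_cast (by linarith : (k : ℝ) ≤ h r + 1).trans (Int.le_ceil _)

end ConeTopology

/-! ### Smooth structure of the cone quotient -/

section ConeSmooth

variable {E : Type*} [NormedAddCommGroup E] [NormedSpace ℝ E]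
  {M : Type*} [TopologicalSpace M] [ChartedSpace E M]
  {φ : Equiv.Perm M} {q : ℝ} {hq : 0 < q}

lemma contMDiff_coneMap_zpow (hφ : ∀ k : ℤ, ContMDiff 𝓘(ℝ, E) 𝓘(ℝ, E) ∞ (φ ^ k : Equiv.Perm M))
    (k : ℤ) : ContMDiff (coneModel E) (coneModel E) ∞
      (coneMap φ q hq ^ k : Equiv.Perm (M × PosReal)) := by
  have : ⇑(coneMap φ q hq ^ k : Equiv.Perm (M × PosReal)) = fun p ↦
      ((φ ^ k) p.1, ⟨q ^ k * p.2, mul_pos (zpow_pos hq k) p.2.2⟩) :=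
    funext fun p ↦ coneMap_zpow_apply k p
  rw [this]
  refine ((hφ k).comp contMDiff_fst).prodMk fun p ↦ ?_
  rw [← ContMDiffAt.subtypeVal_comp_iff]
  have h1 : ContMDiff (coneModel E) 𝓘(ℝ, ℝ) ∞ (fun p : M × PosReal ↦ (p.2 : ℝ)) :=
    contMDiff_subtype_val.comp contMDiff_snd
  have h2 : ContDiff ℝ ∞ (fun s : ℝ ↦ q ^ k * s) := contDiff_const.mul contDiff_id
  exact (h2.contMDiff.comp h1) p

lemma hasSmoothDecks_coneProj
    (hφ : ∀ k : ℤ, ContMDiff 𝓘(ℝ, E) 𝓘(ℝ, E) ∞ (φ ^ k : Equiv.Perm M)) :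
    HasSmoothDecks (coneModel E) (coneProj φ q hq) := by
  intro p p' h
  obtain ⟨k, hk⟩ := coneProj_eq_iff.1 h
  exact ⟨_, contMDiff_coneMap_zpow hφ k, hk, funext fun p ↦ coneProj_zpow k p⟩

/-- The smooth structure of the cone quotient: the projection is a local diffeomorphism. -/
theorem exists_manifold_coneQuotient [IsManifold 𝓘(ℝ, E) ∞ M] (hq1 : q ≠ 1)
    (hφ : ∀ k : ℤ, ContMDiff 𝓘(ℝ, E) 𝓘(ℝ, E) ∞ (φ ^ k : Equiv.Perm M)) :
    ∃ (_ : ChartedSpace (ModelProd E ℝ) (ConeQuotient φ q hq)),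
      IsManifold (coneModel E) ∞ (ConeQuotient φ q hq) ∧
      IsLocalDiffeomorph (coneModel E) (coneModel E) ∞ (coneProj φ q hq) := by
  have hd : HasSmoothDecks (coneModel E) (coneProj φ q hq) := hasSmoothDecks_coneProj hφ
  have hl : IsLocalHomeomorph (coneProj φ q hq) :=
    isLocalHomeomorph_coneProj hq1 fun k ↦ (hφ k).continuous
  exact ⟨hl.chartedSpace coneProj_surjective, hd.isManifold hl coneProj_surjective,
    hd.isLocalDiffeomorph hl coneProj_surjective⟩

end ConeSmooth

/-! ### Christoffel symbols and metric of the cone -/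

section ConeTensors

variable {E : Type*} [NormedAddCommGroup E] [NormedSpace ℝ E]

/-- The bilinear map on `E × ℝ` whose components are `b₁` and `b₂`. -/
def bilinProd {F G G' : Type*} [NormedAddCommGroup F] [NormedSpace ℝ F]
    [NormedAddCommGroup G] [NormedSpace ℝ G] [NormedAddCommGroup G'] [NormedSpace ℝ G']
    (b₁ : F →L[ℝ] F →L[ℝ] G) (b₂ : F →L[ℝ] F →L[ℝ] G') : F →L[ℝ] F →L[ℝ] G × G' :=
  (ContinuousLinearMap.compL ℝ F G (G × G') (ContinuousLinearMap.inl ℝ G G')).comp b₁ +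
    (ContinuousLinearMap.compL ℝ F G' (G × G') (ContinuousLinearMap.inr ℝ G G')).comp b₂

/-- In logarithmic coordinates, the Christoffel symbols of the radiant connection on the cone over
a statistical manifold with Christoffel symbols `A` and metric `G`. -/
def coneChristoffel (l : ℝ) (A : E →L[ℝ] E →L[ℝ] E) (G : E →L[ℝ] E →L[ℝ] ℝ) :
    E × ℝ →L[ℝ] E × ℝ →L[ℝ] E × ℝ :=
  let fst := ContinuousLinearMap.fst ℝ E ℝ
  let snd := ContinuousLinearMap.snd ℝ E ℝ
  let s := (ContinuousLinearMap.lsmul ℝ ℝ : ℝ →L[ℝ] E →L[ℝ] E)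
  bilinProd (A.bilinearComp fst fst + l • (s.bilinearComp snd fst + s.flip.bilinearComp fst snd))
    (l • (ContinuousLinearMap.mul ℝ ℝ).bilinearComp snd snd + (l - 2) • G.bilinearComp fst fst)

lemma coneChristoffel_apply (l : ℝ) (A : E →L[ℝ] E →L[ℝ] E) (G : E →L[ℝ] E →L[ℝ] ℝ)
    (w z : E × ℝ) : coneChristoffel l A G w z =
      (A w.1 z.1 + l • (w.2 • z.1 + z.2 • w.1), l * (w.2 * z.2) + (l - 2) * G w.1 z.1) := by
  simp [coneChristoffel, bilinProd]

/-- In logarithmic coordinates, the cylinder metric over the metric `G`. -/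
def coneMetric (G : E →L[ℝ] E →L[ℝ] ℝ) : E × ℝ →L[ℝ] E × ℝ →L[ℝ] ℝ :=
  G.bilinearComp (ContinuousLinearMap.fst ℝ E ℝ) (ContinuousLinearMap.fst ℝ E ℝ) +
    (ContinuousLinearMap.mul ℝ ℝ).bilinearComp (ContinuousLinearMap.snd ℝ E ℝ)
      (ContinuousLinearMap.snd ℝ E ℝ)

lemma coneMetric_apply (G : E →L[ℝ] E →L[ℝ] ℝ) (w z : E × ℝ) :
    coneMetric G w z = G w.1 z.1 + w.2 * z.2 := rfl

/-- In logarithmic coordinates, the Lee form of the cone. -/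
def coneLeeForm (E : Type*) [NormedAddCommGroup E] [NormedSpace ℝ E] : E × ℝ →L[ℝ] ℝ :=
  (-2 : ℝ) • ContinuousLinearMap.snd ℝ E ℝ

lemma coneLeeForm_apply (w : E × ℝ) : coneLeeForm E w = -2 * w.2 := rfl

lemma contDiffAt_bilin_of_apply {F G : Type*} [NormedAddCommGroup F] [NormedSpace ℝ F]
    [FiniteDimensional ℝ F] [NormedAddCommGroup G] [NormedSpace ℝ G]
    {Γ : F → F →L[ℝ] F →L[ℝ] G} {u : F}
    (h : ∀ w z, ContDiffAt ℝ ∞ (fun v ↦ Γ v w z) u) : ContDiffAt ℝ ∞ Γ u := by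
  have key : ContMDiffAt 𝓘(ℝ, F) 𝓘(ℝ, F →L[ℝ] F →L[ℝ] G) ∞ Γ u := by
    refine contMDiffAt_clm_of_apply (I := 𝓘(ℝ, F)) (M := F) (G := F →L[ℝ] G) (Module.finBasis ℝ F) fun i ↦
      contMDiffAt_clm_of_apply (I := 𝓘(ℝ, F)) (M := F) (G := G) (Module.finBasis ℝ F) fun j ↦ ?_
    exact (h _ _).contMDiffAt
  exact key.contDiffAt

lemma fderiv_bilin_apply {F V G : Type*} [NormedAddCommGroup F] [NormedSpace ℝ F]
    [NormedAddCommGroup V] [NormedSpace ℝ V]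
    [NormedAddCommGroup G] [NormedSpace ℝ G] {Γ : V → F →L[ℝ] F →L[ℝ] G} {u : V}
    (h : DifferentiableAt ℝ Γ u) (x : V) (w z : F) :
    fderiv ℝ Γ u x w z = fderiv ℝ (fun v ↦ Γ v w z) u x := by
  have h1 := (h.hasFDerivAt.clm_apply (hasFDerivAt_const w u)).clm_apply (hasFDerivAt_const z u)
  rw [h1.fderiv]
  simp

lemma hasFDerivAt_bilin_fst {V : Type*} [NormedAddCommGroup V] [NormedSpace ℝ V]
    {A : E → E →L[ℝ] E →L[ℝ] V} {u : E × ℝ} (hA : DifferentiableAt ℝ A u.1) (w z : E) :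
    HasFDerivAt (fun v : E × ℝ ↦ A v.1 w z)
      ((((fderiv ℝ A u.1).flip w).flip z).comp (ContinuousLinearMap.fst ℝ E ℝ)) u := by
  have h0 := (hA.hasFDerivAt.clm_apply (hasFDerivAt_const w u.1)).clm_apply
    (hasFDerivAt_const z u.1)
  have h1 : HasFDerivAt (fun v ↦ A v w z) (((fderiv ℝ A u.1).flip w).flip z) u.1 :=
    h0.congr_fderiv (by ext; simp)
  exact HasFDerivAt.comp u h1 hasFDerivAt_fst

variable [FiniteDimensional ℝ E] {l : ℝ} {A : E → E →L[ℝ] E →L[ℝ] E} {G : E → E →L[ℝ] E →L[ℝ] ℝ}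
  {u : E × ℝ}

lemma contDiffAt_coneChristoffel (hA : ContDiffAt ℝ ∞ A u.1) (hG : ContDiffAt ℝ ∞ G u.1) (l : ℝ) :
    ContDiffAt ℝ ∞ (fun v : E × ℝ ↦ coneChristoffel l (A v.1) (G v.1)) u := by
  refine contDiffAt_bilin_of_apply fun w z ↦ ?_
  simp only [coneChristoffel_apply]
  have hA' : ContDiffAt ℝ ∞ (fun v : E × ℝ ↦ A v.1 w.1 z.1) u :=
    ((hA.comp u contDiffAt_fst).clm_apply contDiffAt_const).clm_apply contDiffAt_const
  have hG' : ContDiffAt ℝ ∞ (fun v : E × ℝ ↦ G v.1 w.1 z.1) u :=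
    ((hG.comp u contDiffAt_fst).clm_apply contDiffAt_const).clm_apply contDiffAt_const
  exact (hA'.add contDiffAt_const).prodMk (contDiffAt_const.add (contDiffAt_const.mul hG'))

lemma contDiffAt_coneMetric (hG : ContDiffAt ℝ ∞ G u.1) :
    ContDiffAt ℝ ∞ (fun v : E × ℝ ↦ coneMetric (G v.1)) u := by
  refine contDiffAt_bilin_of_apply fun w z ↦ ?_
  simp only [coneMetric_apply]
  have hG' : ContDiffAt ℝ ∞ (fun v : E × ℝ ↦ G v.1 w.1 z.1) u :=
    ((hG.comp u contDiffAt_fst).clm_apply contDiffAt_const).clm_apply contDiffAt_const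
  exact hG'.add contDiffAt_const

lemma fderiv_coneChristoffel (hA : ContDiffAt ℝ ∞ A u.1) (hG : ContDiffAt ℝ ∞ G u.1)
    (x w z : E × ℝ) :
    fderiv ℝ (fun v : E × ℝ ↦ coneChristoffel l (A v.1) (G v.1)) u x w z =
      (fderiv ℝ A u.1 x.1 w.1 z.1, (l - 2) * fderiv ℝ G u.1 x.1 w.1 z.1) := by
  rw [fderiv_bilin_apply ((contDiffAt_coneChristoffel hA hG l).differentiableAt (by simp))]
  simp only [coneChristoffel_apply]
  have h1 := hasFDerivAt_bilin_fst (hA.differentiableAt (by simp)) w.1 z.1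
  have h2 := hasFDerivAt_bilin_fst (hG.differentiableAt (by simp)) w.1 z.1
  rw [((h1.add_const _).prodMk ((h2.const_mul (l - 2)).const_add _)).fderiv]
  rfl

lemma fderiv_coneMetric (hG : ContDiffAt ℝ ∞ G u.1) (x w z : E × ℝ) :
    fderiv ℝ (fun v : E × ℝ ↦ coneMetric (G v.1)) u x w z = fderiv ℝ G u.1 x.1 w.1 z.1 := by
  rw [fderiv_bilin_apply ((contDiffAt_coneMetric hG).differentiableAt (by simp))]
  simp only [coneMetric_apply]
  have h2 := hasFDerivAt_bilin_fst (hG.differentiableAt (by simp)) w.1 z.1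
  rw [(h2.add_const _).fderiv]
  rfl

/-- The Codazzi equation: the covariant derivative of `G` is totally symmetric. -/
def Codazzi (A : E → E →L[ℝ] E →L[ℝ] E) (G : E → E →L[ℝ] E →L[ℝ] ℝ) (u : E) : Prop :=
  ∀ x y z, fderiv ℝ G u x y z - G u (A u x y) z - G u y (A u x z) =
    fderiv ℝ G u y x z - G u (A u y x) z - G u x (A u y z)

/-- The component in `E` is the curvature of `A` plus `l (l - 2)` times the constant curvature
tensor, and these cancel by `hl`. The component in `ℝ` is `l - 2` times the Codazzi equation. All
other terms cancel by symmetry. -/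
lemma christoffelCurvature_cone {c : ℝ} (hl : l * (2 - l) = c) (hA : ContDiffAt ℝ ∞ A u.1)
    (hG : ContDiffAt ℝ ∞ G u.1) (hsymm : ∀ x y, A u.1 x y = A u.1 y x)
    (hGsymm : ∀ x y, G u.1 x y = G u.1 y x)
    (hcod : Codazzi A G u.1)
    (hcurv : ∀ x y z, christoffelCurvature A u.1 x y z = c • (G u.1 y z • x - G u.1 x z • y))
    (x y z : E × ℝ) :
    christoffelCurvature (fun v : E × ℝ ↦ coneChristoffel l (A v.1) (G v.1)) u x y z = 0 := by
  have h1 := hcurv x.1 y.1 z.1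
  have h2 := hcod x.1 y.1 z.1
  unfold christoffelCurvature at h1 ⊢
  rw [fderiv_coneChristoffel hA hG, fderiv_coneChristoffel hA hG]
  simp only [coneChristoffel_apply]
  have h3 : fderiv ℝ A u.1 x.1 y.1 z.1 = fderiv ℝ A u.1 y.1 x.1 z.1
      - A u.1 x.1 (A u.1 y.1 z.1) + A u.1 y.1 (A u.1 x.1 z.1)
      + c • (G u.1 y.1 z.1 • x.1 - G u.1 x.1 z.1 • y.1) := by
    rw [← h1]; abel
  rw [h3, hsymm y.1 x.1]  at *
  refine Prod.ext ?_ ?_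
  · simp only [Prod.fst_add, Prod.fst_sub, Prod.fst_zero, map_add, map_smul, smul_add, add_smul,
      smul_sub, hsymm y.1 x.1, ← hl]
    module
  · simp only [Prod.snd_add, Prod.snd_sub, Prod.snd_zero, map_add, map_smul, smul_eq_mul,
      hGsymm y.1 x.1]
    rw [hGsymm (A u.1 x.1 y.1) z.1] at h2
    linear_combination (l - 2) * h2

/-- Before the Lee term, `x.2 * G y z` carries the coefficient `-l` and `y.2 * G x z` the
coefficient `-(l - 2)`. Subtracting `θ ⊗ g` adds `2` to the first and makes the expression symmetric
up to the Codazzi equation on `E`. -/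
lemma cone_codazzi (hsymm : ∀ x y, A u.1 x y = A u.1 y x)
    (hGsymm : ∀ x y, G u.1 x y = G u.1 y x) (hG : ContDiffAt ℝ ∞ G u.1)
    (hcod : Codazzi A G u.1) (x y z : E × ℝ) :
    fderiv ℝ (fun v : E × ℝ ↦ coneMetric (G v.1)) u x y z
      - coneMetric (G u.1) (coneChristoffel l (A u.1) (G u.1) x y) z
      - coneMetric (G u.1) y (coneChristoffel l (A u.1) (G u.1) x z)
      - coneLeeForm E x * coneMetric (G u.1) y z =
    fderiv ℝ (fun v : E × ℝ ↦ coneMetric (G v.1)) u y x z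
      - coneMetric (G u.1) (coneChristoffel l (A u.1) (G u.1) y x) z
      - coneMetric (G u.1) x (coneChristoffel l (A u.1) (G u.1) y z)
      - coneLeeForm E y * coneMetric (G u.1) x z := by
  have h2 := hcod x.1 y.1 z.1
  rw [fderiv_coneMetric hG, fderiv_coneMetric hG]
  simp only [coneMetric_apply, coneChristoffel_apply, coneLeeForm_apply, map_add, map_smul,
    smul_eq_mul, add_apply, smul_apply]
  rw [hsymm y.1 x.1] at h2
  rw [hsymm y.1 x.1, hGsymm y.1 x.1]
  linear_combination h2

end ConeTensors

/-! ### Manifolds that are locally the cone over a statistical manifold -/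

section ConeStructure

variable {E : Type*} [NormedAddCommGroup E] [NormedSpace ℝ E]
  {H : Type*} [TopologicalSpace H] {I : ModelWithCorners ℝ (E × ℝ) H}
  {C : Type*} [TopologicalSpace C] [ChartedSpace H C] [IsManifold I ∞ C]

/-- `A` and `G` are the Christoffel symbols and the metric of a statistical structure of constant
curvature `c` near the point `u` of a vector space. -/
structure IsStatisticalExpr (c : ℝ) (A : E → E →L[ℝ] E →L[ℝ] E) (G : E → E →L[ℝ] E →L[ℝ] ℝ)
    (u : E) : Prop where
  contDiffAt_christoffel : ContDiffAt ℝ ∞ A u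
  contDiffAt_metric : ContDiffAt ℝ ∞ G u
  christoffel_comm : ∀ x y, A u x y = A u y x
  metric_comm : ∀ x y, G u x y = G u y x
  codazzi : Codazzi A G u
  curvature : ∀ x y z, christoffelCurvature A u x y z = c • (G u y z • x - G u x z • y)

/-- In the parametrization `f` on the open set `U`, the given tensors on `C` are those of the cone
over the statistical structure with Christoffel symbols `A` and metric `G`. -/
structure IsConeParam (N : Connection I C) (g : RiemMetric I C)
    (Θ : Π x : C, TangentSpace I x →L[ℝ] ℝ) (Ξ : Π x : C, TangentSpace I x) (l c : ℝ)
    (A : E → E →L[ℝ] E →L[ℝ] E) (G : E → E →L[ℝ] E →L[ℝ] ℝ) (f : E × ℝ → C) (U : Set E) :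
    Prop where
  isOpen : IsOpen U
  param : ∀ u : E × ℝ, u.1 ∈ U → IsParamAt I f u
  statistical : ∀ u ∈ U, IsStatisticalExpr c A G u
  connection : ∀ u : E × ℝ, u.1 ∈ U → Represents N f u (coneChristoffel l (A u.1) (G u.1))
  metric : ∀ u : E × ℝ, u.1 ∈ U → metricPull g f u = coneMetric (G u.1)
  form : ∀ u : E × ℝ, u.1 ∈ U → ∀ w, Θ (f u) (dpar I f u w) = coneLeeForm E w
  field : ∀ u : E × ℝ, u.1 ∈ U → dpar I f u ((0 : E), (-2 : ℝ)) = Ξ (f u)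

variable {N : Connection I C} {g : RiemMetric I C}
  {Θ : Π x : C, TangentSpace I x →L[ℝ] ℝ} {Ξ : Π x : C, TangentSpace I x} {l c : ℝ}
  {A : E → E →L[ℝ] E →L[ℝ] E} {G : E → E →L[ℝ] E →L[ℝ] ℝ} {f : E × ℝ → C} {U : Set E}
  {u : E × ℝ}

lemma IsConeParam.eventually (h : IsConeParam N g Θ Ξ l c A G f U) (hu : u.1 ∈ U) :
    ∀ᶠ v : E × ℝ in 𝓝 u, v.1 ∈ U :=
  (h.isOpen.preimage continuous_fst).mem_nhds hu

lemma IsConeParam.pull_field (h : IsConeParam N g Θ Ξ l c A G f U) (hu : u.1 ∈ U) :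
    pull f Ξ u = ((0 : E), (-2 : ℝ)) :=
  (h.param u hu).pull_eq (h.field u hu)

lemma IsConeParam.form_pull (h : IsConeParam N g Θ Ξ l c A G f U) (hu : u.1 ∈ U)
    (Y : Π x : C, TangentSpace I x) : Θ (f u) (Y (f u)) = coneLeeForm E (pull f Y u) := by
  rw [← h.form u hu, (h.param u hu).dpar_pull]

variable [FiniteDimensional ℝ E]

lemma IsConeParam.lee (h : IsConeParam N g Θ Ξ l c A G f U) (hu : u.1 ∈ U)
    (v : TangentSpace I (f u)) : g.inner (f u) (Ξ (f u)) v = Θ (f u) v := by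
  have hf := h.param u hu
  rw [← hf.dpar_dparInv v, ← h.field u hu, ← metricPull_apply, h.metric u hu, h.form u hu,
    coneMetric_apply, coneLeeForm_apply]
  simp

/-- This value decides when `μ = -2 l` can equal `-g(ξ, ξ)`. -/
lemma IsConeParam.inner_field (h : IsConeParam N g Θ Ξ l c A G f U) (hu : u.1 ∈ U) :
    g.inner (f u) (Ξ (f u)) (Ξ (f u)) = 4 := by
  rw [h.lee hu, h.form_pull hu, h.pull_field hu, coneLeeForm_apply]
  norm_num

lemma IsParamAt.mvfderiv_inner {F : Type*} [NormedAddCommGroup F] [NormedSpace ℝ F]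
    [FiniteDimensional ℝ F] {H : Type*} [TopologicalSpace H] {I : ModelWithCorners ℝ F H}
    {M : Type*} [TopologicalSpace M] [ChartedSpace H M] [IsManifold I ∞ M]
    {f : F → M} {u : F} (hf : IsParamAt I f u) (g : RiemMetric I M)
    (hg : DifferentiableAt ℝ (metricPull g f) u)
    {Y Z : Π x : M, TangentSpace I x} (hY : SmoothVF Y) (hZ : SmoothVF Z) (w : F) :
    mvfderiv I (fun y ↦ g.inner y (Y y) (Z y)) (f u) (dpar I f u w) =
      fderiv ℝ (metricPull g f) u w (pull f Y u) (pull f Z u) +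
      metricPull g f u (fderiv ℝ (pull f Y) u w) (pull f Z u) +
      metricPull g f u (pull f Y u) (fderiv ℝ (pull f Z) u w) := by
  have hdy := hf.differentiableAt_pull (hY.mdifferentiableAt _)
  have hdz := hf.differentiableAt_pull (hZ.mdifferentiableAt _)
  have hs : MDifferentiableAt I 𝓘(ℝ, ℝ) (fun y ↦ g.inner y (Y y) (Z y)) (f u) :=
    (contMDiffAt_inner g (hY _) (hZ _)).mdifferentiableAt (by simp)
  have h1 : (fun y ↦ g.inner y (Y y) (Z y)) ∘ f =ᶠ[𝓝 u]
      fun v ↦ metricPull g f v (pull f Y v) (pull f Z v) := by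
    filter_upwards [hf.eventually] with v hv
    exact (hv.metricPull_pull g Y Z).symm
  have hB := (hg.hasFDerivAt.clm_apply hdy.hasFDerivAt).clm_apply hdz.hasFDerivAt
  rw [hf.mvfderiv_dpar hs, h1.fderiv_eq, hB.fderiv]
  simp only [add_apply, ContinuousLinearMap.comp_apply, ContinuousLinearMap.flip_apply]
  ring

lemma IsConeParam.differentiableAt_metricPull (h : IsConeParam N g Θ Ξ l c A G f U)
    (hu : u.1 ∈ U) : DifferentiableAt ℝ (metricPull g f) u := by
  have h1 : metricPull g f =ᶠ[𝓝 u] fun v ↦ coneMetric (G v.1) := by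
    filter_upwards [h.eventually hu] with v hv using h.metric v hv
  exact ((contDiffAt_coneMetric (h.statistical _ hu).contDiffAt_metric).differentiableAt
    (by simp)).congr_of_eventuallyEq h1

lemma IsConeParam.fderiv_metricPull (h : IsConeParam N g Θ Ξ l c A G f U)
    (hu : u.1 ∈ U) : fderiv ℝ (metricPull g f) u = fderiv ℝ (fun v ↦ coneMetric (G v.1)) u := by
  apply Filter.EventuallyEq.fderiv_eq
  filter_upwards [h.eventually hu] with v hv using h.metric v hv

lemma IsConeParam.mvfderiv_form (h : IsConeParam N g Θ Ξ l c A G f U) (hu : u.1 ∈ U)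
    {Y : Π x : C, TangentSpace I x} (hY : SmoothVF Y) (w : E × ℝ) :
    mvfderiv I (fun y ↦ Θ y (Y y)) (f u) (dpar I f u w) =
      coneLeeForm E (fderiv ℝ (pull f Y) u w) := by
  have hf := h.param u hu
  have h1 : (fun y ↦ Θ y (Y y)) ∘ f =ᶠ[𝓝 u] fun v ↦ coneLeeForm E (pull f Y v) := by
    filter_upwards [h.eventually hu] with v hv using h.form_pull hv Y
  have h2 := hf.contDiffAt_pull (hY _)
  have h3 : ContDiffAt ℝ ∞ (fun v ↦ coneLeeForm E (pull f Y v)) u :=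
    (coneLeeForm E).contDiff.contDiffAt.comp u h2
  have hs : MDifferentiableAt I 𝓘(ℝ, ℝ) (fun y ↦ Θ y (Y y)) (f u) :=
    (hf.contMDiffAt_comp_iff.2 (h3.congr_of_eventuallyEq h1)).mdifferentiableAt (by simp)
  have h4 : HasFDerivAt (fun v ↦ coneLeeForm E (pull f Y v))
      ((coneLeeForm E).comp (fderiv ℝ (pull f Y) u)) u :=
    (coneLeeForm E).hasFDerivAt.comp u (h2.differentiableAt (by simp)).hasFDerivAt
  rw [hf.mvfderiv_dpar hs, h1.fderiv_eq, h4.fderiv]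
  rfl

lemma IsConeParam.closed (h : IsConeParam N g Θ Ξ l c A G f U) (hu : u.1 ∈ U)
    {X Y : Π x : C, TangentSpace I x} (hX : SmoothVF X) (hY : SmoothVF Y) :
    mvfderiv I (fun y ↦ Θ y (Y y)) (f u) (X (f u)) - mvfderiv I (fun y ↦ Θ y (X y)) (f u) (Y (f u))
      - Θ (f u) (VectorField.mlieBracket I X Y (f u)) = 0 := by
  have hf := h.param u hu
  rw [h.form_pull hu, hf.pull_mlieBracket (hX.mdifferentiableAt _) (hY.mdifferentiableAt _),
    ← hf.dpar_pull X, ← hf.dpar_pull Y, h.mvfderiv_form hu hX, h.mvfderiv_form hu hY, map_sub]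
  ring

/-- `Ξ` has constant coefficients, so its brackets are directional derivatives, and the metric
coefficients do not vary along `Ξ`. -/
lemma IsConeParam.killing (h : IsConeParam N g Θ Ξ l c A G f U) (hu : u.1 ∈ U) (hΞ : SmoothVF Ξ)
    {Y Z : Π x : C, TangentSpace I x} (hY : SmoothVF Y) (hZ : SmoothVF Z) :
    mvfderiv I (fun y ↦ g.inner y (Y y) (Z y)) (f u) (Ξ (f u))
      - g.inner (f u) (VectorField.mlieBracket I Ξ Y (f u)) (Z (f u))
      - g.inner (f u) (Y (f u)) (VectorField.mlieBracket I Ξ Z (f u)) = 0 := by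
  have hf := h.param u hu
  have hc : fderiv ℝ (pull f Ξ) u = 0 := by
    have : pull f Ξ =ᶠ[𝓝 u] fun _ ↦ ((0 : E), (-2 : ℝ)) := by
      filter_upwards [h.eventually hu] with v hv using h.pull_field hv
    rw [this.fderiv_eq]
    simp
  have h0 := fderiv_coneMetric (h.statistical _ hu).contDiffAt_metric ((0 : E), (-2 : ℝ))
    (pull f Y u) (pull f Z u)
  rw [show ((0 : E), (-2 : ℝ)).1 = 0 from rfl, (fderiv ℝ G u.1).map_zero, zero_apply,
    zero_apply] at h0
  rw [← hf.metricPull_pull, ← hf.metricPull_pull,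
    hf.pull_mlieBracket (hΞ.mdifferentiableAt _) (hY.mdifferentiableAt _),
    hf.pull_mlieBracket (hΞ.mdifferentiableAt _) (hZ.mdifferentiableAt _),
    ← h.field u hu, hf.mvfderiv_inner g (h.differentiableAt_metricPull hu) hY hZ,
    h.fderiv_metricPull hu, h0,
    h.pull_field hu, hc, zero_apply, zero_apply, sub_zero, sub_zero]
  ring

/-- For constant coefficients only the Christoffel term is left, and `coneChristoffel` paired with
`(0, -2)` is multiplication by `-2 l`. -/
lemma IsConeParam.nabla_field (h : IsConeParam N g Θ Ξ l c A G f U) (hu : u.1 ∈ U)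
    (hΞ : SmoothVF Ξ) (v : TangentSpace I (f u)) : N Ξ (f u) v = (-2 * l) • v := by
  have hf := h.param u hu
  have hc : ∀ᶠ v in 𝓝 u, pull f Ξ v = ((0 : E), (-2 : ℝ)) := by
    filter_upwards [h.eventually hu] with v hv using h.pull_field hv
  rw [← hf.dpar_dparInv v, h.connection u hu Ξ (hΞ.mdifferentiableAt _), covPull_of_const _ hc,
    ← map_smul]
  congr 1
  rw [coneChristoffel_apply]
  refine Prod.ext ?_ ?_
  · simp [smul_smul, mul_comm]
  · simp; ring

lemma IsConeParam.curvature (hl : l * (2 - l) = c) (h : IsConeParam N g Θ Ξ l c A G f U)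
    (hu : u.1 ∈ U) {X Y Z : Π x : C, TangentSpace I x} (hX : SmoothVF X) (hY : SmoothVF Y)
    (hZ : SmoothVF Z) : curvature N X Y Z (f u) = 0 := by
  have hf := h.param u hu
  have hs := h.statistical _ hu
  have h1 : ∀ᶠ v in 𝓝 u, Represents N f v (coneChristoffel l (A v.1) (G v.1)) := by
    filter_upwards [h.eventually hu] with v hv using h.connection v hv
  rw [← hf.dpar_pull (LCHGeometry.curvature N X Y Z), pull_curvature hf h1
    ((contDiffAt_coneChristoffel hs.contDiffAt_christoffel hs.contDiffAt_metric l).differentiableAt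
      (by simp)) hX hY hZ, christoffelCurvature_cone hl hs.contDiffAt_christoffel
      hs.contDiffAt_metric hs.christoffel_comm hs.metric_comm hs.codazzi hs.curvature, map_zero]

lemma IsConeParam.symmetric (h : IsConeParam N g Θ Ξ l c A G f U)
    (hu : u.1 ∈ U) {X Y Z : Π x : C, TangentSpace I x} (hX : SmoothVF X) (hY : SmoothVF Y)
    (hZ : SmoothVF Z) :
    nablaMetric N g X Y Z (f u) - Θ (f u) (X (f u)) * g.inner (f u) (Y (f u)) (Z (f u)) =
    nablaMetric N g Y X Z (f u) - Θ (f u) (Y (f u)) * g.inner (f u) (X (f u)) (Z (f u)) := by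
  have hf := h.param u hu
  have hs := h.statistical _ hu
  rw [nablaMetric_param hf g (h.connection u hu) (h.differentiableAt_metricPull hu) hY hZ,
    nablaMetric_param hf g (h.connection u hu) (h.differentiableAt_metricPull hu) hX hZ,
    ← hf.metricPull_pull, ← hf.metricPull_pull, h.fderiv_metricPull hu, h.metric u hu,
    h.form_pull hu, h.form_pull hu]
  exact cone_codazzi hs.christoffel_comm hs.metric_comm hs.contDiffAt_metric hs.codazzi _ _ _

/-- Symmetry in the last two slots comes from the symmetry of `g` alone. Total symmetry thus reduces
to the first transposition. -/
lemma nablaMetric_comm (N : Connection I C) (g : RiemMetric I C)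
    (X Y Z : Π x : C, TangentSpace I x) (x : C) :
    nablaMetric N g X Y Z x = nablaMetric N g X Z Y x := by
  unfold nablaMetric
  have h : (fun y ↦ g.inner y (Y y) (Z y)) = fun y ↦ g.inner y (Z y) (Y y) :=
    funext fun y ↦ g.symm y _ _
  rw [h, g.symm x _ (Z x), g.symm x (Y x)]
  ring

/-- The given tensors on `C` are locally those of the cone over a statistical manifold of constant
curvature `c`. -/
def IsCone (N : Connection I C) (g : RiemMetric I C)
    (Θ : Π x : C, TangentSpace I x →L[ℝ] ℝ) (Ξ : Π x : C, TangentSpace I x) (l c : ℝ) : Prop :=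
  ∀ x : C, ∃ A G, ∃ (f : E × ℝ → C) (U : Set E), IsConeParam N g Θ Ξ l c A G f U ∧
    ∃ u : E × ℝ, u.1 ∈ U ∧ f u = x

theorem IsCone.isLCH [T2Space C] (hl : l * (2 - l) = c) (h : IsCone N g Θ Ξ l c)
    (hN : SmoothConnection N) (hΘ : SmoothForm Θ) : IsLCH N g Θ := by
  refine ⟨⟨hN, ?_, ?_⟩, hΘ, ?_, ?_⟩
  · intro x
    obtain ⟨A, G, f, U, hp, u, hu, rfl⟩ := h x
    refine (torsionFree_iff_christoffel (hp.param u hu) (hp.connection u hu)).2 fun x y ↦ ?_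
    have hs := hp.statistical _ hu
    rw [coneChristoffel_apply, coneChristoffel_apply, hs.christoffel_comm, hs.metric_comm,
      mul_comm x.2, add_comm (x.2 • y.1)]
  · intro X Y Z hX hY hZ x
    obtain ⟨A, G, f, U, hp, u, hu, rfl⟩ := h x
    exact hp.curvature hl hu hX hY hZ
  · intro X Y hX hY x
    obtain ⟨A, G, f, U, hp, u, hu, rfl⟩ := h x
    exact hp.closed hu hX hY
  · intro X Y Z hX hY hZ x
    obtain ⟨A, G, f, U, hp, u, hu, rfl⟩ := h x
    refine ⟨hp.symmetric hu hX hY hZ, ?_⟩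
    simp only
    rw [nablaMetric_comm, g.symm]

theorem IsCone.isLeeField (h : IsCone N g Θ Ξ l c) : IsLeeField g Θ Ξ := by
  intro x
  obtain ⟨A, G, f, U, hp, u, hu, rfl⟩ := h x
  exact hp.lee hu

theorem IsCone.inner_field (h : IsCone N g Θ Ξ l c) (x : C) : g.inner x (Ξ x) (Ξ x) = 4 := by
  obtain ⟨A, G, f, U, hp, u, hu, rfl⟩ := h x
  exact hp.inner_field hu

theorem IsCone.isKilling (h : IsCone N g Θ Ξ l c) (hΞ : SmoothVF Ξ) : IsKilling g Ξ := by
  refine ⟨hΞ, fun Y Z hY hZ x ↦ ?_⟩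
  obtain ⟨A, G, f, U, hp, u, hu, rfl⟩ := h x
  exact hp.killing hu hΞ hY hZ

theorem IsCone.nablaEqSmulId (h : IsCone N g Θ Ξ l c) (hΞ : SmoothVF Ξ) :
    NablaEqSmulId N Ξ (-2 * l) := by
  intro x
  obtain ⟨A, G, f, U, hp, u, hu, rfl⟩ := h x
  exact hp.nabla_field hu hΞ

theorem IsCone.isRadiantLCH [T2Space C] (hl : l * (2 - l) = c) (h : IsCone N g Θ Ξ l c)
    (hN : SmoothConnection N) (hΘ : SmoothForm Θ) (hΞ : SmoothVF Ξ) : IsRadiantLCH N g Θ Ξ :=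
  ⟨h.isLCH hl hN hΘ, h.isLeeField, h.isKilling hΞ, _, h.nablaEqSmulId hΞ⟩

end ConeStructure

/-! ### Changes of parametrizations of the cone -/

section CylMap

variable {E : Type*} [NormedAddCommGroup E] [NormedSpace ℝ E]

/-- The map `σ × (· + s)`. -/
def cylMap (σ : E → E) (s : ℝ) (v : E × ℝ) : E × ℝ := (σ v.1, v.2 + s)

variable {σ : E → E} {s : ℝ} {u : E × ℝ}

lemma contDiffAt_cylMap (hσ : ContDiffAt ℝ ∞ σ u.1) (s : ℝ) : ContDiffAt ℝ ∞ (cylMap σ s) u :=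
  (hσ.comp u contDiffAt_fst).prodMk (contDiffAt_snd.add contDiffAt_const)

lemma fderiv_cylMap (hσ : DifferentiableAt ℝ σ u.1) (s : ℝ) (w : E × ℝ) :
    fderiv ℝ (cylMap σ s) u w = (fderiv ℝ σ u.1 w.1, w.2) := by
  have h : HasFDerivAt (cylMap σ s) (((fderiv ℝ σ u.1).comp (ContinuousLinearMap.fst ℝ E ℝ)).prod
      (ContinuousLinearMap.snd ℝ E ℝ)) u :=
    (hσ.hasFDerivAt.comp u hasFDerivAt_fst).prodMk (hasFDerivAt_snd.add_const s)
  rw [h.fderiv]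
  rfl

lemma fderiv_clm_apply_const {V W : Type*} [NormedAddCommGroup V] [NormedSpace ℝ V]
    [NormedAddCommGroup W] [NormedSpace ℝ W] {L : V → V →L[ℝ] W} {v : V}
    (h : DifferentiableAt ℝ L v) (w z : V) :
    fderiv ℝ L v w z = fderiv ℝ (fun v ↦ L v z) v w := by
  rw [(h.hasFDerivAt.clm_apply (hasFDerivAt_const z v)).fderiv]
  simp

lemma fderiv_fderiv_cylMap (hσ : ContDiffAt ℝ ∞ σ u.1) (s : ℝ) (w z : E × ℝ) :
    fderiv ℝ (fderiv ℝ (cylMap σ s)) u w z = (fderiv ℝ (fderiv ℝ σ) u.1 w.1 z.1, 0) := by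
  have hτ := contDiffAt_cylMap hσ s
  have hd : DifferentiableAt ℝ (fderiv ℝ (cylMap σ s)) u :=
    (hτ.fderiv_right (m := 1) (by norm_cast)).differentiableAt (by simp)
  have hd' : DifferentiableAt ℝ (fderiv ℝ σ) u.1 :=
    (hσ.fderiv_right (m := 1) (by norm_cast)).differentiableAt (by simp)
  rw [fderiv_clm_apply_const hd, fderiv_clm_apply_const hd']
  have h1 : ∀ᶠ v in 𝓝 u.1, DifferentiableAt ℝ σ v := by
    filter_upwards [(hσ.of_le (m := 1) (by norm_cast)).eventually (by simp)] with v hv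
    exact hv.differentiableAt (by simp)
  have h2 : (fun v ↦ fderiv ℝ (cylMap σ s) v z) =ᶠ[𝓝 u] fun v ↦ (fderiv ℝ σ v.1 z.1, z.2) := by
    filter_upwards [continuousAt_fst.eventually h1] with v hv using fderiv_cylMap hv s z
  have h3 : HasFDerivAt (fun v ↦ fderiv ℝ σ v z.1) (fderiv ℝ (fun v ↦ fderiv ℝ σ v z.1) u.1) u.1 :=
    (hd'.clm_apply (differentiableAt_const _)).hasFDerivAt
  have h4 : HasFDerivAt (fun v : E × ℝ ↦ fderiv ℝ σ v.1 z.1)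
      ((fderiv ℝ (fun v ↦ fderiv ℝ σ v z.1) u.1).comp (ContinuousLinearMap.fst ℝ E ℝ)) u :=
    HasFDerivAt.comp u h3 hasFDerivAt_fst
  rw [h2.fderiv_eq, (h4.prodMk (hasFDerivAt_const z.2 u)).fderiv]
  rfl

/-- The translation contributes no second derivative. The part in `A` follows the law for `σ`, the
part in `G` is invariant since `σ` is isometric, and the remaining terms are natural. -/
lemma christoffelLaw_cylMap {l : ℝ} {A A' : E →L[ℝ] E →L[ℝ] E} {G G' : E →L[ℝ] E →L[ℝ] ℝ}
    (hσ : ContDiffAt ℝ ∞ σ u.1) (hA : ChristoffelLaw σ u.1 A A')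
    (hG : ∀ w z, G w z = G' (fderiv ℝ σ u.1 w) (fderiv ℝ σ u.1 z)) (s : ℝ) :
    ChristoffelLaw (cylMap σ s) u (coneChristoffel l A G) (coneChristoffel l A' G') := by
  intro w z
  have hd := hσ.differentiableAt (by simp)
  rw [fderiv_cylMap hd, fderiv_cylMap hd, fderiv_cylMap hd, fderiv_fderiv_cylMap hσ,
    coneChristoffel_apply, coneChristoffel_apply]
  refine Prod.ext ?_ ?_
  · simp only [map_add, map_smul, Prod.fst_add, hA w.1 z.1]
    abel
  · simp [hG w.1 z.1]

lemma coneMetric_cylMap {G G' : E →L[ℝ] E →L[ℝ] ℝ} (hσ : DifferentiableAt ℝ σ u.1)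
    (hG : ∀ w z, G w z = G' (fderiv ℝ σ u.1 w) (fderiv ℝ σ u.1 z)) (s : ℝ) (w z : E × ℝ) :
    coneMetric G w z =
      coneMetric G' (fderiv ℝ (cylMap σ s) u w) (fderiv ℝ (cylMap σ s) u z) := by
  rw [fderiv_cylMap hσ, fderiv_cylMap hσ, coneMetric_apply, coneMetric_apply, hG]

end CylMap

/-! ### Parametrizations of the cone and of its quotient -/

section ConeParam

variable {E : Type*} [NormedAddCommGroup E] [NormedSpace ℝ E]
  {M : Type*} [TopologicalSpace M] [ChartedSpace E M]

/-- The parametrization of `M × ℝ^{>0}` by a chart of `M` and the logarithm. -/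
def coneParam (m : M) (u : E × ℝ) : M × PosReal :=
  ((chartAt E m).symm u.1, ⟨Real.exp u.2, Real.exp_pos _⟩)

lemma exists_coneParam_eq (p : M × PosReal) :
    ∃ m : M, ∃ u : E × ℝ, u.1 ∈ (chartAt E m).target ∧ coneParam m u = p := by
  refine ⟨p.1, (chartAt E p.1 p.1, Real.log p.2), mem_chart_target E p.1,
    Prod.ext ?_ (Subtype.ext (Real.exp_log p.2.2))⟩
  exact (chartAt E p.1).left_inv (mem_chart_source E p.1)

lemma dfst_apply [IsManifold 𝓘(ℝ, E) ∞ M] (p : M × PosReal) (v : TangentSpace (coneModel E) p) :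
    dfst p v = (show E × ℝ from v).1 := by
  unfold dfst
  rw [mfderiv_fst]
  rfl

lemma ds_apply [IsManifold 𝓘(ℝ, E) ∞ M] (p : M × PosReal) (v : TangentSpace (coneModel E) p) :
    ds p v = (show E × ℝ from v).2 := by
  have h : HasMFDerivAt 𝓘(ℝ, ℝ) 𝓘(ℝ, ℝ) (Subtype.val : PosReal → ℝ) p.2
      (ContinuousLinearMap.id ℝ ℝ) := by
    have key : HasFDerivAt (fun x : ℝ ↦ ((chartAt ℝ p.2).symm x : ℝ))
        (ContinuousLinearMap.id ℝ ℝ) (chartAt ℝ p.2 p.2) := by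
      refine HasFDerivAt.congr_of_eventuallyEq (hasFDerivAt_id (𝕜 := ℝ) (chartAt ℝ p.2 p.2)) ?_
      filter_upwards [(chartAt ℝ p.2).open_target.mem_nhds (mem_chart_target ℝ p.2)] with x hx
      exact (chartAt ℝ p.2).right_inv hx
    exact ⟨continuous_subtype_val.continuousAt, key.hasFDerivWithinAt⟩
  have hc : HasMFDerivAt (coneModel E) 𝓘(ℝ, ℝ) (fun p : M × PosReal ↦ (p.2 : ℝ)) p
      ((ContinuousLinearMap.id ℝ ℝ).comp (ContinuousLinearMap.snd ℝ E ℝ)) :=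
    HasMFDerivAt.comp p h (hasMFDerivAt_snd p)
  unfold ds mvfderiv
  rw [hc.mfderiv]
  rfl

variable [IsManifold 𝓘(ℝ, E) ∞ M]

lemma isParamAt_coneParam (m : M) {u : E × ℝ} (hu : u.1 ∈ (chartAt E m).target) :
    IsParamAt (coneModel E) (coneParam m) u := by
  let Φ : PartialEquiv (E × ℝ) (M × PosReal) :=
    { toFun := coneParam m
      invFun := fun p ↦ (chartAt E m p.1, Real.log p.2)
      source := (chartAt E m).target ×ˢ univ
      target := (chartAt E m).source ×ˢ univ
      map_source' := fun v hv ↦ ⟨(chartAt E m).map_target hv.1, trivial⟩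
      map_target' := fun p hp ↦ ⟨(chartAt E m).map_source hp.1, trivial⟩
      left_inv' := fun v hv ↦ Prod.ext ((chartAt E m).right_inv hv.1) (Real.log_exp _)
      right_inv' := fun p hp ↦ Prod.ext ((chartAt E m).left_inv hp.1)
        (Subtype.ext (Real.exp_log p.2.2)) }
  refine ⟨⟨Φ, (chartAt E m).open_target.prod isOpen_univ,
    (chartAt E m).open_source.prod isOpen_univ, ?_, ?_⟩, ⟨hu, trivial⟩, fun _ _ ↦ rfl⟩
  · have h1 : ContMDiffOn 𝓘(ℝ, E × ℝ) 𝓘(ℝ, E) ∞ (fun v : E × ℝ ↦ (chartAt E m).symm v.1)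
        ((chartAt E m).target ×ˢ univ) :=
      contMDiffOn_chart_symm.comp (contDiff_fst.contMDiff).contMDiffOn fun v hv ↦ hv.1
    have h2 : ContMDiff 𝓘(ℝ, E × ℝ) 𝓘(ℝ, ℝ) ∞
        (fun v : E × ℝ ↦ (⟨Real.exp v.2, Real.exp_pos _⟩ : PosReal)) := by
      intro v
      rw [← ContMDiffAt.subtypeVal_comp_iff]
      exact (Real.contDiff_exp.comp contDiff_snd).contMDiff v
    exact h1.prodMk h2.contMDiffOn
  · have h1 : ContMDiffOn (coneModel E) 𝓘(ℝ, E) ∞ (fun p : M × PosReal ↦ chartAt E m p.1)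
        ((chartAt E m).source ×ˢ univ) :=
      contMDiffOn_chart.comp contMDiff_fst.contMDiffOn fun v hv ↦ hv.1
    have h2 : ContMDiff (coneModel E) 𝓘(ℝ, ℝ) ∞ (fun p : M × PosReal ↦ Real.log p.2) := by
      intro p
      have h3 : ContMDiffAt (coneModel E) 𝓘(ℝ, ℝ) ∞ (fun p : M × PosReal ↦ (p.2 : ℝ)) p :=
        (contMDiff_subtype_val.comp contMDiff_snd) p
      have h4 : ContDiffAt ℝ ∞ Real.log p.2 :=
        Real.contDiffAt_log.2 (show (0 : ℝ) < p.2 from p.2.2).ne'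
      exact h4.contMDiffAt.comp p h3
    exact h1.prodMk_space h2.contMDiffOn

lemma dfst_coneParam (m : M) {u : E × ℝ} (hu : u.1 ∈ (chartAt E m).target) (w : E × ℝ) :
    dfst (coneParam m u) (dpar (coneModel E) (coneParam m) u w) =
      dpar 𝓘(ℝ, E) (chartAt E m).symm u.1 w.1 := by
  have hk := isParamAt_coneParam m hu
  have h1 : MDifferentiableAt (coneModel E) 𝓘(ℝ, E) (Prod.fst : M × PosReal → M)
    (coneParam m u) := mdifferentiableAt_fst
  have h2 := mfderiv_comp u h1 (hk.mdifferentiableAt (by simp))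
  have h3 : MDifferentiableAt 𝓘(ℝ, E × ℝ) 𝓘(ℝ, E) (Prod.fst : E × ℝ → E) u :=
    differentiableAt_fst.mdifferentiableAt
  have h4 := mfderiv_comp u ((isParamAt_chartAt_symm m hu).mdifferentiableAt (by simp)) h3
  rw [mfderiv_eq_fderiv, fderiv_fst] at h4
  exact congrArg (fun L : E × ℝ →L[ℝ] E ↦ L w) (h2.symm.trans h4)

/-- With `s = e^t` one has `ds = e^t dt`, so that `ds / s` becomes `dt`. -/
lemma ds_coneParam (m : M) {u : E × ℝ} (hu : u.1 ∈ (chartAt E m).target) (w : E × ℝ) :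
    ds (coneParam m u) (dpar (coneModel E) (coneParam m) u w) = Real.exp u.2 * w.2 := by
  have hk := isParamAt_coneParam m hu
  have h1 : MDifferentiableAt (coneModel E) 𝓘(ℝ, ℝ) (fun p : M × PosReal ↦ (p.2 : ℝ))
      (coneParam m u) :=
    ((contMDiff_subtype_val (n := ∞).comp contMDiff_snd) _).mdifferentiableAt (by simp)
  have h2 := hk.mvfderiv_dpar h1 w
  have h3 : HasFDerivAt (fun v : E × ℝ ↦ Real.exp v.2)
      (Real.exp u.2 • ContinuousLinearMap.snd ℝ E ℝ) u := hasFDerivAt_snd.exp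
  refine h2.trans ?_
  change fderiv ℝ (fun v : E × ℝ ↦ Real.exp v.2) u w = _
  rw [h3.fderiv]
  rfl

lemma dpar_coneParam_sds (m : M) {u : E × ℝ} (hu : u.1 ∈ (chartAt E m).target) (a : ℝ) :
    dpar (coneModel E) (coneParam m) u ((0 : E), a) = a • sds (coneParam m u) := by
  have h1 := dfst_coneParam m hu ((0 : E), a)
  have h2 := ds_coneParam m hu ((0 : E), a)
  rw [dfst_apply] at h1
  rw [ds_apply] at h2
  refine Prod.ext (h1.trans ?_) (h2.trans ?_)
  · rw [map_zero]
    exact (smul_zero (A := E) a).symm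
  · exact mul_comm _ _

end ConeParam

/-! ### The cone structure on the quotient -/

section QuotientParam

variable {E : Type*} [NormedAddCommGroup E] [NormedSpace ℝ E]
  {M : Type*} [TopologicalSpace M] [ChartedSpace E M]

/-- The parametrizations of the cone quotient. -/
def quotParam (φ : Equiv.Perm M) (q : ℝ) (hq : 0 < q) (m : M) : E × ℝ → ConeQuotient φ q hq :=
  coneProj φ q hq ∘ coneParam m

variable {φ : Equiv.Perm M} {q : ℝ} {hq : 0 < q}

/-- In the logarithmic coordinate, multiplication by `q ^ k` is translation by `k log q`. -/
lemma quotParam_eq_iff {m m' : M} {u u' : E × ℝ} :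
    quotParam φ q hq m u = quotParam φ q hq m' u' ↔
      ∃ k : ℤ, (φ ^ k) ((chartAt E m).symm u.1) = (chartAt E m').symm u'.1 ∧
        u'.2 = u.2 + k * Real.log q := by
  unfold quotParam
  rw [Function.comp_apply, Function.comp_apply, coneProj_eq_iff]
  refine exists_congr fun k ↦ ?_
  rw [coneMap_zpow_apply, Prod.ext_iff, Subtype.ext_iff]
  refine and_congr Iff.rfl ?_
  change q ^ k * Real.exp u.2 = Real.exp u'.2 ↔ _
  have h : q ^ k = Real.exp (k * Real.log q) := by
    rw [mul_comm, Real.exp_mul, Real.exp_log hq, Real.rpow_intCast]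
  rw [h, ← Real.exp_add, Real.exp_eq_exp, add_comm, eq_comm]

lemma exists_quotParam_eq (x : ConeQuotient φ q hq) :
    ∃ m : M, ∃ u : E × ℝ, u.1 ∈ (chartAt E m).target ∧ quotParam φ q hq m u = x := by
  obtain ⟨p, rfl⟩ := coneProj_surjective x
  obtain ⟨m, u, hu, rfl⟩ := exists_coneParam_eq (E := E) p
  exact ⟨m, u, hu, rfl⟩

variable [IsManifold 𝓘(ℝ, E) ∞ M] [ChartedSpace (ModelProd E ℝ) (ConeQuotient φ q hq)]

lemma isParamAt_quotParam
    (hp : IsLocalDiffeomorph (coneModel E) (coneModel E) ∞ (coneProj φ q hq)) (m : M) {u : E × ℝ}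
    (hu : u.1 ∈ (chartAt E m).target) : IsParamAt (coneModel E) (quotParam φ q hq m) u :=
  IsLocalDiffeomorphAt.comp _ _ (isParamAt_coneParam m hu) (hp _)

lemma dpar_quotParam
    (hp : IsLocalDiffeomorph (coneModel E) (coneModel E) ∞ (coneProj φ q hq)) (m : M) {u : E × ℝ}
    (hu : u.1 ∈ (chartAt E m).target) (w : E × ℝ) :
    dpar (coneModel E) (quotParam φ q hq m) u w = mfderiv (coneModel E) (coneModel E)
      (coneProj φ q hq) (coneParam m u) (dpar (coneModel E) (coneParam m) u w) := by
  have h := mfderiv_comp u ((hp (coneParam m u)).mdifferentiableAt (by simp))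
    ((isParamAt_coneParam m hu).mdifferentiableAt (by simp))
  exact congrArg (fun L : E × ℝ →L[ℝ] E × ℝ ↦ L w) h

variable (φ q hq) in
lemma isParamCover_quotParam
    (hp : IsLocalDiffeomorph (coneModel E) (coneModel E) ∞ (coneProj φ q hq)) :
    IsParamCover (coneModel E) (quotParam φ q hq) fun m : M ↦ Prod.fst ⁻¹' (chartAt E m).target :=
  ⟨fun m ↦ (chartAt E m).open_target.preimage continuous_fst,
    fun m _ hu ↦ isParamAt_quotParam hp m hu, exists_quotParam_eq⟩

variable [FiniteDimensional ℝ E] [T2Space M] {D : Connection 𝓘(ℝ, E) M} {gM : RiemMetric 𝓘(ℝ, E) M}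

/-- Two parameters with the same image differ by some `φ_q^k`, so the change of parametrizations is
the chart expression of `φ ^ k` times a translation. -/
lemma compatible_quotParam (hφ : φ ∈ paramInvariants D gM) :
    Compatible (quotParam φ q hq) (fun m : M ↦ Prod.fst ⁻¹' (chartAt E m).target)
      fun m m' u u' τ ↦ ∃ σ s, τ = cylMap σ s ∧ ContDiffAt ℝ ∞ σ u.1 ∧
        ChristoffelLaw σ u.1 (christoffel D (chartAt E m).symm u.1)
          (christoffel D (chartAt E m').symm u'.1) ∧
        ∀ w z, metricPull gM (chartAt E m).symm u.1 w z =
          metricPull gM (chartAt E m').symm u'.1 (fderiv ℝ σ u.1 w) (fderiv ℝ σ u.1 z) := by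
  intro m m' u hu u' hu' h
  obtain ⟨k, h1, h2⟩ := quotParam_eq_iff.1 h
  obtain ⟨hs, hs', hinv⟩ := zpow_mem hφ k
  have hf := isParamAt_chartAt_symm m hu
  have hf' := isParamAt_chartAt_symm m' hu'
  have ht := isTransition_chartExpr hs hu hu' h1
  have hfk : IsParamAt 𝓘(ℝ, E) ((φ ^ k : Equiv.Perm M) ∘ (chartAt E m).symm) u.1 :=
    hf.comp_diffeomorph (permDiffeomorph _ hs hs')
  refine ⟨cylMap (chartExpr (φ ^ k : Equiv.Perm M) m m') (k * Real.log q),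
    ⟨contDiffAt_cylMap ht.contDiffAt _, Prod.ext ht.map h2.symm, ?_⟩, _, _, rfl, ht.contDiffAt,
    ?_, fun w z ↦ ?_⟩
  · filter_upwards [continuousAt_fst.eventually ht.comp] with v hv
    exact (quotParam_eq_iff.2 ⟨k, hv.symm, rfl⟩).symm
  -- `φ ^ k` preserves `D`, so the symbols of the chart at `m` also represent `D` in `φ ^ k ∘
  -- chart⁻¹`, and the law for one connection applies.
  · exact Represents.christoffelLaw (((hinv _ _ hf).1 _).2 (represents_christoffel hf D))
      (represents_christoffel hf' D) ht hfk hf'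
  · rw [← ht.metricPull_eq hf', (hinv _ _ hf).2]

lemma isStatisticalExpr_chart {c : ℝ} (hstat : IsStatistical D gM)
    (hcurv : HasConstantCurvature D gM c) (m : M) {u : E} (hu : u ∈ (chartAt E m).target) :
    IsStatisticalExpr c (christoffel D (chartAt E m).symm) (metricPull gM (chartAt E m).symm) u :=
  have hf := isParamAt_chartAt_symm m hu
  ⟨contDiffAt_christoffel hf hstat.smooth, contDiffAt_metricPull hf gM,
    hstat.christoffel_comm hf, fun _ _ ↦ gM.symm _ _ _, hstat.codazzi hf,
    hcurv.christoffelCurvature_eq hstat.smooth hf⟩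

/-- The tensors that the cone over a statistical manifold of constant curvature induces on the
cone quotient. -/
theorem exists_isCone [IsManifold (coneModel E) ∞ (ConeQuotient φ q hq)]
    [T2Space (ConeQuotient φ q hq)]
    (hp : IsLocalDiffeomorph (coneModel E) (coneModel E) ∞ (coneProj φ q hq))
    (hφ : φ ∈ paramInvariants D gM) {c : ℝ} (hstat : IsStatistical D gM)
    (hcurv : HasConstantCurvature D gM c) (l : ℝ) :
    ∃ (N : Connection (coneModel E) (ConeQuotient φ q hq))
      (g : RiemMetric (coneModel E) (ConeQuotient φ q hq))
      (Θ : Π x : ConeQuotient φ q hq, TangentSpace (coneModel E) x →L[ℝ] ℝ)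
      (Ξ : Π x : ConeQuotient φ q hq, TangentSpace (coneModel E) x),
      SmoothConnection N ∧ SmoothForm Θ ∧ SmoothVF Ξ ∧
      ∀ m : M, IsConeParam N g Θ Ξ l c (christoffel D (chartAt E m).symm)
        (metricPull gM (chartAt E m).symm) (quotParam φ q hq m) (chartAt E m).target := by
  have hU := isParamCover_quotParam φ q hq hp
  have hc := compatible_quotParam (q := q) (hq := hq) hφ
  have hs : ∀ (m : M) (u : E × ℝ), u ∈ Prod.fst ⁻¹' (chartAt E m).target →
      IsStatisticalExpr c (christoffel D (chartAt E m).symm)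
        (metricPull gM (chartAt E m).symm) u.1 :=
    fun m u hu ↦ isStatisticalExpr_chart hstat hcurv m hu
  obtain ⟨N, hN, hN'⟩ := exists_connection hU
    (fun m u ↦ coneChristoffel l (christoffel D (chartAt E m).symm u.1)
      (metricPull gM (chartAt E m).symm u.1))
    (fun m u hu ↦ contDiffAt_coneChristoffel (hs m u hu).contDiffAt_christoffel
      (hs m u hu).contDiffAt_metric l) (by
      intro m m' u hu u' hu' h
      obtain ⟨τ, ht, σ, s, rfl, h1, h2, h3⟩ := hc m m' u hu u' hu' h
      exact ⟨_, ht, christoffelLaw_cylMap h1 h2 h3 s⟩)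
  obtain ⟨g, hg⟩ := exists_metric hU (fun m u ↦ coneMetric (metricPull gM (chartAt E m).symm u.1))
    (fun m u hu ↦ contDiffAt_coneMetric (hs m u hu).contDiffAt_metric)
    (fun m u hu w z ↦ by
      rw [coneMetric_apply, coneMetric_apply, (hs m u hu).metric_comm, mul_comm w.2])
    (fun m u hu w hw ↦ by
      rw [coneMetric_apply, metricPull_apply]
      have hf := isParamAt_chartAt_symm m (u := u.1) hu
      by_cases h : w.1 = 0
      · have h2 : w.2 ≠ 0 := fun h2 ↦ hw (Prod.ext h h2)
        rw [h, map_zero, map_zero, zero_add]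
        exact mul_self_pos.2 h2
      · have h1 : dpar 𝓘(ℝ, E) (chartAt E m).symm u.1 w.1 ≠ 0 := fun h1 ↦
          h (hf.dpar_injective (h1.trans (map_zero _).symm))
        exact add_pos_of_pos_of_nonneg (gM.pos _ _ h1) (mul_self_nonneg _)) (by
      intro m m' u hu u' hu' h
      obtain ⟨τ, ht, σ, s, rfl, h1, h2, h3⟩ := hc m m' u hu u' hu' h
      exact ⟨_, ht, coneMetric_cylMap (h1.differentiableAt (by simp)) h3 s⟩)
  obtain ⟨Θ, hΘ⟩ := exists_form hU (fun _ _ ↦ coneLeeForm E) (by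
      intro m m' u hu u' hu' h
      obtain ⟨τ, ht, σ, s, rfl, h1, h2, h3⟩ := hc m m' u hu u' hu' h
      refine ⟨_, ht, fun w ↦ ?_⟩
      rw [fderiv_cylMap (h1.differentiableAt (by simp))]
      rfl)
  obtain ⟨Ξ, hΞ⟩ := exists_vectorField hU (fun _ _ ↦ ((0 : E), (-2 : ℝ))) (by
      intro m m' u hu u' hu' h
      obtain ⟨τ, ht, σ, s, rfl, h1, h2, h3⟩ := hc m m' u hu u' hu' h
      refine ⟨_, ht, ?_⟩
      change fderiv ℝ (cylMap σ s) u _ = _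
      rw [fderiv_cylMap (h1.differentiableAt (by simp)), map_zero])
  refine ⟨N, g, Θ, Ξ, hN, smoothForm_of_params hU hΘ fun _ _ _ ↦ contDiffAt_const,
    smoothVF_of_params hU hΞ fun _ _ _ ↦ contDiffAt_const, fun m ↦ ?_⟩
  exact ⟨(chartAt E m).open_target, fun u hu ↦ hU.param m u hu,
    fun u hu ↦ isStatisticalExpr_chart hstat hcurv m hu, fun u hu ↦ hN' m u hu,
    fun u hu ↦ hg m u hu, fun u hu ↦ hΘ m u hu, fun u hu ↦ hΞ m u hu⟩

end QuotientParam

/-! ### The induced metric, Lee form and Lee field in terms of `s` -/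

section Formulas

variable {E : Type*} [NormedAddCommGroup E] [NormedSpace ℝ E] [FiniteDimensional ℝ E]
  {M : Type*} [TopologicalSpace M] [ChartedSpace E M] [IsManifold 𝓘(ℝ, E) ∞ M]
  {φ : Equiv.Perm M} {q : ℝ} {hq : 0 < q} [ChartedSpace (ModelProd E ℝ) (ConeQuotient φ q hq)]
  [IsManifold (coneModel E) ∞ (ConeQuotient φ q hq)]
  {D : Connection 𝓘(ℝ, E) M} {gM : RiemMetric 𝓘(ℝ, E) M}
  {N : Connection (coneModel E) (ConeQuotient φ q hq)}
  {g : RiemMetric (coneModel E) (ConeQuotient φ q hq)}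
  {Θ : Π x : ConeQuotient φ q hq, TangentSpace (coneModel E) x →L[ℝ] ℝ}
  {Ξ : Π x : ConeQuotient φ q hq, TangentSpace (coneModel E) x} {l c : ℝ}

lemma isCone_of_isConeParam
    (h : ∀ m : M, IsConeParam N g Θ Ξ l c (christoffel D (chartAt E m).symm)
        (metricPull gM (chartAt E m).symm) (quotParam φ q hq m) (chartAt E m).target) :
    IsCone N g Θ Ξ l c := by
  intro x
  obtain ⟨m, u, hu, hx⟩ := exists_quotParam_eq (E := E) x
  exact ⟨_, _, _, _, h m, u, hu, hx⟩

lemma inner_mfderiv_coneProj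
    (hp : IsLocalDiffeomorph (coneModel E) (coneModel E) ∞ (coneProj φ q hq))
    (h : ∀ m : M, IsConeParam N g Θ Ξ l c (christoffel D (chartAt E m).symm)
        (metricPull gM (chartAt E m).symm) (quotParam φ q hq m) (chartAt E m).target)
    (p : M × PosReal) (v w : TangentSpace (coneModel E) p) :
    g.inner (coneProj φ q hq p)
        (mfderiv (coneModel E) (coneModel E) (coneProj φ q hq) p v)
        (mfderiv (coneModel E) (coneModel E) (coneProj φ q hq) p w)
      = gM.inner p.1 (dfst p v) (dfst p w) + ds p v * ds p w / (p.2 : ℝ) ^ 2 := by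
  obtain ⟨m, u, hu, rfl⟩ := exists_coneParam_eq (E := E) p
  have hk := isParamAt_coneParam m hu
  rw [← hk.dpar_dparInv v, ← hk.dpar_dparInv w, ← dpar_quotParam hp m hu, ← dpar_quotParam hp m hu,
    dfst_coneParam m hu, dfst_coneParam m hu, ds_coneParam m hu, ds_coneParam m hu]
  have h1 := congrArg (fun B ↦ B (dparInv (coneModel E) (coneParam m) u v)
    (dparInv (coneModel E) (coneParam m) u w)) ((h m).metric u hu)
  rw [metricPull_apply, coneMetric_apply, metricPull_apply] at h1
  refine h1.trans ?_
  congr 1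
  change _ = Real.exp u.2 * _ * (Real.exp u.2 * _) / Real.exp u.2 ^ 2
  have := Real.exp_pos u.2
  field_simp

lemma form_mfderiv_coneProj
    (hp : IsLocalDiffeomorph (coneModel E) (coneModel E) ∞ (coneProj φ q hq))
    (h : ∀ m : M, IsConeParam N g Θ Ξ l c (christoffel D (chartAt E m).symm)
        (metricPull gM (chartAt E m).symm) (quotParam φ q hq m) (chartAt E m).target)
    (p : M × PosReal) (v : TangentSpace (coneModel E) p) :
    Θ (coneProj φ q hq p) (mfderiv (coneModel E) (coneModel E) (coneProj φ q hq) p v)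
      = -2 * ds p v / (p.2 : ℝ) := by
  obtain ⟨m, u, hu, rfl⟩ := exists_coneParam_eq (E := E) p
  have hk := isParamAt_coneParam m hu
  rw [← hk.dpar_dparInv v, ← dpar_quotParam hp m hu, ds_coneParam m hu]
  refine ((h m).form u hu _).trans ?_
  rw [coneLeeForm_apply]
  change _ = -2 * (Real.exp u.2 * _) / Real.exp u.2
  have := Real.exp_pos u.2
  field_simp

lemma field_coneProj
    (hp : IsLocalDiffeomorph (coneModel E) (coneModel E) ∞ (coneProj φ q hq))
    (h : ∀ m : M, IsConeParam N g Θ Ξ l c (christoffel D (chartAt E m).symm)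
        (metricPull gM (chartAt E m).symm) (quotParam φ q hq m) (chartAt E m).target)
    (p : M × PosReal) :
    Ξ (coneProj φ q hq p)
      = mfderiv (coneModel E) (coneModel E) (coneProj φ q hq) p ((-2 : ℝ) • sds p) := by
  obtain ⟨m, u, hu, rfl⟩ := exists_coneParam_eq (E := E) p
  rw [← dpar_coneParam_sds m hu, ← dpar_quotParam hp m hu]
  exact ((h m).field u hu).symm

end Formulas

/-! ### The Lee field is affine -/

section Affine

variable {E : Type*} [NormedAddCommGroup E] [NormedSpace ℝ E]
  {H : Type*} [TopologicalSpace H] {I : ModelWithCorners ℝ (E × ℝ) H}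
  {C : Type*} [TopologicalSpace C] [ChartedSpace H C] [IsManifold I ∞ C]
  {N : Connection I C} {g : RiemMetric I C}
  {Θ : Π x : C, TangentSpace I x →L[ℝ] ℝ} {Ξ : Π x : C, TangentSpace I x} {l c : ℝ}
  {A : E → E →L[ℝ] E →L[ℝ] E} {G : E → E →L[ℝ] E →L[ℝ] ℝ} {f : E × ℝ → C} {U : Set E}
  {u : E × ℝ}

lemma IsConeParam.hasMFDerivAt_curve (h : IsConeParam N g Θ Ξ l c A G f U) (hu : u.1 ∈ U) (t : ℝ) :
    HasMFDerivAt 𝓘(ℝ, ℝ) I (fun t : ℝ ↦ f (u + t • ((0 : E), (-2 : ℝ)))) t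
      ((1 : ℝ →L[ℝ] ℝ).smulRight (Ξ (f (u + t • ((0 : E), (-2 : ℝ)))))) := by
  have hu' : (u + t • ((0 : E), (-2 : ℝ))).1 ∈ U := by simpa using hu
  have h1 : HasMFDerivAt 𝓘(ℝ, E × ℝ) I f (u + t • ((0 : E), (-2 : ℝ)))
      (dpar I f (u + t • ((0 : E), (-2 : ℝ)))) :=
    ((h.param _ hu').mdifferentiableAt (by simp)).hasMFDerivAt
  have h2 : HasFDerivAt (fun t : ℝ ↦ u + t • ((0 : E), (-2 : ℝ)))
      ((1 : ℝ →L[ℝ] ℝ).smulRight ((0 : E), (-2 : ℝ))) t :=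
    ((hasFDerivAt_id (𝕜 := ℝ) t).smul_const ((0 : E), (-2 : ℝ))).const_add u
  have h3 := HasMFDerivAt.comp t h1 h2.hasMFDerivAt
  have h4 : ((dpar I f (u + t • ((0 : E), (-2 : ℝ)))).comp
      ((1 : ℝ →L[ℝ] ℝ).smulRight ((0 : E), (-2 : ℝ))) : ℝ →L[ℝ] E × ℝ) =
      (1 : ℝ →L[ℝ] ℝ).smulRight (Ξ (f (u + t • ((0 : E), (-2 : ℝ)))) : E × ℝ) := by
    rw [← h.field _ hu']
    exact ContinuousLinearMap.ext fun a ↦ map_smul (dpar I f (u + t • ((0 : E), (-2 : ℝ)))) _ _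
  exact h3.congr_mfderiv h4

variable [FiniteDimensional ℝ E] [T2Space C] [BoundarylessManifold I C]

/-- The lines in direction `(0, -2)` are integral curves of `Ξ`. By uniqueness any integral curve
with the same initial point is such a line. -/
lemma IsConeParam.flow_eq (h : IsConeParam N g Θ Ξ l c A G f U) (hu : u.1 ∈ U) (hΞ : SmoothVF Ξ)
    {ε : ℝ} (hε : 0 < ε) {γ : ℝ → C} (h0 : γ 0 = f u)
    (hγ : IsMIntegralCurveOn γ Ξ (Ioo (-ε) ε)) {t : ℝ} (ht : t ∈ Ioo (-ε) ε) :
    γ t = f (u + t • ((0 : E), (-2 : ℝ))) := by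
  have : IsManifold I 1 C := IsManifold.of_le (n := ∞) (by norm_cast)
  have : CompleteSpace (E × ℝ) := FiniteDimensional.complete ℝ _
  refine isMIntegralCurveOn_Ioo_eqOn_of_contMDiff_boundaryless (I := I) (t₀ := 0) (v := Ξ)
    ⟨neg_lt_zero.2 hε, hε⟩ (ContMDiff.of_le hΞ (by norm_cast)) hγ
    (fun t _ ↦ (h.hasMFDerivAt_curve hu t).hasMFDerivWithinAt) ?_ ht
  simp [h0]

lemma IsConeParam.covPull_translate {u' : E × ℝ} (hu : u'.1 = u.1)
    {Y Y' : Π x : C, TangentSpace I x}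
    (hY : ∀ᶠ v in 𝓝 u, pull f Y v = pull f Y' (v + (u' - u))) (w : E × ℝ) :
    covPull f u (coneChristoffel l (A u.1) (G u.1)) Y w =
      covPull f u' (coneChristoffel l (A u'.1) (G u'.1)) Y' w := by
  have h1 : u + (u' - u) = u' := by abel
  rw [covPull_apply, covPull_apply, Filter.EventuallyEq.fderiv_eq hY,
    fderiv_comp_add_right (f := pull f Y') (u' - u), h1, hY.self_of_nhds, h1, hu]

/-- In a cone parametrization any local flow of `Ξ` is a translation in the last coordinate. Its
differential is the identity and the Christoffel symbols do not depend on that coordinate. -/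
theorem IsCone.isAffineField (h : IsCone N g Θ Ξ l c) (hΞ : SmoothVF Ξ) : IsAffineField N Ξ := by
  refine ⟨hΞ, fun V ε ψ hV hε hψ hfl t ht X Y X' Y' hX hY hX' hY' hXX' hYY' x hx ↦ ?_⟩
  obtain ⟨A, G, f, U, hp, u, hu, rfl⟩ := h x
  set T : E × ℝ := t • ((0 : E), (-2 : ℝ)) with hT
  have hfV : ∀ᶠ v in 𝓝 u, f v ∈ V :=
    (hp.param u hu).continuousAt.eventually (hV.mem_nhds hx)
  have hgood : ∀ᶠ v in 𝓝 u, v.1 ∈ U ∧ f v ∈ V := (hp.eventually hu).and hfV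
  -- The domain is a full cylinder `U × ℝ`, so one parametrization serves for all times `t`.
  have hmem : ∀ v : E × ℝ, v.1 ∈ U → (v + T).1 ∈ U := fun v hv ↦ by simpa [hT] using hv
  have hflow : ∀ v : E × ℝ, v.1 ∈ U → f v ∈ V → ψ t (f v) = f (v + T) := fun v hv hv' ↦
    hp.flow_eq hv hΞ hε (hfl _ hv').1 (hfl _ hv').2 ht
  have hd : ∀ v : E × ℝ, f v ∈ V → MDifferentiableAt I I (ψ t) (f v) := by
    intro v hv
    have h1 : ContMDiffAt (𝓘(ℝ, ℝ).prod I) I ∞ (fun p : ℝ × C ↦ ψ p.1 p.2) (t, f v) :=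
      hψ.contMDiffAt ((isOpen_Ioo.prod hV).mem_nhds ⟨ht, hv⟩)
    have h2 : ContMDiffAt I (𝓘(ℝ, ℝ).prod I) ∞ (fun y : C ↦ (t, y)) (f v) :=
      contMDiffAt_const.prodMk contMDiffAt_id
    exact (ContMDiffAt.comp (f v) h1 h2).mdifferentiableAt (by simp)
  have hder : ∀ v : E × ℝ, v.1 ∈ U → f v ∈ V → ∀ w : E × ℝ,
      (mfderiv I I (ψ t) (f v) (dpar I f v w) : E × ℝ) = dpar I f (v + T) w := by
    intro v hv hv' w
    have hf := hp.param v hv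
    have h1 := mfderiv_comp v (hd v hv') (hf.mdifferentiableAt (by simp))
    have h2 : ψ t ∘ f =ᶠ[𝓝 v] fun v ↦ f (v + T) := by
      filter_upwards [hp.eventually hv, hf.continuousAt.eventually (hV.mem_nhds hv')] with y hy hy'
      exact hflow y hy hy'
    have h3 : HasMFDerivAt 𝓘(ℝ, E × ℝ) 𝓘(ℝ, E × ℝ) (fun v ↦ v + T) v
        (ContinuousLinearMap.id ℝ (E × ℝ)) :=
      ((hasFDerivAt_id v).add_const T).hasMFDerivAt
    have h4 := HasMFDerivAt.comp v
      ((hp.param (v + T) (hmem v hv)).mdifferentiableAt (by simp)).hasMFDerivAt h3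
    have h5 := h2.mfderiv_eq (I := 𝓘(ℝ, E × ℝ)) (I' := I)
    exact congrArg (fun L : E × ℝ →L[ℝ] E × ℝ ↦ L w) (h1.symm.trans (h5.trans h4.mfderiv))
  have hpull : ∀ Z Z' : Π x : C, TangentSpace I x,
      (∀ x ∈ V, mfderiv I I (ψ t) x (Z x) = Z' (ψ t x)) →
      ∀ v : E × ℝ, v.1 ∈ U → f v ∈ V → pull f Z v = pull f Z' (v + T) := by
    intro Z Z' hZ v hv hv'
    refine ((hp.param _ (hmem v hv)).pull_eq ?_).symm
    have h1 := hder v hv hv' (pull f Z v)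
    rw [(hp.param v hv).dpar_pull] at h1
    have h2 : (Z' (ψ t (f v)) : E × ℝ) = Z' (f (v + T)) :=
      congrArg (fun y ↦ (Z' y : E × ℝ)) (hflow v hv hv')
    exact h1.symm.trans ((hZ (f v) hv').trans h2)
  have e1 : (N Y' (ψ t (f u)) (X' (ψ t (f u))) : E × ℝ) = N Y' (f (u + T)) (X' (f (u + T))) :=
    congrArg (fun y ↦ (N Y' y (X' y) : E × ℝ)) (hflow u hu hx)
  refine Eq.trans ?_ e1.symm
  rw [← (hp.param u hu).dpar_pull X, ← (hp.param _ (hmem u hu)).dpar_pull X',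
    hp.connection u hu Y (hY.mdifferentiableAt _),
    hp.connection (u + T) (hmem u hu) Y' (hY'.mdifferentiableAt _)]
  refine (hder u hu hx _).trans ?_
  rw [← hpull X X' hXX' u hu hx]
  refine congrArg (fun w : E × ℝ ↦ (dpar I f (u + T) w : E × ℝ)) ?_
  refine IsConeParam.covPull_translate (by simp [hT]) ?_ _
  filter_upwards [hgood] with v hv
  rw [add_sub_cancel_left]
  exact hpull Y Y' hYY' v hv.1 hv.2

end Affine

/-! ### Integrals of the Lee form -/

/-- With `J` the primitive of `h`, the product `L · exp(-2πi J / b)` has derivative zero. Comparing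
the endpoints, `L 1 = L 0 ≠ 0` forces `exp(-2πi J(1) / b) = 1`. This replaces lifting a loop to the
covering. -/
lemma exists_integral_eq_int_mul {h : ℝ → ℝ} {L : ℝ → ℂ} {b : ℝ} (hb : b ≠ 0) (hc : Continuous h)
    (hL : ∀ t, HasDerivAt L (2 * Real.pi * Complex.I * (h t / b : ℝ) * L t) t) (h0 : L 0 ≠ 0)
    (h1 : L 1 = L 0) : ∃ k : ℤ, ∫ t in (0 : ℝ)..1, h t = k * b := by
  set J : ℝ → ℝ := fun t ↦ ∫ s in (0 : ℝ)..t, h s with hJ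
  have hJd : ∀ t, HasDerivAt J (h t) t := fun t ↦ (hc.integral_hasStrictDerivAt 0 t).hasDerivAt
  have hF : ∀ t, HasDerivAt
      (fun t ↦ L t * Complex.exp (-(2 * Real.pi * Complex.I) * (J t / b : ℝ))) 0 t := by
    intro t
    have e1 : HasDerivAt (fun t ↦ ((J t / b : ℝ) : ℂ)) ((h t / b : ℝ) : ℂ) t :=
      ((hJd t).div_const b).ofReal_comp
    have e2 := (hL t).mul ((e1.const_mul (-(2 * Real.pi * Complex.I))).cexp)
    refine e2.congr_deriv ?_
    ring
  have hconst := is_const_of_deriv_eq_zero (fun t ↦ (hF t).differentiableAt)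
    (fun t ↦ (hF t).deriv) 1 0
  have hJ0 : J 0 = 0 := by simp [hJ]
  simp only [hJ0, h1, zero_div, Complex.ofReal_zero, mul_zero, Complex.exp_zero] at hconst
  have h2 := mul_left_cancel₀ h0 hconst
  obtain ⟨n, hn⟩ := Complex.exp_eq_one_iff.1 h2
  refine ⟨-n, ?_⟩
  have h3 : (((J 1 / b : ℝ) : ℂ)) = ((-n : ℝ) : ℂ) := by
    have hpi : (2 * Real.pi * Complex.I : ℂ) ≠ 0 := Complex.two_pi_I_ne_zero
    apply mul_left_cancel₀ hpi
    push_cast at hn ⊢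
    linear_combination -hn
  have h4 : J 1 / b = -n := by exact_mod_cast h3
  rw [div_eq_iff hb] at h4
  push_cast
  exact h4

/-! ### Curves in a parametrization -/

section FormCurve

variable {F : Type*} [NormedAddCommGroup F] [NormedSpace ℝ F]
  {H : Type*} [TopologicalSpace H] {I : ModelWithCorners ℝ F H}
  {M : Type*} [TopologicalSpace M] [ChartedSpace H M]

/-- A `C^1` curve in a parametrization. -/
lemma IsParamAt.exists_lift {f : F → M} {u : F} (hf : IsParamAt I f u) {γ : ℝ → M} {t : ℝ}
    (hγ : ContMDiffAt 𝓘(ℝ, ℝ) I 1 γ t) (h : γ t = f u) :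
    ∃ c : ℝ → F, ContDiffAt ℝ 1 c t ∧ c t = u ∧ γ =ᶠ[𝓝 t] f ∘ c := by
  refine ⟨hf.localInverse ∘ γ, ?_, ?_, ?_⟩
  · rw [← contMDiffAt_iff_contDiffAt]
    have h1 : ContMDiffAt I 𝓘(ℝ, F) 1 hf.localInverse (γ t) := by
      rw [h]; exact hf.localInverse_contMDiffAt.of_le (by norm_cast)
    exact h1.comp t hγ
  · rw [Function.comp_apply, h, hf.localInverse_left_inv hf.localInverse_mem_target]
  · have h1 := hγ.continuousAt
    rw [ContinuousAt, h] at h1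
    filter_upwards [h1.eventually hf.localInverse_eventuallyEq_right] with s hs
    exact hs.symm

lemma mfderiv_curve {f : F → M} {c : ℝ → F} {γ : ℝ → M} {t : ℝ} (hf : IsParamAt I f (c t))
    (hc : DifferentiableAt ℝ c t) (h : γ =ᶠ[𝓝 t] f ∘ c) :
    (mfderiv 𝓘(ℝ, ℝ) I γ t (1 : ℝ) : F) = dpar I f (c t) (deriv c t) := by
  have h1 := mfderiv_comp t (hf.mdifferentiableAt (by simp)) hc.mdifferentiableAt
  have h2 := h.mfderiv_eq (I := 𝓘(ℝ, ℝ)) (I' := I)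
  rw [mfderiv_eq_fderiv] at h1
  have h3 := congrArg (fun L : ℝ →L[ℝ] F ↦ L 1) (h2.trans h1)
  refine h3.trans ?_
  rw [← fderiv_apply_one_eq_deriv]
  rfl

end FormCurve

/-! ### The logarithmic angle and the periods of the Lee form -/

section LogAngle

variable {E : Type*} [NormedAddCommGroup E] [NormedSpace ℝ E]
  {M : Type*} {φ : Equiv.Perm M} {q : ℝ} {hq : 0 < q}

/-- The function on the cone quotient induced by `exp (2 π i log s / log q)`. -/
def logAngle (φ : Equiv.Perm M) (q : ℝ) (hq : 0 < q) (hq1 : q ≠ 1) : ConeQuotient φ q hq → ℂ :=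
  Quotient.lift (fun p : M × PosReal ↦
      Complex.exp (2 * Real.pi * Complex.I * (Real.log p.2 / Real.log q : ℝ))) (by
    rintro p _ ⟨k, rfl⟩
    have hl : Real.log q ≠ 0 := Real.log_ne_zero_of_pos_of_ne_one hq hq1
    rw [log_coneMap_zpow, Complex.exp_eq_exp_iff_exists_int]
    refine ⟨-k, ?_⟩
    have : (k * Real.log q + Real.log p.2) / Real.log q = k + Real.log p.2 / Real.log q := by
      field_simp
    rw [this]
    push_cast
    ring)

variable [TopologicalSpace M] [ChartedSpace E M]

lemma logAngle_quotParam (hq1 : q ≠ 1) (m : M) (u : E × ℝ) :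
    logAngle φ q hq hq1 (quotParam φ q hq m u) =
      Complex.exp (2 * Real.pi * Complex.I * (u.2 / Real.log q : ℝ)) := by
  change Complex.exp (2 * Real.pi * Complex.I * (Real.log (Real.exp u.2) / Real.log q : ℝ)) = _
  rw [Real.log_exp]

lemma logAngle_ne_zero (hq1 : q ≠ 1) (x : ConeQuotient φ q hq) : logAngle φ q hq hq1 x ≠ 0 := by
  obtain ⟨p, rfl⟩ := coneProj_surjective x
  exact Complex.exp_ne_zero _

variable [ChartedSpace (ModelProd E ℝ) (ConeQuotient φ q hq)]
  {Θ : Π x : ConeQuotient φ q hq, TangentSpace (coneModel E) x →L[ℝ] ℝ} [IsManifold 𝓘(ℝ, E) ∞ M]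

/-- The Lee form in terms of the parametrizations. -/
def IsConeLeeForm (Θ : Π x : ConeQuotient φ q hq, TangentSpace (coneModel E) x →L[ℝ] ℝ) : Prop :=
  ∀ (m : M) (u : E × ℝ), u.1 ∈ (chartAt E m).target → ∀ w,
    Θ (quotParam φ q hq m u) (dpar (coneModel E) (quotParam φ q hq m) u w) = coneLeeForm E w

lemma IsConeLeeForm.local_formula (hΘ : IsConeLeeForm Θ)
    (hp : IsLocalDiffeomorph (coneModel E) (coneModel E) ∞ (coneProj φ q hq))
    {γ : ℝ → ConeQuotient φ q hq} (hγ : ContMDiff 𝓘(ℝ, ℝ) (coneModel E) 1 γ) (t : ℝ) :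
    ∃ (m : M) (c : ℝ → E × ℝ), ContDiffAt ℝ 1 c t ∧ γ =ᶠ[𝓝 t] quotParam φ q hq m ∘ c ∧
      ∀ᶠ s in 𝓝 t, Θ (γ s) (mfderiv 𝓘(ℝ, ℝ) (coneModel E) γ s (1 : ℝ)) = -2 * (deriv c s).2 := by
  obtain ⟨m, u, hu, hx⟩ := exists_quotParam_eq (E := E) (γ t)
  obtain ⟨c, hc, hct, hcγ⟩ := (isParamAt_quotParam hp m hu).exists_lift (hγ t) hx.symm
  refine ⟨m, c, hc, hcγ, ?_⟩
  have hc1 : ∀ᶠ s in 𝓝 t, (c s).1 ∈ (chartAt E m).target := by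
    have h1 : ContinuousAt (fun s ↦ (c s).1) t := hc.continuousAt.fst
    refine h1.eventually ((chartAt E m).open_target.mem_nhds ?_)
    simpa only [hct] using hu
  filter_upwards [hc1, hcγ.eventuallyEq_nhds, hc.eventually (by simp)] with s hs hs' hs''
  have h1 := mfderiv_curve (isParamAt_quotParam hp m hs) (hs''.differentiableAt (by simp)) hs'
  rw [tangent_congr (fun x v ↦ Θ x v) hs'.self_of_nhds h1]
  exact hΘ m _ hs _

/-- Along `γ`, the logarithmic derivative of `logAngle` is `2πi (log s)' / log q`, where `log s` is
any local branch. As `θ(γ') = -2 (log s)'`, this is the equation of `exists_integral_eq_int_mul`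
with `b = -2 log q`. -/
theorem IsConeLeeForm.exists_pathIntegral_eq (hΘ : IsConeLeeForm Θ) (hq1 : q ≠ 1)
    (hp : IsLocalDiffeomorph (coneModel E) (coneModel E) ∞ (coneProj φ q hq))
    {γ : ℝ → ConeQuotient φ q hq} (hγ : ContMDiff 𝓘(ℝ, ℝ) (coneModel E) 1 γ) (h : γ 1 = γ 0) :
    ∃ k : ℤ, pathIntegral Θ γ = k * (-2 * Real.log q) := by
  have hl : Real.log q ≠ 0 := Real.log_ne_zero_of_pos_of_ne_one hq hq1
  refine exists_integral_eq_int_mul (L := fun t ↦ logAngle φ q hq hq1 (γ t)) (by simpa using hl)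
    ?_ ?_ (logAngle_ne_zero hq1 _) (by rw [h])
  · rw [continuous_iff_continuousAt]
    intro t
    obtain ⟨m, c, hc, -, h2⟩ := hΘ.local_formula hp hγ t
    have h3 : ContinuousAt (deriv c) t := by
      have h4 : ContinuousAt (fderiv ℝ c) t :=
        (hc.fderiv_right (m := 0) (by norm_num)).continuousAt
      exact h4.clm_apply continuousAt_const
    exact (continuousAt_const.mul h3.snd).congr (h2.mono fun s hs ↦ hs.symm)
  · intro t
    obtain ⟨m, c, hc, h1, h2⟩ := hΘ.local_formula hp hγ t
    rw [h2.self_of_nhds]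
    have h3 : (fun t ↦ logAngle φ q hq hq1 (γ t)) =ᶠ[𝓝 t]
        fun t ↦ Complex.exp (2 * Real.pi * Complex.I * ((c t).2 / Real.log q : ℝ)) := by
      filter_upwards [h1] with s hs
      rw [hs, Function.comp_apply, logAngle_quotParam]
    have h4 : HasDerivAt (fun s ↦ (c s).2) (deriv c t).2 t := by
      have := (hc.differentiableAt (by simp)).hasDerivAt
      exact (ContinuousLinearMap.snd ℝ E ℝ).hasFDerivAt.comp_hasDerivAt t this
    have h5 := ((h4.div_const (Real.log q)).ofReal_comp.const_mul
      (2 * Real.pi * Complex.I)).cexp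
    rw [show logAngle φ q hq hq1 (γ t) = _ from h3.self_of_nhds]
    refine (h5.congr_of_eventuallyEq h3).congr_deriv ?_
    rw [show -2 * (deriv c t).2 / (-2 * Real.log q) = (deriv c t).2 / Real.log q by field_simp]
    ring

end LogAngle

/-! ### Smooth paths -/

section Paths

variable {E : Type*} [NormedAddCommGroup E] [NormedSpace ℝ E]
  {M : Type*} [TopologicalSpace M] [ChartedSpace E M]

/-- There is a smooth path from `x` to `y` that is constant outside of `[0, 1]`. -/
def SmoothlyJoined (E : Type*) [NormedAddCommGroup E] [NormedSpace ℝ E]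
    {M : Type*} [TopologicalSpace M] [ChartedSpace E M] (x y : M) : Prop :=
  ∃ α : ℝ → M, ContMDiff 𝓘(ℝ, ℝ) 𝓘(ℝ, E) ∞ α ∧ (∀ t ≤ 0, α t = x) ∧ ∀ t, 1 ≤ t → α t = y

lemma SmoothlyJoined.trans {x y z : M} (h : SmoothlyJoined E x y) (h' : SmoothlyJoined E y z) :
    SmoothlyJoined E x z := by
  obtain ⟨α, hα, hα0, hα1⟩ := h
  obtain ⟨β, hβ, hβ0, hβ1⟩ := h'
  have ha : ContMDiff 𝓘(ℝ, ℝ) 𝓘(ℝ, E) ∞ (fun t : ℝ ↦ α (3 * t)) :=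
    hα.comp (contDiff_const.mul contDiff_id).contMDiff
  have hb : ContMDiff 𝓘(ℝ, ℝ) 𝓘(ℝ, E) ∞ (fun t : ℝ ↦ β (3 * t - 2)) :=
    hβ.comp ((contDiff_const.mul contDiff_id).sub contDiff_const).contMDiff
  -- The first path ends at time `1/3` and the second starts at `2/3`. In between both are
  -- constantly `y`, so near each time the concatenation equals one of the two smooth curves.
  refine ⟨fun t ↦ if t ≤ 1 / 2 then α (3 * t) else β (3 * t - 2), fun t ↦ ?_, fun t ht ↦ ?_,
    fun t ht ↦ ?_⟩
  · rcases lt_or_ge t (2 / 3) with ht | ht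
    · refine (ha t).congr_of_eventuallyEq ?_
      filter_upwards [Iio_mem_nhds ht] with s hs
      have hs : s < 2 / 3 := hs
      split_ifs with h
      · rfl
      · rw [hβ0 _ (by linarith), hα1 _ (by linarith)]
    · refine (hb t).congr_of_eventuallyEq ?_
      filter_upwards [Ioi_mem_nhds (show 1 / 3 < t by linarith)] with s hs
      have hs : 1 / 3 < s := hs
      split_ifs with h
      · rw [hβ0 _ (by linarith), hα1 _ (by linarith)]
      · rfl
  · simp only
    rw [if_pos (by linarith), hα0 _ (by linarith)]
  · simp only
    rw [if_neg (by linarith), hβ1 _ (by linarith)]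

/-- A segment in the chart, reparametrized by a smooth step so that it is constant outside `[0, 1]`.
-/
lemma smoothlyJoined_chart [IsManifold 𝓘(ℝ, E) ∞ M] (m : M) {V : Set E} (hV : Convex ℝ V)
    (hVt : V ⊆ (chartAt E m).target) {u v : E} (hu : u ∈ V) (hv : v ∈ V) :
    SmoothlyJoined E ((chartAt E m).symm u) ((chartAt E m).symm v) := by
  refine ⟨fun t ↦ (chartAt E m).symm (u + Real.smoothTransition t • (v - u)), fun t ↦ ?_,
    fun t ht ↦ ?_, fun t ht ↦ ?_⟩
  · have h1 : ContDiff ℝ ∞ (fun t : ℝ ↦ u + Real.smoothTransition t • (v - u)) :=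
      contDiff_const.add (Real.smoothTransition.contDiff.smul contDiff_const)
    have h2 : u + Real.smoothTransition t • (v - u) ∈ (chartAt E m).target :=
      hVt (hV.add_smul_sub_mem hu hv
        ⟨Real.smoothTransition.nonneg t, Real.smoothTransition.le_one t⟩)
    exact ContMDiffAt.comp t (isParamAt_chartAt_symm m h2).contMDiffAt h1.contMDiff.contMDiffAt
  · simp [Real.smoothTransition.zero_of_nonpos ht]
  · simp [Real.smoothTransition.one_of_one_le ht]

/-- Nearby points are joined inside a chart ball; transitivity and connectedness do the rest. -/
lemma smoothlyJoined [IsManifold 𝓘(ℝ, E) ∞ M] [PreconnectedSpace M] (x y : M) :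
    SmoothlyJoined E x y := by
  refine PreconnectedSpace.induction₂' (SmoothlyJoined E) (fun m ↦ ?_) ⟨fun _ _ _ ↦ SmoothlyJoined.trans⟩ x y
  obtain ⟨r, hr, hb⟩ := Metric.isOpen_iff.1 (chartAt E m).open_target _ (mem_chart_target E m)
  have hs := (chartAt E m).open_source.mem_nhds (mem_chart_source E m)
  have hc : ContinuousAt (chartAt E m) m := (chartAt E m).continuousAt (mem_chart_source E m)
  filter_upwards [hs, hc (Metric.ball_mem_nhds _ hr)] with y hy hy'
  have h0 := Metric.mem_ball_self (x := chartAt E m m) hr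
  have h1 := smoothlyJoined_chart m (convex_ball _ r) hb h0 hy'
  have h2 := smoothlyJoined_chart m (convex_ball _ r) hb hy' h0
  rw [(chartAt E m).left_inv hy, (chartAt E m).left_inv (mem_chart_source E m)] at h1 h2
  exact ⟨h1, h2⟩

end Paths

/-! ### The rank -/

/-- An infinite cyclic group is isomorphic to `ℤ` through `n ↦ Q ^ n`. -/
lemma rank_additive_zpowers {G : Type*} [CommGroup G] {Q : G} (h : ∀ n : ℤ, Q ^ n = 1 → n = 0) :
    Module.rank ℤ (Additive (Subgroup.zpowers Q)) = 1 := by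
  let v : Additive (Subgroup.zpowers Q) := Additive.ofMul ⟨Q, Subgroup.mem_zpowers Q⟩
  have hv : ∀ n : ℤ, ((Additive.toMul (n • v) : Subgroup.zpowers Q) : G) = Q ^ n := fun n ↦ by
    simp [v]
  have hinj : Function.Injective (LinearMap.toSpanSingleton ℤ _ v) := by
    rw [injective_iff_map_eq_zero]
    intro n hn
    refine h n ?_
    rw [← hv n, ← LinearMap.toSpanSingleton_apply, hn]
    rfl
  have hsurj : Function.Surjective (LinearMap.toSpanSingleton ℤ _ v) := by
    rintro w
    obtain ⟨⟨g, n, hn⟩, rfl⟩ := Additive.ofMul.surjective w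
    refine ⟨n, Additive.toMul.injective (Subtype.ext ?_)⟩
    rw [LinearMap.toSpanSingleton_apply, hv]
    exact hn
  have e := LinearEquiv.lift_rank_eq (LinearEquiv.ofBijective _ ⟨hinj, hsurj⟩)
  rw [CommSemiring.rank_self, Cardinal.lift_one] at e
  exact (Cardinal.lift_eq_one.1 e.symm)

section Rank

variable {E : Type*} [NormedAddCommGroup E] [NormedSpace ℝ E]
  {M : Type*} [TopologicalSpace M] [ChartedSpace E M] [IsManifold 𝓘(ℝ, E) ∞ M]
  {φ : Equiv.Perm M} {q : ℝ} {hq : 0 < q}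
  [ChartedSpace (ModelProd E ℝ) (ConeQuotient φ q hq)]
  {Θ : Π x : ConeQuotient φ q hq, TangentSpace (coneModel E) x →L[ℝ] ℝ}

/-- The loop in the cone quotient given by a path from `m` to `φ m`. -/
lemma exists_loop [PreconnectedSpace M]
    (hp : IsLocalDiffeomorph (coneModel E) (coneModel E) ∞ (coneProj φ q hq))
    (hΘ : ∀ (p : M × PosReal) (v : TangentSpace (coneModel E) p),
      Θ (coneProj φ q hq p) (mfderiv (coneModel E) (coneModel E) (coneProj φ q hq) p v)
        = -2 * ds p v / (p.2 : ℝ)) (x₀ : ConeQuotient φ q hq) :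
    ∃ γ : ℝ → ConeQuotient φ q hq, ContMDiff 𝓘(ℝ, ℝ) (coneModel E) 1 γ ∧ γ 0 = x₀ ∧ γ 1 = x₀ ∧
      pathIntegral Θ γ = -2 * Real.log q := by
  obtain ⟨⟨m, s⟩, rfl⟩ := coneProj_surjective x₀
  obtain ⟨α, hα, hα0, hα1⟩ := smoothlyJoined (E := E) m (φ m)
  have hs : (0 : ℝ) < s := s.2
  have hpos : ∀ t : ℝ, 0 < s * Real.exp (t * Real.log q) := fun t ↦
    mul_pos hs (Real.exp_pos _)
  -- Moving `s` exponentially to `q s` gives `β 1 = φ_q (β 0)`, so the projection is a loop, and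
  -- makes the integrand constantly equal to `-2 log q`.
  set β : ℝ → M × PosReal := fun t ↦ (α t, ⟨s * Real.exp (t * Real.log q), hpos t⟩) with hβ
  have hβs : ContMDiff 𝓘(ℝ, ℝ) (coneModel E) ∞ β := by
    refine hα.prodMk fun t ↦ ?_
    rw [← ContMDiffAt.subtypeVal_comp_iff]
    have : ContDiff ℝ ∞ (fun t : ℝ ↦ (s : ℝ) * Real.exp (t * Real.log q)) :=
      contDiff_const.mul (Real.contDiff_exp.comp (contDiff_id.mul contDiff_const))
    exact this.contMDiff t
  refine ⟨coneProj φ q hq ∘ β, (hp.contMDiff.comp hβs).of_le (by norm_cast), ?_, ?_, ?_⟩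
  · refine congrArg _ (Prod.ext (hα0 0 le_rfl) (Subtype.ext ?_))
    simp [hβ]
  · refine (coneProj_eq_iff.2 ⟨1, ?_⟩).symm
    rw [zpow_one, coneMap_apply]
    refine Prod.ext (hα1 1 le_rfl).symm (Subtype.ext ?_)
    simp [hβ, Real.exp_log hq, mul_comm]
  · have key : ∀ t : ℝ, Θ ((coneProj φ q hq ∘ β) t)
        (mfderiv 𝓘(ℝ, ℝ) (coneModel E) (coneProj φ q hq ∘ β) t (1 : ℝ)) = -2 * Real.log q := by
      intro t
      have hβd : MDifferentiableAt 𝓘(ℝ, ℝ) (coneModel E) β t :=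
        (hβs t).mdifferentiableAt (by simp)
      have h1 := mfderiv_comp t ((hp (β t)).mdifferentiableAt (by simp)) hβd
      have h2 : (mfderiv 𝓘(ℝ, ℝ) (coneModel E) (coneProj φ q hq ∘ β) t (1 : ℝ) : E × ℝ) =
          mfderiv (coneModel E) (coneModel E) (coneProj φ q hq) (β t)
            (mfderiv 𝓘(ℝ, ℝ) (coneModel E) β t (1 : ℝ)) :=
        congrArg (fun L : ℝ →L[ℝ] E × ℝ ↦ L 1) h1
      have h3 : MDifferentiableAt (coneModel E) 𝓘(ℝ, ℝ) (fun p : M × PosReal ↦ (p.2 : ℝ)) (β t) :=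
        ((contMDiff_subtype_val (n := ∞).comp contMDiff_snd) _).mdifferentiableAt (by simp)
      have h4 := mfderiv_comp t h3 hβd
      rw [mfderiv_eq_fderiv] at h4
      have h5 : HasDerivAt (fun t : ℝ ↦ (s : ℝ) * Real.exp (t * Real.log q))
          (s * (Real.exp (t * Real.log q) * (1 * Real.log q))) t :=
        (((hasDerivAt_id t).mul_const (Real.log q)).exp).const_mul (s : ℝ)
      have h6 : ds (β t) (mfderiv 𝓘(ℝ, ℝ) (coneModel E) β t (1 : ℝ)) =
          s * (Real.exp (t * Real.log q) * (1 * Real.log q)) := by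
        have h7 := congrArg (fun L : ℝ →L[ℝ] ℝ ↦ L 1) h4
        refine h7.symm.trans ?_
        have h8 := h5.deriv
        rw [← fderiv_apply_one_eq_deriv] at h8
        exact h8
      rw [tangent_congr (fun x v ↦ Θ x v) rfl h2]
      refine (hΘ (β t) _).trans ?_
      rw [h6]
      change -2 * _ / (s * Real.exp (t * Real.log q)) = _
      have := Real.exp_pos (t * Real.log q)
      field_simp
    unfold pathIntegral
    simp_rw [key]
    simp

/-- Every period of `Θ` at `x₀` is an integer multiple of `-2 log q`, and that value occurs. Hence
`Im χ` is generated by `exp(2 log q) = q²`, which has infinite order as `q ≠ 1`. -/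
theorem IsConeLeeForm.lchRank_eq_one [PreconnectedSpace M] (hΘ : IsConeLeeForm Θ) (hq1 : q ≠ 1)
    (hp : IsLocalDiffeomorph (coneModel E) (coneModel E) ∞ (coneProj φ q hq))
    (hΘ' : ∀ (p : M × PosReal) (v : TangentSpace (coneModel E) p),
      Θ (coneProj φ q hq p) (mfderiv (coneModel E) (coneModel E) (coneProj φ q hq) p v)
        = -2 * ds p v / (p.2 : ℝ)) (x₀ : ConeQuotient φ q hq) : lchRank Θ x₀ = 1 := by
  have hl : Real.log q ≠ 0 := Real.log_ne_zero_of_pos_of_ne_one hq hq1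
  set Q : ℝˣ := Units.mk0 (Real.exp (2 * Real.log q)) (Real.exp_ne_zero _) with hQ
  have hQn : ∀ n : ℤ, ((Q ^ n : ℝˣ) : ℝ) = Real.exp (n * (2 * Real.log q)) := fun n ↦ by
    rw [Units.val_zpow_eq_zpow_val, hQ, Units.val_mk0, mul_comm (n : ℝ),
      Real.exp_mul (2 * Real.log q), Real.rpow_intCast]
  have hgrp : homothetyGroup Θ x₀ = Subgroup.zpowers Q := by
    refine le_antisymm ((Subgroup.closure_le _).2 ?_) ?_
    · rintro w ⟨γ, hγ, h0, h1, hw⟩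
      obtain ⟨k, hk⟩ := hΘ.exists_pathIntegral_eq hq1 hp hγ (h1.trans h0.symm)
      refine ⟨k, Units.ext ?_⟩
      change ((Q ^ k : ℝˣ) : ℝ) = w
      rw [hQn, hw, hk]
      congr 1; ring
    · rw [Subgroup.zpowers_le]
      obtain ⟨γ, hγ, h0, h1, hint⟩ := exists_loop hp hΘ' x₀
      refine Subgroup.subset_closure ⟨γ, hγ, h0, h1, ?_⟩
      rw [hint, hQ, Units.val_mk0]
      congr 1; ring
  unfold lchRank
  rw [hgrp]
  refine rank_additive_zpowers fun n hn ↦ ?_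
  have h1 := hQn n
  rw [hn, Units.val_one, eq_comm, Real.exp_eq_one_iff] at h1
  simpa [hl] using h1

end Rank

/-! ### Scaling the metric of a statistical manifold -/

section Scale

variable {F : Type*} [NormedAddCommGroup F] [NormedSpace ℝ F] [FiniteDimensional ℝ F]
  {H : Type*} [TopologicalSpace H] {I : ModelWithCorners ℝ F H}
  {M : Type*} [TopologicalSpace M] [ChartedSpace H M] [IsManifold I ∞ M]

/-- The metric `a g`. -/
def scaleMetric (a : ℝ) (ha : 0 < a) (g : RiemMetric I M) : RiemMetric I M where
  inner x := a • g.inner x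
  symm x v w := congrArg (a * ·) (g.symm x v w)
  pos x v hv := mul_pos ha (g.pos x v hv)
  isVonNBounded x := isVonNBounded_of_posDef (F := F) (a • g.inner x)
    fun v hv ↦ mul_pos ha (g.pos x v hv)
  contMDiff := ContMDiff.const_smul_section (a := a) g.contMDiff

lemma scaleMetric_inner {a : ℝ} (ha : 0 < a) (g : RiemMetric I M) (x : M)
    (v w : TangentSpace I x) : (scaleMetric a ha g).inner x v w = a * g.inner x v w := rfl

variable {D : Connection I M} {g : RiemMetric I M} {a : ℝ}

lemma nablaMetric_scaleMetric (ha : 0 < a) {X Y Z : Π x : M, TangentSpace I x}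
    (hY : SmoothVF Y) (hZ : SmoothVF Z) (x : M) :
    nablaMetric D (scaleMetric a ha g) X Y Z x = a * nablaMetric D g X Y Z x := by
  have hs : MDifferentiableAt I 𝓘(ℝ, ℝ) (fun y ↦ g.inner y (Y y) (Z y)) x :=
    (contMDiffAt_inner g (hY _) (hZ _)).mdifferentiableAt (by simp)
  have h1 : mvfderiv I (fun y ↦ (scaleMetric a ha g).inner y (Y y) (Z y)) x (X x) =
      a * mvfderiv I (fun y ↦ g.inner y (Y y) (Z y)) x (X x) :=
    congrArg (fun L : F →L[ℝ] ℝ ↦ L (X x)) (const_smul_mfderiv hs a)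
  unfold nablaMetric
  rw [h1]
  simp only [scaleMetric_inner]
  ring

lemma IsStatistical.scaleMetric (h : IsStatistical D g) (ha : 0 < a) :
    IsStatistical D (scaleMetric a ha g) := by
  refine ⟨h.smooth, h.torsionFree, fun X Y Z hX hY hZ x ↦ ?_⟩
  rw [nablaMetric_scaleMetric ha hY hZ, nablaMetric_scaleMetric ha hX hZ,
    nablaMetric_scaleMetric ha hZ hY]
  obtain ⟨h1, h2⟩ := h.symmetric X Y Z hX hY hZ x
  exact ⟨congrArg _ h1, congrArg _ h2⟩

/-- The curvature of `D` does not involve the metric, so the factor `a` may be absorbed into it. -/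
lemma HasConstantCurvature.scaleMetric (h : HasConstantCurvature D g a) (ha : 0 < a) :
    HasConstantCurvature D (scaleMetric a ha g) 1 := by
  intro X Y Z hX hY hZ x
  rw [h X Y Z hX hY hZ x, scaleMetric_inner, scaleMetric_inner, one_smul, smul_sub, smul_smul,
    smul_smul]

lemma IsStatisticalAut.scaleMetric {φ : Diffeomorph I I M M ∞} (h : IsStatisticalAut D g φ)
    (ha : 0 < a) : IsStatisticalAut D (scaleMetric a ha g) φ :=
  ⟨fun x v w ↦ congrArg (a * ·) (h.metric x v w), h.connection⟩

end Scale

/-! ### The radiant structures on the cone quotient -/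

section Main

variable {E : Type*} [NormedAddCommGroup E] [NormedSpace ℝ E] [FiniteDimensional ℝ E]
  {M : Type*} [TopologicalSpace M] [ChartedSpace E M] [IsManifold 𝓘(ℝ, E) ∞ M]
  [T2Space M] [ConnectedSpace M]
  {φ : Equiv.Perm M} {q : ℝ} {hq : 0 < q}
  [ChartedSpace (ModelProd E ℝ) (ConeQuotient φ q hq)]
  [IsManifold (coneModel E) ∞ (ConeQuotient φ q hq)] [T2Space (ConeQuotient φ q hq)]
  {gM : RiemMetric 𝓘(ℝ, E) M} {D : Connection 𝓘(ℝ, E) M} {c : ℝ}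

theorem exists_radiantLCH
    (hp : IsLocalDiffeomorph (coneModel E) (coneModel E) ∞ (coneProj φ q hq)) (hq1 : q ≠ 1)
    (hstat : IsStatistical D gM) (hcurv : HasConstantCurvature D gM c)
    (hφ : φ ∈ paramInvariants D gM) {l : ℝ} (hl : l * (2 - l) = c) :
    ∃ (N : Connection (coneModel E) (ConeQuotient φ q hq))
      (g : RiemMetric (coneModel E) (ConeQuotient φ q hq))
      (θ : Π x : ConeQuotient φ q hq, TangentSpace (coneModel E) x →L[ℝ] ℝ)
      (ξ : Π x : ConeQuotient φ q hq, TangentSpace (coneModel E) x),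
      ((∀ (p : M × PosReal) (v w : TangentSpace (coneModel E) p),
        g.inner (coneProj φ q hq p)
            (mfderiv (coneModel E) (coneModel E) (coneProj φ q hq) p v)
            (mfderiv (coneModel E) (coneModel E) (coneProj φ q hq) p w)
          = gM.inner p.1 (dfst p v) (dfst p w) + ds p v * ds p w / (p.2 : ℝ) ^ 2) ∧
      (∀ (p : M × PosReal) (v : TangentSpace (coneModel E) p),
        θ (coneProj φ q hq p)
            (mfderiv (coneModel E) (coneModel E) (coneProj φ q hq) p v)
          = -2 * ds p v / (p.2 : ℝ)) ∧
      (∀ p : M × PosReal,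
        ξ (coneProj φ q hq p)
          = mfderiv (coneModel E) (coneModel E) (coneProj φ q hq) p ((-2 : ℝ) • sds p)) ∧
      IsLCH N g θ ∧ IsLeeField g θ ξ ∧ IsKilling g ξ ∧ IsAffineField N ξ ∧
      NablaEqSmulId N ξ (-2 * l) ∧
      IsRadiantLCH N g θ ξ ∧ ∀ x₀, lchRank θ x₀ = 1) ∧ ∀ x, g.inner x (ξ x) (ξ x) = 4 := by
  obtain ⟨N, g, θ, ξ, hN, hθ, hξ, h⟩ := exists_isCone hp hφ hstat hcurv l
  have hc := isCone_of_isConeParam h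
  have hform := form_mfderiv_coneProj hp h
  exact ⟨N, g, θ, ξ, ⟨inner_mfderiv_coneProj hp h, hform, field_coneProj hp h,
    hc.isLCH hl hN hθ, hc.isLeeField, hc.isKilling hξ, hc.isAffineField hξ, hc.nablaEqSmulId hξ,
    hc.isRadiantLCH hl hN hθ hξ,
    IsConeLeeForm.lchRank_eq_one (fun m u hu ↦ (h m).form u hu) hq1 hp hform⟩, hc.inner_field⟩

theorem exists_radiantLCH_mu
    (hp : IsLocalDiffeomorph (coneModel E) (coneModel E) ∞ (coneProj φ q hq)) (hq1 : q ≠ 1)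
    (hstat : IsStatistical D gM) (hcurv : HasConstantCurvature D gM c)
    (hφ : φ ∈ paramInvariants D gM) {l : ℝ} (hl : l * (2 - l) = c) :
    ∃ (N : Connection (coneModel E) (ConeQuotient φ q hq))
      (g : RiemMetric (coneModel E) (ConeQuotient φ q hq))
      (θ : Π x : ConeQuotient φ q hq, TangentSpace (coneModel E) x →L[ℝ] ℝ)
      (ξ : Π x : ConeQuotient φ q hq, TangentSpace (coneModel E) x),
      IsRadiantLCH N g θ ξ ∧ (∀ x₀, lchRank θ x₀ = 1) ∧
      (c ≠ 0 → ∃ μ : ℝ, NablaEqSmulId N ξ μ ∧ μ ≠ 0 ∧ ∀ x, μ ≠ -g.inner x (ξ x) (ξ x)) := by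
  obtain ⟨N, g, θ, ξ, ⟨-, -, -, -, -, -, -, hnabla, hrad, hrank⟩, h4⟩ :=
    exists_radiantLCH hp hq1 hstat hcurv hφ hl
  refine ⟨N, g, θ, ξ, hrad, hrank, fun hc ↦ ⟨-2 * l, hnabla, fun h0 ↦ hc ?_, fun x hx ↦ hc ?_⟩⟩
  -- `μ = 0` means `l = 0` and `μ = -4` means `l = 2`; either gives `c = l (2 - l) = 0`.
  · rw [← hl]
    linear_combination (-(2 - l) / 2) * h0
  · rw [h4] at hx
    rw [← hl]
    linear_combination (l / 2) * hx

end Main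

end LCHGeometry

end

/-! ### The theorem -/

open LCHGeometry in
theorem theoremt1
    {E : Type*} [NormedAddCommGroup E] [NormedSpace ℝ E] [FiniteDimensional ℝ E]
    {M : Type*} [TopologicalSpace M] [ChartedSpace E M] [IsManifold 𝓘(ℝ, E) ∞ M]
    [T2Space M] [SecondCountableTopology M] [ConnectedSpace M]
    (gM : RiemMetric 𝓘(ℝ, E) M) (D : Connection 𝓘(ℝ, E) M) (c : ℝ)
    (hstat : IsStatistical D gM) (hcurv : HasConstantCurvature D gM c)
    (φ : Diffeomorph 𝓘(ℝ, E) 𝓘(ℝ, E) M M ∞) (hφ : IsStatisticalAut D gM φ)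
    (q : ℝ) (hq : 0 < q) (hq1 : q ≠ 1) :
    ∃ (_ : ChartedSpace (ModelProd E ℝ) (ConeQuotient φ.toEquiv q hq))
      (_ : IsManifold (coneModel E) ∞ (ConeQuotient φ.toEquiv q hq)),
      T2Space (ConeQuotient φ.toEquiv q hq) ∧
      SecondCountableTopology (ConeQuotient φ.toEquiv q hq) ∧
      IsLocalDiffeomorph (coneModel E) (coneModel E) ∞ (coneProj φ.toEquiv q hq) ∧
      (∀ l : ℝ, l * (2 - l) = c →
        ∃ (N : Connection (coneModel E) (ConeQuotient φ.toEquiv q hq))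
          (g : RiemMetric (coneModel E) (ConeQuotient φ.toEquiv q hq))
          (θ : Π x : ConeQuotient φ.toEquiv q hq, TangentSpace (coneModel E) x →L[ℝ] ℝ)
          (ξ : Π x : ConeQuotient φ.toEquiv q hq, TangentSpace (coneModel E) x),
          (∀ (p : M × PosReal) (v w : TangentSpace (coneModel E) p),
            g.inner (coneProj φ.toEquiv q hq p)
                (mfderiv (coneModel E) (coneModel E) (coneProj φ.toEquiv q hq) p v)
                (mfderiv (coneModel E) (coneModel E) (coneProj φ.toEquiv q hq) p w)
              = gM.inner p.1 (dfst p v) (dfst p w) + ds p v * ds p w / (p.2 : ℝ) ^ 2) ∧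
          (∀ (p : M × PosReal) (v : TangentSpace (coneModel E) p),
            θ (coneProj φ.toEquiv q hq p)
                (mfderiv (coneModel E) (coneModel E) (coneProj φ.toEquiv q hq) p v)
              = -2 * ds p v / (p.2 : ℝ)) ∧
          (∀ p : M × PosReal,
            ξ (coneProj φ.toEquiv q hq p)
              = mfderiv (coneModel E) (coneModel E) (coneProj φ.toEquiv q hq) p
                  ((-2 : ℝ) • sds p)) ∧
          IsLCH N g θ ∧ IsLeeField g θ ξ ∧ IsKilling g ξ ∧ IsAffineField N ξ ∧
          NablaEqSmulId N ξ (-2 * l) ∧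
          IsRadiantLCH N g θ ξ ∧ ∀ x₀, lchRank θ x₀ = 1) ∧
      ∃ (N : Connection (coneModel E) (ConeQuotient φ.toEquiv q hq))
        (g : RiemMetric (coneModel E) (ConeQuotient φ.toEquiv q hq))
        (θ : Π x : ConeQuotient φ.toEquiv q hq, TangentSpace (coneModel E) x →L[ℝ] ℝ)
        (ξ : Π x : ConeQuotient φ.toEquiv q hq, TangentSpace (coneModel E) x),
        IsRadiantLCH N g θ ξ ∧ (∀ x₀, lchRank θ x₀ = 1) ∧
        (c ≠ 0 → ∃ μ : ℝ, NablaEqSmulId N ξ μ ∧ μ ≠ 0 ∧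
          ∀ x, μ ≠ -g.inner x (ξ x) (ξ x)) := by
  have hφ' := hφ.mem_paramInvariants
  have hk : ∀ k : ℤ, ContMDiff 𝓘(ℝ, E) 𝓘(ℝ, E) ∞ (φ.toEquiv ^ k : Equiv.Perm M) :=
    fun k ↦ (zpow_mem hφ' k).1
  obtain ⟨hC, hM, hp⟩ := exists_manifold_coneQuotient (φ := φ.toEquiv) (hq := hq) hq1 hk
  have hT : T2Space (ConeQuotient φ.toEquiv q hq) :=
    t2Space_coneQuotient hq1 fun k ↦ (hk k).continuous
  refine ⟨hC, hM, hT, secondCountableTopology_coneQuotient fun k ↦ (hk k).continuous, hp,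
    fun l hl ↦ ?_, ?_⟩
  · obtain ⟨N, g, θ, ξ, h, -⟩ := exists_radiantLCH hp hq1 hstat hcurv hφ' hl
    exact ⟨N, g, θ, ξ, h⟩
  · rcases le_or_gt c 1 with hc | hc
    -- A root of `l (2 - l) = c`, equivalently `(l - 1)² = 1 - c`.
    · refine exists_radiantLCH_mu hp hq1 hstat hcurv hφ' (l := 1 + Real.sqrt (1 - c)) ?_
      linear_combination -Real.sq_sqrt (sub_nonneg.2 hc)
    -- There is no real root. The metric `c g_M` with the same `D` has curvature constant `1`, for
    -- which `l = 1` is a root and `1 ≠ 0` gives the condition on `μ`.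
    · have hc0 : 0 < c := one_pos.trans hc
      obtain ⟨N, g, θ, ξ, hrad, hrank, h⟩ := exists_radiantLCH_mu hp hq1 (hstat.scaleMetric hc0)
        (hcurv.scaleMetric hc0) (hφ.scaleMetric hc0).mem_paramInvariants (l := 1) (by norm_num)
      exact ⟨N, g, θ, ξ, hrad, hrank, fun _ ↦ h one_ne_zero⟩
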